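/- Lemma 3.5. Notation. For $\lambda>1$ let $\mathbb{T}_\lambda=\mathbb{R}/(2\pi\lambda\mathbb{Z})$. For $u:\mathbb{R}\times\mathbb{T}_\lambda\times\mathbb{R}\to\mathbb{C}$, a function of $(x,y,t)$, let $$\widehat u(\xi,q,\tau)=\int_{\mathbb{R}^2}\int_0^{2\pi\lambda}e^{-i(t\tau+x\xi+yq)}u(x,y,t)\,dy\,dx\,dt,\qquad (\xi,q,\tau)\in\mathbb{R}\times\tfrac1\lambda\mathbb{Z}\times\mathbb{R},$$ be its Fourier transform (for $u\in L^2$ in the sense of Plancherel: the $L^2$-limit of the transforms of the truncations of $u$ to $|x|,|t|\le n$). Put $|(\xi,q)|=(3\xi^2+q^2)^{1/2}$, $\langle a\rangle=1+|a|$, $\sigma(\xi,q)=\xi^3+\xi q^2$ and, for $s,b\in\mathbb{R}$, $$\|u\|_{X^{s,b}_\lambda}=\Big(\frac1\lambda\sum_{q\in\mathbb{Z}/\lambda}\int_{\mathbb{R}^2}\langle\tau-\sigma(\xi,q)\rangle^{2b}\,\langle|(\xi,q)|\rangle^{2s}\,|\widehat u(\xi,q,\tau)|^2\,d\xi\,d\tau\Big)^{1/2}\in[0,\infty].$$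 For $s\in\mathbb{R}$ and $N\in\{2^j: j=0,1,2,\dots\}$ let $m:\mathbb{R}^2\to\mathbb{R}$ be any smooth function that is radially symmetric and non-increasing with respect to $|\cdot|$ and satisfies $m(\zeta)=1$ for $|\zeta|\le N$ and $m(\zeta)=(|\zeta|/N)^{s-1}$ for $|\zeta|\ge 2N$ (such $m$ exist only for $s\le 1$). The operators $I$ and $\partial_x$ act on the Fourier side as multiplication by $m(\xi,q)$ and by $i\xi$, respectively. Statement. Let $s>9/10$. There is $\varepsilon_0>0$, depending only on $s$, such that for all $0<\varepsilon\le\varepsilon_0$ and all $\delta>0$ there is a constant $C$, depending only on $s,\varepsilon,\delta$ (in particular not on $\lambda$, $N$ or $m$), with the following property: for all $N$ and $m$ as above, all $\lambda>1$ and all $u,v\in L^2(\mathbb{R}\times\mathbb{T}_\lambda\times\mathbb{R};\mathbb{C})$, $$\|\partial_x I(uv)\|_{X^{1,-1/2+\varepsilon}_\lambda}\le C\,\|Iu\|_{X^{1,1/2+\delta}_\lambda}\,\|Iv\|_{X^{1,1/2+\delta}_\lambda}.$$ In particular the left-hand side is finite whenever $Iu,Iv\in X^{1,1/2+\delta}_\lambda$.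 (Any $u$ with $Iu\in X^{1,1/2+\delta}_\lambda$ lies in $L^2$, so $L^2$ is no restriction.) -/

import Mathlib

open MeasureTheory Filter Topology
open scoped ENNReal NNReal ContDiff

noncomputable section

namespace ZK

instance factPeriodPos (lam : ℝ) [h : Fact (1 < lam)] : Fact (0 < 2 * Real.pi * lam) :=
  ⟨mul_pos Real.two_pi_pos (lt_trans one_pos h.out)⟩

/-- Space-time `ℝ × 𝕋_λ × ℝ` with points `(x, y, t)`, where `𝕋_λ = ℝ / (2πλℤ)`. Its volume is
`dx dy dt`, the circle having total mass `2πλ`. -/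
abbrev SpaceTime (lam : ℝ) : Type := ℝ × AddCircle (2 * Real.pi * lam) × ℝ

/-- The norm `|(ξ, q)| = (3 ξ ^ 2 + q ^ 2) ^ (1 / 2)`. -/
def absZeta (ξ q : ℝ) : ℝ := Real.sqrt (3 * ξ ^ 2 + q ^ 2)

/-- The bracket `⟨x⟩ = 1 + |x|`. -/
def bracket (x : ℝ) : ℝ := 1 + |x|

/-- The dispersion relation `σ(ξ, q) = ξ ^ 3 + ξ q ^ 2`. -/
def sigma (ξ q : ℝ) : ℝ := ξ ^ 3 + ξ * q ^ 2

/-- The space-time Fourier integral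
`∫ exp (-i (t τ + x ξ + y q)) f (x, y, t) dx dy dt` at the frequency `(ξ, q, τ)` with
`q = k / λ ∈ ℤ / λ`. Here `fourier (-k) y = exp (-i k y / λ)`. -/
def fourierIntegral (lam : ℝ) [Fact (1 < lam)] (f : SpaceTime lam → ℂ)
    (ξ : ℝ) (k : ℤ) (τ : ℝ) : ℂ :=
  ∫ p : SpaceTime lam,
    Complex.exp (-(Complex.I * ((p.2.2 * τ + p.1 * ξ : ℝ) : ℂ))) * fourier (-k) p.2.1 * f p

/-- The restriction of `u` to `|x| ≤ n`, `|t| ≤ n`, extended by zero. -/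
def truncate {lam : ℝ} (n : ℕ) (u : SpaceTime lam → ℂ) : SpaceTime lam → ℂ :=
  Set.indicator {p | |p.1| ≤ n ∧ |p.2.2| ≤ n} u

/-- `U (ξ, k, τ) = û (ξ, k / λ, τ)` is (a representative of) the Fourier transform of the
square-integrable function `u`: the limit in `L²` of the Fourier integrals of the truncations of
`u`. By Plancherel's theorem it exists and is unique up to null sets for each `u` in `L²`. -/
structure IsFourierTransformL2 (lam : ℝ) [Fact (1 < lam)] (u : SpaceTime lam → ℂ)
    (U : ℝ → ℤ → ℝ → ℂ) : Prop where
  aestronglyMeasurable : ∀ k : ℤ,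
    AEStronglyMeasurable (fun z : ℝ × ℝ => U z.1 k z.2) volume
  tendsto : Tendsto
    (fun n : ℕ => ∑' k : ℤ, ∫⁻ z : ℝ × ℝ,
      ‖fourierIntegral lam (truncate n u) z.1 k z.2 - U z.1 k z.2‖ₑ ^ 2)
    atTop (𝓝 0)

/-- The norm of the Bourgain space `X^{s,b}_λ`, with values in `[0, ∞]`, of the distribution on
`ℝ × 𝕋_λ × ℝ` with Fourier transform `F (ξ, k, τ)`, `q = k / λ`:
`(λ⁻¹ ∑_q ∫ ⟨τ - σ(ξ, q)⟩ ^ (2 b) ⟨|(ξ, q)|⟩ ^ (2 s) |F| ^ 2 dξ dτ) ^ (1 / 2)`. -/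
def bourgainNorm (lam s b : ℝ) (F : ℝ → ℤ → ℝ → ℂ) : ℝ≥0∞ :=
  (ENNReal.ofReal (1 / lam) * ∑' k : ℤ, ∫⁻ z : ℝ × ℝ,
    ENNReal.ofReal
      (bracket (z.2 - sigma z.1 (k / lam)) ^ (2 * b) *
        bracket (absZeta z.1 (k / lam)) ^ (2 * s)) * ‖F z.1 k z.2‖ₑ ^ 2) ^ (1 / 2 : ℝ)

/-- The symbols `m (ξ, q)` admitted for the operator `I` with parameters `s` and `N`. -/
structure IsSymbolI (s N : ℝ) (m : ℝ × ℝ → ℝ) : Prop where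
  smooth : ContDiff ℝ ∞ m
  radial : ∀ z w : ℝ × ℝ, absZeta z.1 z.2 = absZeta w.1 w.2 → m z = m w
  nonincreasing : ∀ z w : ℝ × ℝ, absZeta z.1 z.2 ≤ absZeta w.1 w.2 → m w ≤ m z
  eq_low : ∀ z : ℝ × ℝ, absZeta z.1 z.2 ≤ N → m z = 1
  eq_high : ∀ z : ℝ × ℝ, 2 * N ≤ absZeta z.1 z.2 → m z = (absZeta z.1 z.2 / N) ^ (s - 1)

/-- The operator `I` on the Fourier side: multiplication by `m (ξ, q)`, `q = k / λ`. -/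
def opI (lam : ℝ) (m : ℝ × ℝ → ℝ) (F : ℝ → ℤ → ℝ → ℂ) : ℝ → ℤ → ℝ → ℂ :=
  fun ξ k τ => (m (ξ, k / lam) : ℂ) * F ξ k τ

/-- The operator `∂_x` on the Fourier side: multiplication by `i ξ`. -/
def opDx (F : ℝ → ℤ → ℝ → ℂ) : ℝ → ℤ → ℝ → ℂ :=
  fun ξ k τ => Complex.I * (ξ : ℂ) * F ξ k τ

end ZK

end

open FourierTransform ComplexConjugate in
theorem ZK.coeFn_fourier_toLp {f : ℂ → ℂ} (h1 : Integrable f) (h2 : MemLp f 2) :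
    (𝓕 (h2.toLp f) : Lp ℂ 2 (volume : Measure ℂ)) =ᵐ[volume] 𝓕 f := by
  refine ae_eq_of_integral_contDiff_smul_eq ((Lp.memLp _).locallyIntegrable (by norm_num)) ?_ ?_
  · refine Continuous.locallyIntegrable ?_
    exact VectorFourier.fourierIntegral_continuous Real.continuous_fourierChar
      (by exact continuous_inner) h1
  · intro g hg hgc
    have hc : HasCompactSupport (fun x => (g x : ℂ)) := hgc.comp_left (g := fun x : ℝ => (x : ℂ)) (by simp)
    have hs : ContDiff ℝ ∞ (fun x => (g x : ℂ)) := Complex.ofRealCLM.contDiff.comp hg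
    set G := hc.toSchwartzMap hs
    have hGx : ∀ x, G x = (g x : ℂ) := fun x => rfl
    have e1 := Lp.toTemperedDistribution_apply (𝓕 (h2.toLp f) : Lp ℂ 2 (volume : Measure ℂ)) G
    rw [← Lp.fourier_toTemperedDistribution_eq, TemperedDistribution.fourier_apply,
      Lp.toTemperedDistribution_apply] at e1
    have e2 : ∫ x, (𝓕 G) x • (h2.toLp f) x = ∫ x, 𝓕 (⇑G) x * f x := by
      refine integral_congr_ae ?_
      filter_upwards [h2.coeFn_toLp] with x hx
      rw [hx, SchwartzMap.fourier_coe, smul_eq_mul]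
    have e3 : ∫ x, 𝓕 (⇑G) x * f x = ∫ x, G x * 𝓕 f x :=
      VectorFourier.integral_fourierIntegral_smul_eq_flip (L := innerₗ ℂ) (μ := volume)
        (ν := volume) Real.continuous_fourierChar (by exact continuous_inner) G.integrable h1 |>.trans (by
          simp [FourierTransform.fourier])
    calc _ = ∫ x, G x • (𝓕 (h2.toLp f) : Lp ℂ 2 (volume : Measure ℂ)) x := by
          simp only [hGx, Complex.real_smul, smul_eq_mul]
      _ = ∫ x, G x * 𝓕 f x := by rw [← e1, e2, e3]
      _ = _ := by simp only [hGx, Complex.real_smul]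

namespace ZK

/-- The Fourier integral on `ℝ × ℝ`. -/
noncomputable def planeFourier (f : ℝ × ℝ → ℂ) (z : ℝ × ℝ) : ℂ :=
  ∫ p : ℝ × ℝ, Complex.exp (-(Complex.I * ((p.2 * z.2 + p.1 * z.1 : ℝ) : ℂ))) * f p

theorem lintegral_comp_smul_plane (F : ℝ × ℝ → ℝ≥0∞) {c : ℝ} (hc : 0 < c) :
    ∫⁻ z, F (c • z) = ENNReal.ofReal ((c ^ 2)⁻¹) * ∫⁻ z, F z := by
  have h := Measure.map_addHaar_smul (volume : Measure (ℝ × ℝ)) hc.ne'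
  have hfin : Module.finrank ℝ (ℝ × ℝ) = 2 := by simp
  rw [hfin, abs_of_pos (by positivity)] at h
  have hm : MeasurableEmbedding (fun z : ℝ × ℝ => c • z) :=
    (Homeomorph.smulOfNeZero c hc.ne').measurableEmbedding
  rw [← hm.lintegral_map F, h, lintegral_smul_measure, smul_eq_mul]

open FourierTransform ComplexConjugate

theorem lintegral_fourier_sq {f : ℂ → ℂ} (h1 : Integrable f) (h2 : MemLp f 2) :
    ∫⁻ w, ‖𝓕 f w‖ₑ ^ 2 = ∫⁻ w, ‖f w‖ₑ ^ 2 := by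
  have key : eLpNorm (𝓕 f) 2 volume = eLpNorm f 2 volume := by
    rw [← eLpNorm_congr_ae (coeFn_fourier_toLp h1 h2), ← eLpNorm_congr_ae h2.coeFn_toLp,
      ← Lp.enorm_def, ← Lp.enorm_def, ← ofReal_norm, ← ofReal_norm, Lp.norm_fourier_eq]
  have e (g : ℂ → ℂ) : ∫⁻ w, ‖g w‖ₑ ^ 2 = eLpNorm g 2 volume ^ 2 := by
    have := eLpNorm_nnreal_pow_eq_lintegral (f := g) (μ := volume) (p := 2) (by norm_num)
    simpa using this.symm
  rw [e, e, key]

theorem integral_mul_eq_integral_fourier {f h : ℂ → ℂ} (hf1 : Integrable f) (hf2 : MemLp f 2)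
    (hh1 : Integrable h) (hh2 : MemLp h 2) :
    ∫ w, f w * h w = ∫ w, 𝓕 f w * 𝓕 h (-w) := by
  have hc1 : Integrable (fun w => conj (f w)) := by
    simpa using (Complex.conjCLE.toContinuousLinearMap.integrable_comp hf1)
  have hc2 : MemLp (fun w => conj (f w)) 2 := hf2.star
  have hF : ∀ w, 𝓕 (fun w => conj (f w)) w = conj (𝓕 f (-w)) := by
    intro w
    rw [Real.fourier_eq', Real.fourier_eq', ← integral_conj]
    congr 1; ext v
    simp only [smul_eq_mul, map_mul, ← Complex.exp_conj, Complex.conj_I, Complex.conj_ofReal,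
      inner_neg_right]
    congr 2
    push_cast
    ring
  have key := Lp.inner_fourier_eq (hc2.toLp _) (hh2.toLp h)
  rw [L2.inner_def, L2.inner_def] at key
  have e1 : ∫ w, f w * h w = ∫ a, inner ℂ (hc2.toLp _ a) (hh2.toLp h a) := by
    refine integral_congr_ae ?_
    filter_upwards [hc2.coeFn_toLp, hh2.coeFn_toLp] with a ha hb
    rw [ha, hb]; simp [mul_comm]
  have e2 : ∫ w, 𝓕 f (-w) * 𝓕 h w =
      ∫ a, inner ℂ ((𝓕 (hc2.toLp _) : Lp ℂ 2 (volume : Measure ℂ)) a)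
        ((𝓕 (hh2.toLp h) : Lp ℂ 2 (volume : Measure ℂ)) a) := by
    refine integral_congr_ae ?_
    filter_upwards [coeFn_fourier_toLp hc1 hc2, coeFn_fourier_toLp hh1 hh2] with a ha hb
    rw [ha, hb, hF]; simp [mul_comm]
  rw [e1, ← key, ← e2, ← integral_neg_eq_self]
  simp

/-- The function on `ℂ` corresponding to a function on `ℝ × ℝ`. -/
noncomputable def toComplexPlane (f : ℝ × ℝ → ℂ) : ℂ → ℂ := fun w => f (Complex.measurableEquivRealProd w)

theorem planeFourier_eq (f : ℝ × ℝ → ℂ) (z : ℝ × ℝ) :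
    planeFourier f z =
      𝓕 (toComplexPlane f) (Complex.measurableEquivRealProd.symm ((2 * Real.pi)⁻¹ • z)) := by
  rw [Real.fourier_eq', planeFourier,
    ← Complex.volume_preserving_equiv_real_prod.integral_comp
      Complex.measurableEquivRealProd.measurableEmbedding]
  congr 1; ext v
  simp only [toComplexPlane, smul_eq_mul]
  congr 2
  simp [Complex.inner, Complex.measurableEquivRealProd]
  field_simp
  ring_nf

theorem integrable_toComplexPlane {f : ℝ × ℝ → ℂ} (h : Integrable f) :
    Integrable (toComplexPlane f) :=
  Complex.volume_preserving_equiv_real_prod.integrable_comp_of_integrable h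

theorem memLp_toComplexPlane {f : ℝ × ℝ → ℂ} (h : MemLp f 2) : MemLp (toComplexPlane f) 2 :=
  h.comp_measurePreserving Complex.volume_preserving_equiv_real_prod

theorem lintegral_planeFourier_sq {f : ℝ × ℝ → ℂ} (h1 : Integrable f) (h2 : MemLp f 2) :
    ∫⁻ z, ‖planeFourier f z‖ₑ ^ 2 = ENNReal.ofReal ((2 * Real.pi) ^ 2) * ∫⁻ p, ‖f p‖ₑ ^ 2 := by
  simp_rw [planeFourier_eq]
  rw [lintegral_comp_smul_plane
    (fun z => ‖𝓕 (toComplexPlane f) (Complex.measurableEquivRealProd.symm z)‖ₑ ^ 2)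
    (by positivity),
    Complex.volume_preserving_equiv_real_prod.symm.lintegral_comp_emb
      Complex.measurableEquivRealProd.symm.measurableEmbedding
      (fun w => ‖𝓕 (toComplexPlane f) w‖ₑ ^ 2),
    lintegral_fourier_sq (integrable_toComplexPlane h1) (memLp_toComplexPlane h2)]
  simp only [toComplexPlane]
  rw [Complex.volume_preserving_equiv_real_prod.lintegral_comp_emb
      Complex.measurableEquivRealProd.measurableEmbedding (fun p => ‖f p‖ₑ ^ 2), inv_pow, inv_inv]

theorem integral_mul_eq_integral_planeFourier {f h : ℝ × ℝ → ℂ} (hf1 : Integrable f)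
    (hf2 : MemLp f 2) (hh1 : Integrable h) (hh2 : MemLp h 2) :
    ((2 * Real.pi) ^ 2 : ℝ) • ∫ p, f p * h p =
      ∫ z, planeFourier f z * planeFourier h (-z) := by
  simp_rw [planeFourier_eq, smul_neg]
  rw [Measure.integral_comp_smul volume
    (fun z => 𝓕 (toComplexPlane f) (Complex.measurableEquivRealProd.symm z) *
      𝓕 (toComplexPlane h) (Complex.measurableEquivRealProd.symm (-z))),
    ← Complex.volume_preserving_equiv_real_prod.integral_comp
      Complex.measurableEquivRealProd.measurableEmbedding (fun p => f p * h p)]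
  have e : ∀ z, Complex.measurableEquivRealProd.symm (-z) =
      -Complex.measurableEquivRealProd.symm z := by
    intro z; simp [Complex.measurableEquivRealProd]
  simp_rw [e]
  rw [Complex.volume_preserving_equiv_real_prod.symm.integral_comp
      Complex.measurableEquivRealProd.symm.measurableEmbedding
      (fun w => 𝓕 (toComplexPlane f) w * 𝓕 (toComplexPlane h) (-w)),
    ← integral_mul_eq_integral_fourier (integrable_toComplexPlane hf1) (memLp_toComplexPlane hf2)
      (integrable_toComplexPlane hh1) (memLp_toComplexPlane hh2)]
  simp only [toComplexPlane, Complex.real_smul]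
  congr 2
  rw [Module.finrank_prod, Module.finrank_self, inv_pow, inv_inv, abs_of_pos (by positivity)]

open ComplexConjugate
section Circle
variable {T : ℝ} [hT : Fact (0 < T)]

/-- The Fourier integral over a circle of total mass `T`. -/
noncomputable def circleFourier (g : AddCircle T → ℂ) (k : ℤ) : ℂ :=
  ∫ y : AddCircle T, fourier (-k) y * g y

theorem circleFourier_eq (g : AddCircle T → ℂ) (k : ℤ) :
    circleFourier g k = (T : ℂ) * fourierCoeff g k := by
  have := hT.out
  rw [circleFourier, fourierCoeff, AddCircle.integral_haarAddCircle]
  simp only [smul_eq_mul, Complex.real_smul, Complex.ofReal_inv]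
  rw [mul_inv_cancel_left₀ (by exact_mod_cast this.ne')]

theorem fourierCoeff_conj (g : AddCircle T → ℂ) (k : ℤ) :
    fourierCoeff (fun y => conj (g y)) k = conj (fourierCoeff g (-k)) := by
  rw [fourierCoeff, fourierCoeff, ← integral_conj]
  congr 1; ext y
  rw [smul_eq_mul, smul_eq_mul, map_mul, fourier_neg, neg_neg]

theorem hasSum_circleFourier_mul {g h : AddCircle T → ℂ} (hg : MemLp g 2) (hh : MemLp h 2) :
    HasSum (fun k => circleFourier g k * circleFourier h (-k)) (T * ∫ y, g y * h y) := by
  have h0 : (T : ℂ) ≠ 0 := by exact_mod_cast hT.out.ne'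
  have hg' := hg.haarAddCircle
  have hh' : MemLp (fun y => conj (h y)) 2 AddCircle.haarAddCircle := hh.haarAddCircle.star
  have key := fourierBasis.hasSum_inner_mul_inner (hh'.toLp _) (hg'.toLp g)
  simp_rw [← HilbertBasis.repr_apply_apply, fourierBasis_repr, ← inner_conj_symm (hh'.toLp _),
    ← HilbertBasis.repr_apply_apply, fourierBasis_repr,
    fourierCoeff_congr_ae hh'.coeFn_toLp, fourierCoeff_congr_ae hg'.coeFn_toLp,
    fourierCoeff_conj, Complex.conj_conj, inner_conj_symm] at key
  have e : inner ℂ (hh'.toLp _) (hg'.toLp g) = ∫ y, g y * h y ∂AddCircle.haarAddCircle := by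
    rw [L2.inner_def]
    refine integral_congr_ae ?_
    filter_upwards [hh'.coeFn_toLp, hg'.coeFn_toLp] with y h1 h2
    rw [h1, h2]; simp
  rw [e, AddCircle.integral_haarAddCircle] at key
  have key2 := key.mul_left ((T : ℂ) ^ 2)
  have e3 : (T : ℂ) ^ 2 * T⁻¹ • ∫ y, g y * h y = T * ∫ y, g y * h y := by
    rw [Complex.real_smul]; push_cast; field_simp
  rw [e3] at key2
  refine key2.congr_fun fun k => ?_
  rw [circleFourier_eq, circleFourier_eq]; ring

theorem tsum_circleFourier_sq {g : AddCircle T → ℂ} (hg : MemLp g 2) :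
    ∑' k, ‖circleFourier g k‖ₑ ^ 2 = ENNReal.ofReal T * ∫⁻ y, ‖g y‖ₑ ^ 2 := by
  have hT0 := hT.out
  have h := hasSum_sq_fourierCoeff (hg.haarAddCircle.toLp g)
  have hi : Integrable (fun y => ‖g y‖ ^ 2) (volume : Measure (AddCircle T)) :=
    hg.integrable_norm_pow (by norm_num)
  have e : ∫ y, ‖hg.haarAddCircle.toLp g y‖ ^ 2 ∂AddCircle.haarAddCircle =
      T⁻¹ * ∫ y, ‖g y‖ ^ 2 := by
    rw [← smul_eq_mul, ← AddCircle.integral_haarAddCircle]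
    refine integral_congr_ae ?_
    filter_upwards [hg.haarAddCircle.coeFn_toLp] with y h1
    rw [h1]
  rw [e] at h
  simp_rw [fourierCoeff_congr_ae hg.haarAddCircle.coeFn_toLp] at h
  have h' := h.mul_left (T ^ 2)
  have hl : ∫⁻ y, ‖g y‖ₑ ^ 2 = ENNReal.ofReal (∫ y, ‖g y‖ ^ 2) := by
    rw [ofReal_integral_eq_lintegral_ofReal hi (.of_forall fun _ => by positivity)]
    simp_rw [ENNReal.ofReal_pow (norm_nonneg _), ofReal_norm]
  rw [hl, ← ENNReal.ofReal_mul hT0.le]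
  have e2 : T * ∫ y, ‖g y‖ ^ 2 = ∑' k, T ^ 2 * ‖fourierCoeff g k‖ ^ 2 := by
    rw [h'.tsum_eq]; field_simp
  rw [e2, ENNReal.ofReal_tsum_of_nonneg (fun _ => by positivity) h'.summable]
  congr 1; ext k
  rw [circleFourier_eq, ← ofReal_norm, ← ENNReal.ofReal_pow (norm_nonneg _), norm_mul, mul_pow,
    Complex.norm_real, Real.norm_of_nonneg hT0.le]

end Circle

/-- The rearrangement `(x, y, t) ↦ ((x, t), y)`. -/
noncomputable def spaceTimeEquiv (lam : ℝ) :
    SpaceTime lam ≃ᵐ (ℝ × ℝ) × AddCircle (2 * Real.pi * lam) :=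
  ((MeasurableEquiv.refl ℝ).prodCongr MeasurableEquiv.prodComm).trans
    MeasurableEquiv.prodAssoc.symm

theorem measurePreserving_spaceTimeEquiv (lam : ℝ) [Fact (1 < lam)] :
    MeasurePreserving (spaceTimeEquiv lam) := by
  refine MeasurePreserving.trans (e := (MeasurableEquiv.refl ℝ).prodCongr MeasurableEquiv.prodComm)
    (μb := volume) ?_ ?_
  · exact (MeasurePreserving.id volume).prod Measure.measurePreserving_swap
  · exact (MeasurePreserving.symm _ (measurePreserving_prodAssoc volume volume volume))

section
variable {lam : ℝ} [hlam : Fact (1 < lam)]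

/-- A function on space-time as a function of `((x, t), y)`. -/
noncomputable def rearrange (f : SpaceTime lam → ℂ) :
    (ℝ × ℝ) × AddCircle (2 * Real.pi * lam) → ℂ := fun q => f (q.1.1, q.2, q.1.2)

theorem integrable_rearrange {f : SpaceTime lam → ℂ} (h : Integrable f) :
    Integrable (rearrange f) :=
  (measurePreserving_spaceTimeEquiv lam).symm.integrable_comp_of_integrable h

theorem memLp_rearrange {f : SpaceTime lam → ℂ} (h : MemLp f 2) : MemLp (rearrange f) 2 :=
  h.comp_measurePreserving (measurePreserving_spaceTimeEquiv lam).symm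

/-- The Fourier integral in the periodic variable. -/
noncomputable def partialFourier (f : SpaceTime lam → ℂ) (k : ℤ) (p : ℝ × ℝ) : ℂ :=
  circleFourier (fun y => rearrange f (p, y)) k

theorem integrable_fourier_mul {f : SpaceTime lam → ℂ} (h : Integrable f) (k : ℤ) :
    Integrable (fun q : (ℝ × ℝ) × AddCircle (2 * Real.pi * lam) =>
      fourier (-k) q.2 * rearrange f q) := by
  refine (integrable_rearrange h).bdd_mul (c := 1) ?_ (.of_forall fun q => ?_)
  · exact ((map_continuous (fourier (-k))).comp continuous_snd).aestronglyMeasurable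
  · rw [fourier_apply, Circle.norm_coe]

theorem integrable_partialFourier {f : SpaceTime lam → ℂ} (h : Integrable f) (k : ℤ) :
    Integrable (partialFourier f k) :=
  (integrable_fourier_mul h k).integral_prod_left

theorem ae_memLp_section {f : SpaceTime lam → ℂ} (h : MemLp f 2) :
    ∀ᵐ p : ℝ × ℝ, MemLp (fun y => rearrange f (p, y)) 2 := by
  have h2 := (memLp_rearrange h).integrable_norm_pow (p := 2) (by norm_num)
  have hm := (memLp_rearrange h).aestronglyMeasurable
  filter_upwards [h2.prod_right_ae, hm.prodMk_left] with p h1 h3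
  exact (memLp_two_iff_integrable_sq_norm h3).2 h1

theorem tsum_lintegral_partialFourier_sq {f : SpaceTime lam → ℂ} (h1 : Integrable f)
    (h2 : MemLp f 2) :
    ∑' k : ℤ, ∫⁻ p, ‖partialFourier f k p‖ₑ ^ 2 =
      ENNReal.ofReal (2 * Real.pi * lam) * ∫⁻ p, ‖f p‖ₑ ^ 2 := by
  rw [← lintegral_tsum fun k => ((integrable_partialFourier h1 k).1.enorm.pow_const 2)]
  have hm : AEMeasurable (fun q => ‖rearrange f q‖ₑ ^ 2) :=
    (integrable_rearrange h1).1.enorm.pow_const 2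
  calc _ = ∫⁻ p : ℝ × ℝ, ENNReal.ofReal (2 * Real.pi * lam) *
        ∫⁻ y, ‖rearrange f (p, y)‖ₑ ^ 2 := by
        refine lintegral_congr_ae ?_
        filter_upwards [ae_memLp_section h2] with p hp
        exact tsum_circleFourier_sq hp
    _ = ENNReal.ofReal (2 * Real.pi * lam) * ∫⁻ q, ‖rearrange f q‖ₑ ^ 2 := by
        rw [lintegral_const_mul' _ _ ENNReal.ofReal_ne_top]
        congr 1
        exact (lintegral_prod _ hm).symm
    _ = _ := by
        congr 1
        exact (measurePreserving_spaceTimeEquiv lam).symm.lintegral_comp_emb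
          (spaceTimeEquiv lam).symm.measurableEmbedding (fun p => ‖f p‖ₑ ^ 2)

theorem memLp_partialFourier {f : SpaceTime lam → ℂ} (h1 : Integrable f) (h2 : MemLp f 2)
    (k : ℤ) : MemLp (partialFourier f k) 2 := by
  refine ⟨(integrable_partialFourier h1 k).1, ?_⟩
  have e := eLpNorm_nnreal_pow_eq_lintegral (f := partialFourier f k) (μ := volume) (p := 2)
    (by norm_num)
  have e' := eLpNorm_nnreal_pow_eq_lintegral (f := f) (μ := volume) (p := 2) (by norm_num)
  have hle : ∫⁻ p, ‖partialFourier f k p‖ₑ ^ 2 < ⊤ := by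
    refine (ENNReal.le_tsum (f := fun k => ∫⁻ p, ‖partialFourier f k p‖ₑ ^ 2) k).trans_lt ?_
    rw [tsum_lintegral_partialFourier_sq h1 h2]
    refine ENNReal.mul_lt_top ENNReal.ofReal_lt_top ?_
    have := h2.eLpNorm_lt_top
    simp only [NNReal.coe_ofNat, ENNReal.coe_ofNat, ENNReal.rpow_ofNat] at e'
    rw [← e']
    exact ENNReal.pow_lt_top this
  simp only [NNReal.coe_ofNat, ENNReal.coe_ofNat, ENNReal.rpow_ofNat] at e
  rw [← e] at hle
  by_contra hcon
  rw [not_lt, top_le_iff] at hcon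
  simp [hcon] at hle

theorem fourierIntegral_eq {f : SpaceTime lam → ℂ} (h : Integrable f) (ξ : ℝ) (k : ℤ) (τ : ℝ) :
    fourierIntegral lam f ξ k τ = planeFourier (partialFourier f k) (ξ, τ) := by
  have hi : Integrable (fun q : (ℝ × ℝ) × AddCircle (2 * Real.pi * lam) =>
      Complex.exp (-(Complex.I * ((q.1.2 * τ + q.1.1 * ξ : ℝ) : ℂ))) *
        (fourier (-k) q.2 * rearrange f q)) := by
    refine (integrable_fourier_mul h k).bdd_mul (c := 1) ?_ (.of_forall fun q => ?_)
    · exact Continuous.aestronglyMeasurable (by fun_prop)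
    · rw [Complex.norm_exp]; simp
  rw [fourierIntegral, ← (measurePreserving_spaceTimeEquiv lam).symm.integral_comp
    (spaceTimeEquiv lam).symm.measurableEmbedding]
  rw [planeFourier]
  simp_rw [partialFourier, circleFourier, ← integral_const_mul]
  refine Eq.trans ?_ (integral_prod _ hi)
  congr 1; ext q
  exact mul_assoc _ _ _

theorem tsum_lintegral_fourierIntegral_sq {f : SpaceTime lam → ℂ} (h1 : Integrable f)
    (h2 : MemLp f 2) :
    ∑' k : ℤ, ∫⁻ z : ℝ × ℝ, ‖fourierIntegral lam f z.1 k z.2‖ₑ ^ 2 =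
      ENNReal.ofReal ((2 * Real.pi) ^ 2) *
        (ENNReal.ofReal (2 * Real.pi * lam) * ∫⁻ p, ‖f p‖ₑ ^ 2) := by
  simp_rw [fourierIntegral_eq h1]
  rw [← tsum_lintegral_partialFourier_sq h1 h2, ← ENNReal.tsum_mul_left]
  congr 1; ext k
  exact lintegral_planeFourier_sq (integrable_partialFourier h1 k) (memLp_partialFourier h1 h2 k)

theorem tsum_integral_partialFourier_mul {f h : SpaceTime lam → ℂ} (hf1 : Integrable f)
    (hf2 : MemLp f 2) (hh1 : Integrable h) (hh2 : MemLp h 2) :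
    ((2 * Real.pi * lam : ℝ) : ℂ) * ∫ p, f p * h p =
      ∑' k : ℤ, ∫ p, partialFourier f k p * partialFourier h (-k) p := by
  have hlt (g : SpaceTime lam → ℂ) (h1 : Integrable g) (h2 : MemLp g 2) :
      ∑' k : ℤ, ∫⁻ p, ‖partialFourier g k p‖ₑ ^ 2 ≠ ⊤ := by
    rw [tsum_lintegral_partialFourier_sq h1 h2]
    refine ENNReal.mul_ne_top ENNReal.ofReal_ne_top ?_
    have := eLpNorm_nnreal_pow_eq_lintegral (f := g) (μ := volume) (p := 2) (by norm_num)
    simp only [NNReal.coe_ofNat, ENNReal.coe_ofNat, ENNReal.rpow_ofNat] at this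
    rw [← this]
    exact ENNReal.pow_ne_top h2.eLpNorm_ne_top
  rw [← integral_tsum]
  · have hi : Integrable (fun q => rearrange f q * rearrange h q) :=
      (memLp_rearrange hf2).integrable_mul (memLp_rearrange hh2)
    rw [← (measurePreserving_spaceTimeEquiv lam).symm.integral_comp
      (spaceTimeEquiv lam).symm.measurableEmbedding (fun p => f p * h p)]
    have e : ∫ q, f ((spaceTimeEquiv lam).symm q) * h ((spaceTimeEquiv lam).symm q) =
      ∫ p : ℝ × ℝ, ∫ y, rearrange f (p, y) * rearrange h (p, y) := integral_prod _ hi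
    rw [e, ← integral_const_mul]
    refine integral_congr_ae ?_
    filter_upwards [ae_memLp_section hf2, ae_memLp_section hh2] with p h1 h2
    exact (hasSum_circleFourier_mul h1 h2).tsum_eq.symm
  · intro k
    exact (integrable_partialFourier hf1 k).1.mul (integrable_partialFourier hh1 (-k)).1
  · refine ne_top_of_le_ne_top (ENNReal.add_ne_top.2 ⟨hlt f hf1 hf2, hlt h hh1 hh2⟩) ?_
    rw [← (Equiv.neg ℤ).tsum_eq (fun k : ℤ => ∫⁻ p, ‖partialFourier h k p‖ₑ ^ 2),
      ← ENNReal.tsum_add]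
    refine ENNReal.tsum_le_tsum fun k => ?_
    rw [← lintegral_add_left' ((integrable_partialFourier hf1 k).1.enorm.pow_const 2)]
    refine lintegral_mono fun p => ?_
    rw [enorm_mul, Equiv.neg_apply]
    rcases le_total ‖partialFourier f k p‖ₑ ‖partialFourier h (-k) p‖ₑ with h | h
    · exact le_add_left ((mul_le_mul_left h _).trans (sq _).ge)
    · exact le_add_right ((mul_le_mul_right h _).trans (sq _).ge)

theorem enorm_integral_mul_le {f h : SpaceTime lam → ℂ} (hf1 : Integrable f)
    (hf2 : MemLp f 2) (hh1 : Integrable h) (hh2 : MemLp h 2) :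
    ENNReal.ofReal ((2 * Real.pi) ^ 2 * (2 * Real.pi * lam)) * ‖∫ p, f p * h p‖ₑ ≤
      ∑' k : ℤ, ∫⁻ z : ℝ × ℝ, ‖fourierIntegral lam f z.1 k z.2‖ₑ *
        ‖fourierIntegral lam h (-z.1) (-k) (-z.2)‖ₑ := by
  have hl : 0 < 2 * Real.pi * lam := (inferInstance : Fact (0 < 2 * Real.pi * lam)).out
  have e : ENNReal.ofReal ((2 * Real.pi) ^ 2 * (2 * Real.pi * lam)) * ‖∫ p, f p * h p‖ₑ =
      ENNReal.ofReal ((2 * Real.pi) ^ 2) *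
        ‖((2 * Real.pi * lam : ℝ) : ℂ) * ∫ p, f p * h p‖ₑ := by
    rw [enorm_mul, ← ofReal_norm ((2 * Real.pi * lam : ℝ) : ℂ), Complex.norm_real,
      Real.norm_of_nonneg hl.le, ENNReal.ofReal_mul (by positivity), mul_assoc]
  rw [e, tsum_integral_partialFourier_mul hf1 hf2 hh1 hh2]
  refine (mul_le_mul_right enorm_tsum_le_tsum_enorm _).trans ?_
  rw [← ENNReal.tsum_mul_left]
  refine ENNReal.tsum_le_tsum fun k => ?_
  have e2 : ENNReal.ofReal ((2 * Real.pi) ^ 2) *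
      ‖∫ p, partialFourier f k p * partialFourier h (-k) p‖ₑ =
      ‖((2 * Real.pi) ^ 2 : ℝ) • ∫ p, partialFourier f k p * partialFourier h (-k) p‖ₑ := by
    rw [enorm_smul, ← ofReal_norm ((2 * Real.pi) ^ 2 : ℝ), Real.norm_of_nonneg (by positivity)]
  rw [e2, integral_mul_eq_integral_planeFourier (integrable_partialFourier hf1 k)
    (memLp_partialFourier hf1 hf2 k) (integrable_partialFourier hh1 (-k))
    (memLp_partialFourier hh1 hh2 (-k))]
  refine (enorm_integral_le_lintegral_enorm _).trans (le_of_eq ?_)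
  refine lintegral_congr fun z => ?_
  rw [enorm_mul, fourierIntegral_eq hf1, fourierIntegral_eq hh1]
  rfl

end

/-- The product of the counting measure on `ℤ` and Lebesgue measure on `ℝ × ℝ`; its points are
written `(k, (ξ, τ))`. -/
noncomputable def freqMeasure : Measure (ℤ × (ℝ × ℝ)) :=
  (Measure.count : Measure ℤ).prod (volume : Measure (ℝ × ℝ))

instance : freqMeasure.IsAddLeftInvariant := by unfold freqMeasure; infer_instance

instance : SigmaFinite freqMeasure := by unfold freqMeasure; infer_instance

instance : freqMeasure.IsNegInvariant :=
  ⟨((Measure.measurePreserving_neg (Measure.count : Measure ℤ)).prod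
    (Measure.measurePreserving_neg (volume : Measure (ℝ × ℝ)))).map_eq⟩

theorem lintegral_freqMeasure {F : ℤ × (ℝ × ℝ) → ℝ≥0∞} (hF : Measurable F) :
    ∫⁻ z, F z ∂freqMeasure = ∑' k : ℤ, ∫⁻ z : ℝ × ℝ, F (k, z) := by
  rw [freqMeasure, lintegral_prod _ hF.aemeasurable, lintegral_count]

theorem sq_lintegral_mul_le {α : Type*} [MeasurableSpace α] (μ : Measure α) {f g : α → ℝ≥0∞}
    (hf : AEMeasurable f μ) (hg : AEMeasurable g μ) :
    (∫⁻ a, f a * g a ∂μ) ^ 2 ≤ (∫⁻ a, f a ^ 2 ∂μ) * ∫⁻ a, g a ^ 2 ∂μ := by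
  have h := ENNReal.lintegral_mul_le_Lp_mul_Lq μ Real.HolderConjugate.two_two hf hg
  simp only [Pi.mul_apply, ENNReal.rpow_ofNat] at h
  refine (pow_le_pow_left' h 2).trans (le_of_eq ?_)
  rw [mul_pow, ← ENNReal.rpow_natCast, ← ENNReal.rpow_natCast, ← ENNReal.rpow_mul,
    ← ENNReal.rpow_mul]
  norm_num

section
variable {lam : ℝ} [hlam : Fact (1 < lam)]

omit hlam in
theorem continuous_planeFourier {f : ℝ × ℝ → ℂ} (h : Integrable f) :
    Continuous (planeFourier f) := by
  refine continuous_of_dominated (bound := fun p => ‖f p‖) (fun z => ?_) (fun z => ?_) h.norm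
    (.of_forall fun p => by fun_prop)
  · exact (Continuous.aestronglyMeasurable (by fun_prop)).mul h.1
  · refine .of_forall fun p => ?_
    rw [norm_mul, Complex.norm_exp]; simp

/-- Multiplication by the character of frequency `(ξ, k, τ)`. -/
noncomputable def modulate (ξ : ℝ) (k : ℤ) (τ : ℝ) (f : SpaceTime lam → ℂ) (p : SpaceTime lam) :
    ℂ :=
  Complex.exp (-(Complex.I * ((p.2.2 * τ + p.1 * ξ : ℝ) : ℂ))) * fourier (-k) p.2.1 * f p

omit hlam in
theorem continuous_character (ξ : ℝ) (k : ℤ) (τ : ℝ) : Continuous (fun p : SpaceTime lam =>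
    Complex.exp (-(Complex.I * ((p.2.2 * τ + p.1 * ξ : ℝ) : ℂ))) * fourier (-k) p.2.1) :=
  Continuous.mul (by fun_prop) ((map_continuous (fourier (-k))).comp (by fun_prop))

omit hlam in
theorem norm_character (ξ : ℝ) (k : ℤ) (τ : ℝ) (p : SpaceTime lam) :
    ‖Complex.exp (-(Complex.I * ((p.2.2 * τ + p.1 * ξ : ℝ) : ℂ))) * fourier (-k) p.2.1‖ = 1 := by
  rw [norm_mul, Complex.norm_exp, fourier_apply, Circle.norm_coe]; simp

theorem integrable_modulate (ξ : ℝ) (k : ℤ) (τ : ℝ) {f : SpaceTime lam → ℂ} (h : Integrable f) :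
    Integrable (modulate ξ k τ f) :=
  h.bdd_mul (c := 1) (continuous_character ξ k τ).aestronglyMeasurable
    (.of_forall fun p => (norm_character ξ k τ p).le)

theorem memLp_modulate (ξ : ℝ) (k : ℤ) (τ : ℝ) {f : SpaceTime lam → ℂ} (h : MemLp f 2) :
    MemLp (modulate ξ k τ f) 2 := by
  refine h.congr_norm ((continuous_character ξ k τ).aestronglyMeasurable.mul h.1)
    (.of_forall fun p => ?_)
  rw [modulate, norm_mul, norm_character, one_mul]

theorem fourierIntegral_modulate (ξ : ℝ) (k : ℤ) (τ : ℝ) (f : SpaceTime lam → ℂ)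
    (ξ' : ℝ) (k' : ℤ) (τ' : ℝ) :
    fourierIntegral lam (modulate ξ k τ f) (-ξ') (-k') (-τ') =
      fourierIntegral lam f (ξ - ξ') (k - k') (τ - τ') := by
  rw [fourierIntegral, fourierIntegral]
  congr 1; ext p
  have e1 : Complex.exp (-(Complex.I * ((p.2.2 * (τ - τ') + p.1 * (ξ - ξ') : ℝ) : ℂ))) =
      Complex.exp (-(Complex.I * ((p.2.2 * -τ' + p.1 * -ξ' : ℝ) : ℂ))) *
        Complex.exp (-(Complex.I * ((p.2.2 * τ + p.1 * ξ : ℝ) : ℂ))) := by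
    rw [← Complex.exp_add]; congr 1; push_cast; ring
  have e2 : fourier (-(k - k')) p.2.1 =
      fourier (- -k') p.2.1 * (fourier (-k) p.2.1 : ℂ) := by
    rw [← fourier_add]; congr 1; ring_nf
  rw [e1, e2, modulate]; ring

theorem enorm_fourierIntegral_mul_le_of_integrable {f g : SpaceTime lam → ℂ} (hf1 : Integrable f)
    (hf2 : MemLp f 2) (hg1 : Integrable g) (hg2 : MemLp g 2) (ξ : ℝ) (k : ℤ) (τ : ℝ) :
    ‖fourierIntegral lam (fun p => f p * g p) ξ k τ‖ₑ ≤ ENNReal.ofReal (1 / lam) *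
      ∑' k' : ℤ, ∫⁻ z : ℝ × ℝ, ‖fourierIntegral lam f z.1 k' z.2‖ₑ *
        ‖fourierIntegral lam g (ξ - z.1) (k - k') (τ - z.2)‖ₑ := by
  have hl : 0 < lam := one_pos.trans hlam.out
  have h := enorm_integral_mul_le hf1 hf2 (integrable_modulate ξ k τ hg1)
    (memLp_modulate ξ k τ hg2)
  simp_rw [fourierIntegral_modulate] at h
  have e : ∫ p, f p * modulate ξ k τ g p = fourierIntegral lam (fun p => f p * g p) ξ k τ := by
    rw [fourierIntegral]; congr 1; ext p; rw [modulate]; ring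
  rw [e] at h
  refine le_trans ?_ (mul_le_mul_right h _)
  rw [← mul_assoc, ← ENNReal.ofReal_mul (by positivity)]
  refine le_mul_of_one_le_left (zero_le) ?_
  rw [ENNReal.one_le_ofReal]
  have hpi := Real.pi_gt_three
  have : 1 / lam * ((2 * Real.pi) ^ 2 * (2 * Real.pi * lam)) = (2 * Real.pi) ^ 3 := by
    field_simp
  rw [this]
  exact one_le_pow₀ (by linarith)

theorem measurable_fourierIntegral {f : SpaceTime lam → ℂ} (h : Integrable f) (k : ℤ) :
    Measurable (fun z : ℝ × ℝ => fourierIntegral lam f z.1 k z.2) := by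
  simp_rw [fourierIntegral_eq h]
  exact (continuous_planeFourier (integrable_partialFourier h k)).measurable

omit hlam in
theorem measurableSet_truncation (n : ℕ) :
    MeasurableSet {p : SpaceTime lam | |p.1| ≤ n ∧ |p.2.2| ≤ n} :=
  (measurableSet_le (f := fun p : SpaceTime lam => |p.1|) (by fun_prop) measurable_const).inter
    (measurableSet_le (f := fun p : SpaceTime lam => |p.2.2|) (by fun_prop) measurable_const)

theorem volume_truncation_lt_top (n : ℕ) :
    volume {p : SpaceTime lam | |p.1| ≤ n ∧ |p.2.2| ≤ n} < ⊤ := by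
  have hc : IsCompact (Set.Icc (-(n : ℝ)) n ×ˢ
      ((Set.univ : Set (AddCircle (2 * Real.pi * lam))) ×ˢ Set.Icc (-(n : ℝ)) n)) :=
    isCompact_Icc.prod (isCompact_univ.prod isCompact_Icc)
  refine (measure_mono fun p hp => ?_).trans_lt hc.measure_lt_top
  exact ⟨abs_le.1 hp.1, Set.mem_univ _, abs_le.1 hp.2⟩

theorem memLp_truncate {u : SpaceTime lam → ℂ} (h : MemLp u 2) (n : ℕ) :
    MemLp (truncate n u) 2 := h.indicator (measurableSet_truncation n)

theorem integrable_truncate {u : SpaceTime lam → ℂ} (h : MemLp u 2) (n : ℕ) :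
    Integrable (truncate n u) := by
  rw [truncate, integrable_indicator_iff (measurableSet_truncation n), IntegrableOn,
    ← memLp_one_iff_integrable]
  have : IsFiniteMeasure
      (volume.restrict {p : SpaceTime lam | |p.1| ≤ n ∧ |p.2.2| ≤ n}) :=
    ⟨by simpa using volume_truncation_lt_top n⟩
  exact (h.restrict _).mono_exponent (by norm_num)

theorem tendsto_fourierIntegral_truncate {w : SpaceTime lam → ℂ} (h : Integrable w) (ξ : ℝ)
    (k : ℤ) (τ : ℝ) : Tendsto (fun n => fourierIntegral lam (truncate n w) ξ k τ) atTop
      (𝓝 (fourierIntegral lam w ξ k τ)) := by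
  refine tendsto_integral_of_dominated_convergence (fun p => ‖w p‖) (fun n => ?_) h.norm
    (fun n => .of_forall fun p => ?_) (.of_forall fun p => ?_)
  · exact (continuous_character ξ k τ).aestronglyMeasurable.mul
      (h.1.indicator (measurableSet_truncation n))
  · rw [norm_mul, norm_character, one_mul, truncate]
    exact norm_indicator_le_norm_self _ _
  · refine tendsto_const_nhds.congr' ?_
    obtain ⟨N, hN⟩ := exists_nat_ge (max |p.1| |p.2.2|)
    filter_upwards [eventually_ge_atTop N] with n hn
    have hN' : max |p.1| |p.2.2| ≤ n := hN.trans (by exact_mod_cast hn)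
    rw [truncate, Set.indicator_of_mem]
    exact ⟨(le_max_left _ _).trans hN', (le_max_right _ _).trans hN'⟩

theorem measurable_freq {U : ℝ → ℤ → ℝ → ℂ}
    (h : ∀ k : ℤ, Measurable (fun z : ℝ × ℝ => U z.1 k z.2)) :
    Measurable (fun z : ℤ × (ℝ × ℝ) => U z.2.1 z.1 z.2.2) :=
  measurable_from_prod_countable_right h

/-- The `L²` norm squared of the error between the transform of a truncation and `U`. -/
noncomputable def truncationError (lam : ℝ) [Fact (1 < lam)] (u : SpaceTime lam → ℂ)
    (U : ℝ → ℤ → ℝ → ℂ) (n : ℕ) : ℝ≥0∞ :=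
  ∫⁻ z, ‖fourierIntegral lam (truncate n u) z.2.1 z.1 z.2.2 - U z.2.1 z.1 z.2.2‖ₑ ^ 2 ∂freqMeasure

theorem measurable_fourierIntegral_truncate {u : SpaceTime lam → ℂ} (hu : MemLp u 2) (n : ℕ) :
    Measurable (fun z : ℤ × (ℝ × ℝ) => fourierIntegral lam (truncate n u) z.2.1 z.1 z.2.2) :=
  measurable_freq (measurable_fourierIntegral (integrable_truncate hu n))

theorem tendsto_truncationError {u : SpaceTime lam → ℂ} (hu : MemLp u 2)
    {U : ℝ → ℤ → ℝ → ℂ} (hU : IsFourierTransformL2 lam u U)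
    (hm : ∀ k : ℤ, Measurable (fun z : ℝ × ℝ => U z.1 k z.2)) :
    Tendsto (truncationError lam u U) atTop (𝓝 0) := by
  refine hU.tendsto.congr fun n => (lintegral_freqMeasure ?_).symm
  exact ((measurable_fourierIntegral_truncate hu n).sub (measurable_freq hm)).enorm.pow_const 2

theorem enorm_sq_le_add (a b : ℂ) : ‖a‖ₑ ^ 2 ≤ 2 * ‖b‖ₑ ^ 2 + 2 * ‖b - a‖ₑ ^ 2 := by
  rw [← ofReal_norm, ← ofReal_norm, ← ofReal_norm, ← ENNReal.ofReal_pow (norm_nonneg _),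
    ← ENNReal.ofReal_pow (norm_nonneg _), ← ENNReal.ofReal_pow (norm_nonneg _)]
  rw [show (2 : ℝ≥0∞) = ENNReal.ofReal 2 by simp, ← ENNReal.ofReal_mul (by norm_num),
    ← ENNReal.ofReal_mul (by norm_num), ← ENNReal.ofReal_add (by positivity) (by positivity)]
  refine ENNReal.ofReal_le_ofReal ?_
  have h : ‖a‖ ≤ ‖b‖ + ‖b - a‖ := by
    have := norm_sub_le b (b - a); simpa using this
  nlinarith [norm_nonneg a, norm_nonneg b, norm_nonneg (b - a), sq_nonneg (‖b‖ - ‖b - a‖)]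

theorem lintegral_sq_lt_top {u : SpaceTime lam → ℂ} (hu : MemLp u 2)
    {U : ℝ → ℤ → ℝ → ℂ} (hU : IsFourierTransformL2 lam u U)
    (hm : ∀ k : ℤ, Measurable (fun z : ℝ × ℝ => U z.1 k z.2)) :
    ∫⁻ z, ‖U z.2.1 z.1 z.2.2‖ₑ ^ 2 ∂freqMeasure ≠ ⊤ := by
  obtain ⟨n, hn⟩ := ((tendsto_truncationError hu hU hm).eventually
    (eventually_lt_nhds (ENNReal.zero_lt_top))).exists
  have hmn := measurable_fourierIntegral_truncate hu n
  refine ne_top_of_le_ne_top ?_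
    (lintegral_mono fun z : ℤ × (ℝ × ℝ) => enorm_sq_le_add (U z.2.1 z.1 z.2.2)
      (fourierIntegral lam (truncate n u) z.2.1 z.1 z.2.2))
  rw [lintegral_add_left (by fun_prop), lintegral_const_mul' _ _ (by simp),
    lintegral_const_mul' _ _ (by simp)]
  refine ENNReal.add_ne_top.2 ⟨ENNReal.mul_ne_top (by simp) ?_, ENNReal.mul_ne_top (by simp) hn.ne⟩
  rw [lintegral_freqMeasure (by fun_prop)]
  rw [tsum_lintegral_fourierIntegral_sq (integrable_truncate hu n) (memLp_truncate hu n)]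
  refine ENNReal.mul_ne_top (by simp) (ENNReal.mul_ne_top (by simp) ?_)
  have := eLpNorm_nnreal_pow_eq_lintegral (f := truncate n u) (μ := volume) (p := 2) (by norm_num)
  simp only [NNReal.coe_ofNat, ENNReal.coe_ofNat, ENNReal.rpow_ofNat] at this
  rw [← this]
  exact ENNReal.pow_ne_top (memLp_truncate hu n).eLpNorm_ne_top

theorem lintegral_mul_sub_le (F G : ℤ × (ℝ × ℝ) → ℝ≥0∞) (hF : Measurable F) (hG : Measurable G)
    (z : ℤ × (ℝ × ℝ)) :
    ∫⁻ w, F w * G (z - w) ∂freqMeasure ≤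
      (∫⁻ w, F w ^ 2 ∂freqMeasure) ^ (1 / 2 : ℝ) * (∫⁻ w, G w ^ 2 ∂freqMeasure) ^ (1 / 2 : ℝ) := by
  have h := ENNReal.lintegral_mul_le_Lp_mul_Lq freqMeasure Real.HolderConjugate.two_two
    hF.aemeasurable (g := fun w => G (z - w)) (hG.comp (by fun_prop)).aemeasurable
  simp only [Pi.mul_apply, ENNReal.rpow_ofNat] at h
  rwa [lintegral_sub_left_eq_self (fun w => G w ^ 2)] at h

/-- The Fourier transform of a product is dominated by the convolution of the transforms. -/
theorem enorm_fourierIntegral_mul_le {u v : SpaceTime lam → ℂ} (hu : MemLp u 2) (hv : MemLp v 2)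
    {U V : ℝ → ℤ → ℝ → ℂ} (hU : IsFourierTransformL2 lam u U) (hV : IsFourierTransformL2 lam v V)
    (hUm : ∀ k : ℤ, Measurable (fun z : ℝ × ℝ => U z.1 k z.2))
    (hVm : ∀ k : ℤ, Measurable (fun z : ℝ × ℝ => V z.1 k z.2)) (z : ℤ × (ℝ × ℝ)) :
    ‖fourierIntegral lam (fun p => u p * v p) z.2.1 z.1 z.2.2‖ₑ ≤ ENNReal.ofReal (1 / lam) *
      ∫⁻ w, ‖U w.2.1 w.1 w.2.2‖ₑ * ‖V (z - w).2.1 (z - w).1 (z - w).2.2‖ₑ ∂freqMeasure := by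
  set FU : ℤ × (ℝ × ℝ) → ℂ := fun w => U w.2.1 w.1 w.2.2 with hFU
  set FV : ℤ × (ℝ × ℝ) → ℂ := fun w => V w.2.1 w.1 w.2.2
  have mU : Measurable FU := measurable_freq hUm
  have mV : Measurable FV := measurable_freq hVm
  let d : ℕ → ℤ × (ℝ × ℝ) → ℂ :=
    fun n w => fourierIntegral lam (truncate n u) w.2.1 w.1 w.2.2 - FU w
  let e : ℕ → ℤ × (ℝ × ℝ) → ℂ :=
    fun n w => fourierIntegral lam (truncate n v) w.2.1 w.1 w.2.2 - FV w
  have md : ∀ n, Measurable (d n) := fun n => (measurable_fourierIntegral_truncate hu n).sub mU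
  have me : ∀ n, Measurable (e n) := fun n => (measurable_fourierIntegral_truncate hv n).sub mV
  have td : Tendsto (fun n => (∫⁻ w, ‖d n w‖ₑ ^ 2 ∂freqMeasure) ^ (1 / 2 : ℝ)) atTop (𝓝 0) := by
    have := (tendsto_truncationError hu hU hUm).ennrpow_const (1 / 2)
    rwa [ENNReal.zero_rpow_of_pos (by norm_num)] at this
  have te : Tendsto (fun n => (∫⁻ w, ‖e n w‖ₑ ^ 2 ∂freqMeasure) ^ (1 / 2 : ℝ)) atTop (𝓝 0) := by
    have := (tendsto_truncationError hv hV hVm).ennrpow_const (1 / 2)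
    rwa [ENNReal.zero_rpow_of_pos (by norm_num)] at this
  set cU := (∫⁻ w, ‖FU w‖ₑ ^ 2 ∂freqMeasure) ^ (1 / 2 : ℝ) with hcU
  set cV := (∫⁻ w, ‖FV w‖ₑ ^ 2 ∂freqMeasure) ^ (1 / 2 : ℝ)
  have fU : cU ≠ ⊤ := ENNReal.rpow_ne_top_of_nonneg (by norm_num) (lintegral_sq_lt_top hu hU hUm)
  have fV : cV ≠ ⊤ := ENNReal.rpow_ne_top_of_nonneg (by norm_num) (lintegral_sq_lt_top hv hV hVm)
  have hint : Integrable (fun p => u p * v p) := hu.integrable_mul hv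
  have hbound : ∀ n, ‖fourierIntegral lam (truncate n (fun p => u p * v p)) z.2.1 z.1 z.2.2‖ₑ ≤
      ENNReal.ofReal (1 / lam) * (∫⁻ w, ‖FU w‖ₑ * ‖FV (z - w)‖ₑ ∂freqMeasure +
        cU * (∫⁻ w, ‖e n w‖ₑ ^ 2 ∂freqMeasure) ^ (1 / 2 : ℝ) +
        (∫⁻ w, ‖d n w‖ₑ ^ 2 ∂freqMeasure) ^ (1 / 2 : ℝ) * cV +
        (∫⁻ w, ‖d n w‖ₑ ^ 2 ∂freqMeasure) ^ (1 / 2 : ℝ) *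
          (∫⁻ w, ‖e n w‖ₑ ^ 2 ∂freqMeasure) ^ (1 / 2 : ℝ)) := by
    intro n
    have e0 : truncate n (fun p => u p * v p) = fun p => truncate n u p * truncate n v p := by
      rw [truncate, truncate, truncate]
      exact Set.indicator_mul _ _ _
    rw [e0]
    refine (enorm_fourierIntegral_mul_le_of_integrable (integrable_truncate hu n)
      (memLp_truncate hu n) (integrable_truncate hv n) (memLp_truncate hv n) _ _ _).trans ?_
    refine mul_le_mul_right ?_ _
    have e1 := lintegral_freqMeasure (F := fun w =>
      ‖fourierIntegral lam (truncate n u) w.2.1 w.1 w.2.2‖ₑ *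
        ‖fourierIntegral lam (truncate n v) (z - w).2.1 (z - w).1 (z - w).2.2‖ₑ)
      ((measurable_fourierIntegral_truncate hu n).enorm.mul
        ((measurable_fourierIntegral_truncate hv n).comp (by fun_prop)).enorm)
    refine (le_of_eq e1.symm).trans ?_
    have mV' : Measurable fun w => FV (z - w) := mV.comp (by fun_prop)
    have me' : Measurable fun w => e n (z - w) := (me n).comp (by fun_prop)
    have mdn := md n
    calc _ ≤ ∫⁻ w, (‖FU w‖ₑ * ‖FV (z - w)‖ₑ + ‖FU w‖ₑ * ‖e n (z - w)‖ₑ +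
          ‖d n w‖ₑ * ‖FV (z - w)‖ₑ + ‖d n w‖ₑ * ‖e n (z - w)‖ₑ) ∂freqMeasure := by
          refine lintegral_mono fun w => ?_
          have h1 : ‖fourierIntegral lam (truncate n u) w.2.1 w.1 w.2.2‖ₑ ≤
              ‖FU w‖ₑ + ‖d n w‖ₑ := by
            refine le_trans (le_of_eq ?_) (enorm_add_le _ _); congr 1; simp [d]
          have h2 : ‖fourierIntegral lam (truncate n v) (z - w).2.1 (z - w).1 (z - w).2.2‖ₑ ≤
              ‖FV (z - w)‖ₑ + ‖e n (z - w)‖ₑ := by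
            refine le_trans (le_of_eq ?_) (enorm_add_le _ _); congr 1; simp [e]
          refine (mul_le_mul' h1 h2).trans (le_of_eq ?_)
          ring
      _ = _ := by
          rw [lintegral_add_left (by fun_prop), lintegral_add_left (by fun_prop),
            lintegral_add_left (by fun_prop)]
      _ ≤ _ := by
          refine add_le_add (add_le_add (add_le_add le_rfl ?_) ?_) ?_
          · exact lintegral_mul_sub_le (fun w => ‖FU w‖ₑ) (fun w => ‖e n w‖ₑ) mU.enorm
              (me n).enorm z
          · exact lintegral_mul_sub_le (fun w => ‖d n w‖ₑ) (fun w => ‖FV w‖ₑ) mdn.enorm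
              mV.enorm z
          · exact lintegral_mul_sub_le (fun w => ‖d n w‖ₑ) (fun w => ‖e n w‖ₑ) mdn.enorm
              (me n).enorm z
  refine le_of_tendsto_of_tendsto'
    ((continuous_enorm.tendsto _).comp (tendsto_fourierIntegral_truncate hint _ _ _)) ?_ hbound
  refine ENNReal.Tendsto.const_mul ?_ (.inr ENNReal.ofReal_ne_top)
  have t1 := ENNReal.Tendsto.const_mul (a := cU) te (.inr fU)
  have t2 := ENNReal.Tendsto.mul_const (b := cV) td (.inr fV)
  have t3 := ENNReal.Tendsto.mul td (.inr ENNReal.zero_ne_top) te (.inr ENNReal.zero_ne_top)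
  have t4 := ((tendsto_const_nhds (x := ∫⁻ w, ‖FU w‖ₑ * ‖FV (z - w)‖ₑ ∂freqMeasure)).add t1).add
    t2 |>.add t3
  simp only [mul_zero, zero_mul, add_zero] at t4
  exact t4

end

/-! ### Bilinear estimates by the Cauchy–Schwarz inequality -/

theorem lintegral_sq_bilinear_le_left {K : (ℤ × (ℝ × ℝ)) × (ℤ × (ℝ × ℝ)) → ℝ≥0∞}
    {F G : ℤ × (ℝ × ℝ) → ℝ≥0∞} (hK : Measurable K) (hF : Measurable F) (hG : Measurable G)
    (c A : ℝ≥0∞) (hA : ∀ z, c * ∫⁻ w, K (z, w) ^ 2 ∂freqMeasure ≤ A) :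
    c * ∫⁻ z, (c * ∫⁻ w, K (z, w) * (F w * G (z - w)) ∂freqMeasure) ^ 2 ∂freqMeasure ≤
      A * ((c * ∫⁻ w, F w ^ 2 ∂freqMeasure) * (c * ∫⁻ w, G w ^ 2 ∂freqMeasure)) := by
  have hFG : Measurable (fun p : (ℤ × (ℝ × ℝ)) × (ℤ × (ℝ × ℝ)) => F p.2 ^ 2 * G (p.1 - p.2) ^ 2) := by
    fun_prop
  calc _ ≤ c * ∫⁻ z, A * (c * ∫⁻ w, F w ^ 2 * G (z - w) ^ 2 ∂freqMeasure) ∂freqMeasure := by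
        refine mul_le_mul_right (lintegral_mono fun z => ?_) _
        have h := sq_lintegral_mul_le freqMeasure (f := fun w => K (z, w))
          (g := fun w => F w * G (z - w)) (by fun_prop) (by fun_prop)
        simp only [mul_pow] at h ⊢
        calc _ ≤ c ^ 2 * ((∫⁻ w, K (z, w) ^ 2 ∂freqMeasure) *
              ∫⁻ w, F w ^ 2 * G (z - w) ^ 2 ∂freqMeasure) := mul_le_mul_right h _
          _ = (c * ∫⁻ w, K (z, w) ^ 2 ∂freqMeasure) *
              (c * ∫⁻ w, F w ^ 2 * G (z - w) ^ 2 ∂freqMeasure) := by ring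
          _ ≤ _ := mul_le_mul_left (hA z) _
    _ = A * (c * (c * ∫⁻ z, ∫⁻ w, F w ^ 2 * G (z - w) ^ 2 ∂freqMeasure ∂freqMeasure)) := by
        rw [lintegral_const_mul _ (by fun_prop), lintegral_const_mul _ (by fun_prop)]
        ring
    _ = _ := by
        rw [lintegral_lintegral_swap hFG.aemeasurable]
        have e : ∀ w, ∫⁻ z, F w ^ 2 * G (z - w) ^ 2 ∂freqMeasure =
            F w ^ 2 * ∫⁻ z, G z ^ 2 ∂freqMeasure := by
          intro w
          rw [lintegral_const_mul _ (by fun_prop)]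
          congr 1
          exact lintegral_sub_right_eq_self (fun z => G z ^ 2) w
        simp_rw [e]
        rw [lintegral_mul_const _ (by fun_prop)]
        ring

theorem lintegral_sq_bilinear_le_right {K : (ℤ × (ℝ × ℝ)) × (ℤ × (ℝ × ℝ)) → ℝ≥0∞}
    {F G : ℤ × (ℝ × ℝ) → ℝ≥0∞} (hK : Measurable K) (hF : Measurable F) (hG : Measurable G)
    (c A : ℝ≥0∞) (hA : ∀ w, c * ∫⁻ z, K (z, w) ^ 2 ∂freqMeasure ≤ A) :
    c * ∫⁻ z, (c * ∫⁻ w, K (z, w) * (F w * G (z - w)) ∂freqMeasure) ^ 2 ∂freqMeasure ≤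
      A * ((c * ∫⁻ w, F w ^ 2 ∂freqMeasure) * (c * ∫⁻ w, G w ^ 2 ∂freqMeasure)) := by
  have hKF : Measurable (fun p : (ℤ × (ℝ × ℝ)) × (ℤ × (ℝ × ℝ)) => K (p.1, p.2) ^ 2 * F p.2 ^ 2) := by
    fun_prop
  set N := ∫⁻ w, G w ^ 2 ∂freqMeasure
  calc _ ≤ c * ∫⁻ z, (c * N) * (c * ∫⁻ w, K (z, w) ^ 2 * F w ^ 2 ∂freqMeasure) ∂freqMeasure := by
        refine mul_le_mul_right (lintegral_mono fun z => ?_) _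
        have h := sq_lintegral_mul_le freqMeasure (f := fun w => K (z, w) * F w)
          (g := fun w => G (z - w)) (by fun_prop) (by fun_prop)
        rw [lintegral_sub_left_eq_self (fun w => G w ^ 2)] at h
        simp only [mul_pow, mul_assoc] at h ⊢
        calc _ ≤ c ^ 2 * ((∫⁻ w, K (z, w) ^ 2 * F w ^ 2 ∂freqMeasure) * N) :=
              mul_le_mul_right h _
          _ = _ := by ring
    _ = c * N * (c * (c * ∫⁻ z, ∫⁻ w, K (z, w) ^ 2 * F w ^ 2 ∂freqMeasure ∂freqMeasure)) := by
        rw [lintegral_const_mul _ (by fun_prop), lintegral_const_mul _ (by fun_prop)]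
        ring
    _ = c * N * (c * ∫⁻ w, (c * ∫⁻ z, K (z, w) ^ 2 ∂freqMeasure) * F w ^ 2 ∂freqMeasure) := by
        rw [lintegral_lintegral_swap hKF.aemeasurable]
        have e : ∀ w, (c * ∫⁻ z, K (z, w) ^ 2 ∂freqMeasure) * F w ^ 2 =
            c * ∫⁻ z, K (z, w) ^ 2 * F w ^ 2 ∂freqMeasure := by
          intro w
          rw [lintegral_mul_const _ (by fun_prop), mul_assoc]
        simp_rw [e]
        rw [lintegral_const_mul _ (by fun_prop)]
    _ ≤ c * N * (c * ∫⁻ w, A * F w ^ 2 ∂freqMeasure) := by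
        gcongr with w
        exact hA w
    _ = _ := by
        rw [lintegral_const_mul _ (by fun_prop)]
        ring

/-! ### Integrals and lattice sums of powers of brackets -/

theorem one_le_bracket (x : ℝ) : 1 ≤ bracket x := by unfold bracket; linarith [abs_nonneg x]

theorem bracket_pos (x : ℝ) : 0 < bracket x := one_pos.trans_le (one_le_bracket x)

theorem bracket_neg (x : ℝ) : bracket (-x) = bracket x := by simp [bracket]

@[fun_prop]
theorem continuous_bracket : Continuous bracket := by unfold bracket; fun_prop

@[fun_prop]
theorem measurable_bracket : Measurable bracket := continuous_bracket.measurable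

theorem bracket_add_le (x y : ℝ) : bracket (x + y) ≤ bracket x * bracket y := by
  unfold bracket
  nlinarith [abs_add_le x y, abs_nonneg x, abs_nonneg y, mul_nonneg (abs_nonneg x) (abs_nonneg y)]

/-- The integral of `⟨x⟩ ^ (-p)`. -/
noncomputable def bracketIntegral (p : ℝ) : ℝ≥0∞ := ∫⁻ x : ℝ, ENNReal.ofReal (bracket x ^ (-p))

theorem bracketIntegral_ne_top {p : ℝ} (hp : 1 < p) : bracketIntegral p ≠ ⊤ := by
  have h := integrable_one_add_norm (E := ℝ) (μ := volume) (r := p) (by simpa using hp)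
  have h2 := h.lintegral_lt_top
  exact h2.ne

theorem bracketIntegral_sub (p a : ℝ) :
    ∫⁻ x : ℝ, ENNReal.ofReal (bracket (x - a) ^ (-p)) = bracketIntegral p :=
  lintegral_sub_right_eq_self (fun x : ℝ => ENNReal.ofReal (bracket x ^ (-p))) a

theorem lintegral_comp_affine (g : ℝ → ℝ≥0∞) {m : ℝ} (hm : m ≠ 0) (n : ℝ) :
    ∫⁻ x : ℝ, g (m * x + n) = ENNReal.ofReal |m|⁻¹ * ∫⁻ x, g x := by
  have h := Real.map_volume_mul_left hm
  have hemb : MeasurableEmbedding (fun x : ℝ => m * x) :=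
    (Homeomorph.mulLeft₀ m hm).measurableEmbedding
  rw [← lintegral_add_right_eq_self g n, ← abs_inv, ← smul_eq_mul, ← lintegral_smul_measure, ← h,
    hemb.lintegral_map]

/-- Convolution of brackets. -/
theorem lintegral_bracket_mul_le {a p : ℝ} (ha : 0 ≤ a) (hap : a ≤ p) (x₀ A : ℝ) :
    ∫⁻ x : ℝ, ENNReal.ofReal (bracket (x - x₀) ^ (-a) * bracket (A - (x - x₀)) ^ (-p)) ≤
      ENNReal.ofReal (2 ^ (a + 1)) * bracketIntegral p * ENNReal.ofReal (bracket A ^ (-a)) := by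
  have key : ∀ x : ℝ, bracket x ^ (-a) * bracket (A - x) ^ (-p) ≤
      2 ^ a * bracket A ^ (-a) * (bracket x ^ (-p) + bracket (x - A) ^ (-p)) := by
    intro x
    rw [show bracket (A - x) = bracket (x - A) by rw [← bracket_neg]; ring_nf]
    set X := bracket x
    set Y := bracket (x - A)
    have hX : 1 ≤ X := one_le_bracket _
    have hY : 1 ≤ Y := one_le_bracket _
    have hA0 : 0 < bracket A := bracket_pos _
    have hA : bracket A ≤ X + Y := by
      simp only [X, Y, bracket]
      have := abs_sub x (x - A)
      rw [sub_sub_cancel] at this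
      linarith
    have hX0 : 0 < X := by linarith
    have hY0 : 0 < Y := by linarith
    have pw : ∀ Z, 0 < Z → bracket A / 2 ≤ Z → Z ^ (-a) ≤ 2 ^ a * bracket A ^ (-a) := by
      intro Z hZ h
      have := Real.rpow_le_rpow_of_nonpos (by positivity) h (neg_nonpos.2 ha)
      rw [Real.div_rpow hA0.le (by norm_num), Real.rpow_neg (by norm_num : (0:ℝ) ≤ 2), div_inv_eq_mul,
        mul_comm] at this
      exact this
    have mono : ∀ Z : ℝ, 1 ≤ Z → 0 ≤ Z ^ (-p) := fun Z hZ => Real.rpow_nonneg (by linarith) _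
    rcases le_total X Y with hXY | hXY
    · have h1 : X ^ (-a) * Y ^ (-p) ≤ Y ^ (-a) * X ^ (-p) := by
        have e1 : X ^ (-p) = X ^ (-a) * X ^ (a - p) := by
          rw [← Real.rpow_add hX0]; ring_nf
        have e2 : Y ^ (-p) = Y ^ (-a) * Y ^ (a - p) := by
          rw [← Real.rpow_add hY0]; ring_nf
        rw [e1, e2]
        have := Real.rpow_le_rpow_of_nonpos hX0 hXY (sub_nonpos.2 hap)
        have hp := mul_pos (Real.rpow_pos_of_pos hX0 (-a)) (Real.rpow_pos_of_pos hY0 (-a))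
        nlinarith
      have h2 := pw Y hY0 (by linarith)
      nlinarith [mul_le_mul_of_nonneg_right h2 (mono X hX), mul_nonneg
        (mul_nonneg (Real.rpow_nonneg zero_le_two a) (Real.rpow_nonneg hA0.le (-a))) (mono Y hY)]
    · have h2 := pw X hX0 (by linarith)
      nlinarith [mul_le_mul_of_nonneg_right h2 (mono Y hY), mul_nonneg
        (mul_nonneg (Real.rpow_nonneg zero_le_two a) (Real.rpow_nonneg hA0.le (-a))) (mono X hX)]
  have hbn : ∀ (x q : ℝ), 0 ≤ bracket x ^ q := fun x q => Real.rpow_nonneg (bracket_pos x).le q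
  calc _ = ∫⁻ x : ℝ, ENNReal.ofReal (bracket x ^ (-a) * bracket (A - x) ^ (-p)) :=
        lintegral_sub_right_eq_self
          (fun x : ℝ => ENNReal.ofReal (bracket x ^ (-a) * bracket (A - x) ^ (-p))) x₀
    _ ≤ ∫⁻ x : ℝ, ENNReal.ofReal (2 ^ a * bracket A ^ (-a)) *
        (ENNReal.ofReal (bracket x ^ (-p)) + ENNReal.ofReal (bracket (x - A) ^ (-p))) := by
        refine lintegral_mono fun x => ?_
        rw [← ENNReal.ofReal_add (hbn _ _) (hbn _ _), ← ENNReal.ofReal_mul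
          (mul_nonneg (Real.rpow_nonneg zero_le_two a) (hbn _ _))]
        exact ENNReal.ofReal_le_ofReal (key x)
    _ = ENNReal.ofReal (2 ^ a * bracket A ^ (-a)) * (bracketIntegral p + bracketIntegral p) := by
        rw [lintegral_const_mul _ (by fun_prop), lintegral_add_left (by fun_prop),
          bracketIntegral_sub]
        rfl
    _ = _ := by
        rw [ENNReal.ofReal_mul (Real.rpow_nonneg zero_le_two a), Real.rpow_add two_pos,
          Real.rpow_one, ENNReal.ofReal_mul (Real.rpow_nonneg zero_le_two a)]
        simp only [ENNReal.ofReal_ofNat]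
        ring

theorem tsum_bracket_le {lam : ℝ} (hlam : 1 < lam) {p : ℝ} (hp : 0 ≤ p) (r : ℝ) :
    ENNReal.ofReal (1 / lam) * ∑' k : ℤ, ENNReal.ofReal (bracket (k / lam - r) ^ (-p)) ≤
      ENNReal.ofReal (2 ^ p) * bracketIntegral p := by
  have hl : 0 < lam := one_pos.trans hlam
  set g : ℝ → ℝ≥0∞ := fun x => ENNReal.ofReal (bracket (lam⁻¹ * x + (-r)) ^ (-p)) with hg
  have hgm : Measurable g := by rw [hg]; fun_prop
  have hterm : ∀ k : ℤ, ENNReal.ofReal (bracket (k / lam - r) ^ (-p)) ≤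
      ENNReal.ofReal (2 ^ p) * ∫⁻ x in Set.Ioc (k : ℝ) (k + 1), g x := by
    intro k
    have hv : volume (Set.Ioc (k : ℝ) (k + 1)) = 1 := by simp
    calc _ = ∫⁻ x in Set.Ioc (k : ℝ) (k + 1), ENNReal.ofReal (bracket (k / lam - r) ^ (-p)) := by
          rw [setLIntegral_const, hv, mul_one]
      _ ≤ ∫⁻ x in Set.Ioc (k : ℝ) (k + 1), ENNReal.ofReal (2 ^ p) * g x := by
          refine setLIntegral_mono (by fun_prop) fun x hx => ?_
          rw [hg, ← ENNReal.ofReal_mul (by positivity)]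
          refine ENNReal.ofReal_le_ofReal ?_
          have hb : bracket (lam⁻¹ * x + -r) ≤ 2 * bracket (k / lam - r) := by
            have e : lam⁻¹ * x + -r = (k / lam - r) + (x - k) / lam := by field_simp; ring
            have h1 : |(x - k) / lam| ≤ 1 := by
              rw [abs_div, abs_of_pos hl, div_le_one hl, abs_le]
              constructor <;> linarith [hx.1, hx.2]
            rw [e]
            have := abs_add_le (k / lam - r) ((x - k) / lam)
            unfold bracket
            linarith [abs_nonneg (k / lam - r)]
          have h2 := Real.rpow_le_rpow_of_nonpos (bracket_pos _) hb (neg_nonpos.2 hp)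
          rw [Real.mul_rpow zero_le_two (bracket_pos _).le] at h2
          have h3 : (2 : ℝ) ^ p * 2 ^ (-p) = 1 := by
            rw [← Real.rpow_add two_pos]; simp
          have h4 := mul_le_mul_of_nonneg_left h2 (Real.rpow_nonneg zero_le_two p)
          rwa [← mul_assoc, h3, one_mul] at h4
      _ = _ := by rw [lintegral_const_mul _ hgm]
  calc _ ≤ ENNReal.ofReal (1 / lam) *
        ∑' k : ℤ, ENNReal.ofReal (2 ^ p) * ∫⁻ x in Set.Ioc (k : ℝ) (k + 1), g x :=
        mul_le_mul_right (ENNReal.tsum_le_tsum hterm) _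
    _ = ENNReal.ofReal (1 / lam) * (ENNReal.ofReal (2 ^ p) * ∫⁻ x, g x) := by
        rw [ENNReal.tsum_mul_left, ← lintegral_iUnion (fun k => measurableSet_Ioc)
          (Set.pairwise_disjoint_Ioc_intCast ℝ), iUnion_Ioc_intCast, setLIntegral_univ]
    _ = _ := by
        rw [hg, lintegral_comp_affine (fun x => ENNReal.ofReal (bracket x ^ (-p)))
          (inv_ne_zero hl.ne'), abs_of_pos (by positivity), inv_inv]
        rw [mul_left_comm, ← mul_assoc (ENNReal.ofReal (1 / lam)), ← ENNReal.ofReal_mul (by positivity),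
          one_div_mul_cancel hl.ne', ENNReal.ofReal_one, one_mul]
        rfl

/-! ### One-dimensional integrals along quadratic phases -/

theorem lintegral_abs_deriv_quadratic_le (α β γ : ℝ) {g : ℝ → ℝ≥0∞} (hg : Measurable g) :
    ∫⁻ x : ℝ, ENNReal.ofReal |2 * α * x + β| * g (α * x ^ 2 + β * x + γ) ≤ 2 * ∫⁻ x, g x := by
  set φ : ℝ → ℝ := fun x => α * x ^ 2 + β * x + γ with hφ
  have hd : ∀ x, HasDerivAt φ (2 * α * x + β) x := by
    intro x
    have h1 := ((hasDerivAt_pow 2 x).const_mul α).add ((hasDerivAt_id x).const_mul β)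
    exact (h1.add_const γ).congr_deriv (by norm_num; ring)
  have hsub : ∀ x y, φ x - φ y = (x - y) * ((2 * α * x + β) + (2 * α * y + β)) / 2 := by
    intro x y; simp only [hφ]; ring
  have part : ∀ s : Set ℝ, MeasurableSet s → Set.InjOn φ s →
      ∫⁻ x in s, ENNReal.ofReal |2 * α * x + β| * g (φ x) ≤ ∫⁻ x, g x := by
    intro s hs hinj
    rw [← lintegral_image_eq_lintegral_abs_deriv_mul hs
      (fun x _ => (hd x).hasDerivWithinAt) hinj g]
    exact setLIntegral_le_lintegral _ _
  set P : Set ℝ := {x | 0 < 2 * α * x + β}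
  set M : Set ℝ := {x | 2 * α * x + β < 0}
  have hP : MeasurableSet P := measurableSet_lt measurable_const (by fun_prop)
  have hM : MeasurableSet M := measurableSet_lt (by fun_prop) measurable_const
  have h1 := part P hP (fun x hx y hy hxy => by
    have h := hsub x y
    rw [hxy, sub_self] at h
    have hx' : 0 < 2 * α * x + β := hx
    have hy' : 0 < 2 * α * y + β := hy
    rcases mul_eq_zero.1 (show (x - y) * ((2 * α * x + β) + (2 * α * y + β)) = 0 by linarith)
      with h | h <;> linarith)
  have h2 := part M hM (fun x hx y hy hxy => by
    have h := hsub x y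
    rw [hxy, sub_self] at h
    have hx' : 2 * α * x + β < 0 := hx
    have hy' : 2 * α * y + β < 0 := hy
    rcases mul_eq_zero.1 (show (x - y) * ((2 * α * x + β) + (2 * α * y + β)) = 0 by linarith)
      with h | h <;> linarith)
  have e : ∀ x, ENNReal.ofReal |2 * α * x + β| * g (φ x) ≤
      P.indicator (fun x => ENNReal.ofReal |2 * α * x + β| * g (φ x)) x +
        M.indicator (fun x => ENNReal.ofReal |2 * α * x + β| * g (φ x)) x := by
    intro x
    rcases lt_trichotomy (2 * α * x + β) 0 with h | h | h
    · rw [Set.indicator_of_mem (s := M) h]; exact le_add_self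
    · rw [h, abs_zero, ENNReal.ofReal_zero, zero_mul]
      exact zero_le
    · rw [Set.indicator_of_mem (s := P) h]; exact le_self_add
  calc _ ≤ ∫⁻ x, (P.indicator (fun x => ENNReal.ofReal |2 * α * x + β| * g (φ x)) x +
        M.indicator (fun x => ENNReal.ofReal |2 * α * x + β| * g (φ x)) x) := lintegral_mono e
    _ = (∫⁻ x in P, ENNReal.ofReal |2 * α * x + β| * g (φ x)) +
        ∫⁻ x in M, ENNReal.ofReal |2 * α * x + β| * g (φ x) := by
        have hφm : Measurable φ := by rw [hφ]; fun_prop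
        rw [lintegral_add_left (Measurable.indicator (by fun_prop) hP), lintegral_indicator hP,
          lintegral_indicator hM]
    _ ≤ _ := (add_le_add h1 h2).trans (two_mul _).ge

theorem bracket_le_bracket_sq_sub {u A : ℝ} (hu : 0 ≤ u) :
    bracket ((1 + √|A|) * (u - √|A|)) ≤ 3 * bracket (u ^ 2 - A) := by
  set ρ := √|A|
  have hρ0 : 0 ≤ ρ := Real.sqrt_nonneg _
  have hρ2 : ρ ^ 2 = |A| := Real.sq_sqrt (abs_nonneg A)
  have hw : |u - ρ| * (u + ρ) ≤ |u ^ 2 - A| := by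
    rcases le_total 0 A with hA | hA
    · rw [abs_of_nonneg hA] at hρ2
      rw [← hρ2, show u ^ 2 - ρ ^ 2 = (u - ρ) * (u + ρ) by ring, abs_mul,
        abs_of_nonneg (add_nonneg hu hρ0)]
    · rw [abs_of_nonpos hA] at hρ2
      rw [show u ^ 2 - A = u ^ 2 + ρ ^ 2 by linarith,
        abs_of_nonneg (add_nonneg (sq_nonneg u) (sq_nonneg ρ))]
      rcases abs_cases (u - ρ) with ⟨h, -⟩ | ⟨h, -⟩ <;> rw [h] <;> nlinarith
  have hw2 : |u - ρ| ≤ u + ρ := by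
    rw [abs_le]; constructor <;> linarith
  unfold bracket
  rw [abs_mul, abs_of_nonneg (by positivity : (0 : ℝ) ≤ 1 + ρ)]
  nlinarith [abs_nonneg (u - ρ), sq_nonneg (|u - ρ| - 1), mul_nonneg (abs_nonneg (u - ρ)) hu]

/-- Sublevel set type estimate for a quadratic phase, with decay in the critical value. -/
theorem lintegral_bracket_quadratic_le {p : ℝ} (hp : 0 ≤ p) {a : ℝ} (ha : a ≠ 0) (x₀ A : ℝ) :
    ∫⁻ x : ℝ, ENNReal.ofReal (bracket (a * (x - x₀) ^ 2 - A) ^ (-p)) ≤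
      ENNReal.ofReal (2 * 3 ^ p) * bracketIntegral p *
        ENNReal.ofReal ((√|a|)⁻¹ * (1 + √|A|)⁻¹) := by
  wlog hpos : 0 < a generalizing a A
  · have h := this (a := -a) (neg_ne_zero.2 ha) (-A) (by
      rcases lt_or_gt_of_ne ha with h | h
      · linarith
      · exact absurd h hpos)
    rw [abs_neg, abs_neg] at h
    refine (le_of_eq (lintegral_congr fun x => ?_)).trans h
    rw [← bracket_neg]; ring_nf
  set ρ := √|A|
  have hρ0 : 0 ≤ ρ := Real.sqrt_nonneg _
  set b := √a
  have hb0 : 0 < b := Real.sqrt_pos.2 hpos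
  have hb2 : b ^ 2 = a := Real.sq_sqrt hpos.le
  have hbn : ∀ (x q : ℝ), 0 ≤ bracket x ^ q := fun x q => Real.rpow_nonneg (bracket_pos x).le q
  have pw : ∀ u : ℝ, bracket (u ^ 2 - A) ^ (-p) ≤
      3 ^ p * (bracket ((1 + ρ) * (u - ρ)) ^ (-p) + bracket ((1 + ρ) * (u + ρ)) ^ (-p)) := by
    have base : ∀ u : ℝ, 0 ≤ u → bracket (u ^ 2 - A) ^ (-p) ≤
        3 ^ p * bracket ((1 + ρ) * (u - ρ)) ^ (-p) := by
      intro u hu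
      have h := bracket_le_bracket_sq_sub (A := A) hu
      have h2 := Real.rpow_le_rpow_of_nonpos (bracket_pos _) h (neg_nonpos.2 hp)
      rw [Real.mul_rpow (by norm_num) (bracket_pos _).le] at h2
      have h3 : (3 : ℝ) ^ p * 3 ^ (-p) = 1 := by
        rw [← Real.rpow_add (by norm_num)]; simp
      have h4 := mul_le_mul_of_nonneg_left h2 (Real.rpow_nonneg (by norm_num : (0 : ℝ) ≤ 3) p)
      rwa [← mul_assoc, h3, one_mul] at h4
    intro u
    have h3 : (0 : ℝ) ≤ 3 ^ p := by positivity
    rcases le_total 0 u with hu | hu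
    · have := base u hu
      nlinarith [mul_nonneg h3 (hbn ((1 + ρ) * (u + ρ)) (-p))]
    · have := base (-u) (by linarith)
      rw [neg_sq, show (1 + ρ) * (-u - ρ) = -((1 + ρ) * (u + ρ)) by ring, bracket_neg] at this
      nlinarith [mul_nonneg h3 (hbn ((1 + ρ) * (u - ρ)) (-p))]
  have hm : (1 + ρ) * b ≠ 0 := by positivity
  have aff : ∀ n : ℝ, ∫⁻ x : ℝ, ENNReal.ofReal (bracket ((1 + ρ) * (b * (x - x₀) + n)) ^ (-p)) =
      ENNReal.ofReal (b⁻¹ * (1 + ρ)⁻¹) * bracketIntegral p := by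
    intro n
    have h := lintegral_comp_affine (fun x => ENNReal.ofReal (bracket x ^ (-p))) hm
      ((1 + ρ) * (-b * x₀ + n))
    rw [abs_of_pos (by positivity), mul_inv_rev] at h
    rw [bracketIntegral, ← h]
    refine lintegral_congr fun x => ?_
    congr 3; ring
  calc _ ≤ ∫⁻ x : ℝ, ENNReal.ofReal (3 ^ p) *
        (ENNReal.ofReal (bracket ((1 + ρ) * (b * (x - x₀) + -ρ)) ^ (-p)) +
          ENNReal.ofReal (bracket ((1 + ρ) * (b * (x - x₀) + ρ)) ^ (-p))) := by
        refine lintegral_mono fun x => ?_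
        rw [← ENNReal.ofReal_add (hbn _ _) (hbn _ _), ← ENNReal.ofReal_mul (by positivity)]
        refine ENNReal.ofReal_le_ofReal ?_
        have h := pw (b * (x - x₀))
        rwa [mul_pow, hb2] at h
    _ = _ := by
        rw [lintegral_const_mul _ (by fun_prop), lintegral_add_left (by fun_prop), aff, aff,
          ENNReal.ofReal_mul (by norm_num : (0 : ℝ) ≤ 2), abs_of_pos hpos]
        simp only [ENNReal.ofReal_ofNat]
        ring


/-! ### Integrals over the frequencies with a fixed sum -/

/-- The square `3 ξ ^ 2 + q ^ 2` of `|(ξ, q)|`. -/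
def sqZeta (ξ q : ℝ) : ℝ := 3 * ξ ^ 2 + q ^ 2

/-- The sum of the dispersion relations at `(ξ, q)` and `(ξ₀ - ξ, q₀ - q)`. -/
def pairPhase (ξ₀ q₀ ξ q : ℝ) : ℝ := sigma ξ q + sigma (ξ₀ - ξ) (q₀ - q)

theorem lintegral_transversal_le {p : ℝ} (ξ₀ q₀ c q : ℝ) :
    ∫⁻ ξ : ℝ, ENNReal.ofReal (|sqZeta ξ q - sqZeta (ξ₀ - ξ) (q₀ - q)| *
      bracket (c - pairPhase ξ₀ q₀ ξ q) ^ (-p)) ≤ 2 * bracketIntegral p := by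
  have h := lintegral_abs_deriv_quadratic_le (3 * ξ₀) (-3 * ξ₀ ^ 2 + q ^ 2 - (q₀ - q) ^ 2)
    (ξ₀ ^ 3 + ξ₀ * (q₀ - q) ^ 2 - c) (g := fun x => ENNReal.ofReal (bracket x ^ (-p)))
    (by fun_prop)
  refine (le_of_eq (lintegral_congr fun ξ => ?_)).trans h
  rw [ENNReal.ofReal_mul (abs_nonneg _), ← bracket_neg]
  congr 3
  · unfold sqZeta; ring_nf
  · congr 1; unfold pairPhase sigma; ring

theorem tsum_lintegral_transversal_le {lam : ℝ} (hlam : 1 < lam) {p θ : ℝ} (hθ : 0 ≤ θ)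
    (ξ₀ q₀ c r : ℝ) :
    ENNReal.ofReal (1 / lam) * ∑' k : ℤ, ∫⁻ ξ : ℝ, ENNReal.ofReal
      (|sqZeta ξ (k / lam) - sqZeta (ξ₀ - ξ) (q₀ - k / lam)| * bracket (k / lam - r) ^ (-θ) *
        bracket (c - pairPhase ξ₀ q₀ ξ (k / lam)) ^ (-p)) ≤
      2 * bracketIntegral p * (ENNReal.ofReal (2 ^ θ) * bracketIntegral θ) := by
  calc _ ≤ ENNReal.ofReal (1 / lam) * ∑' k : ℤ,
        2 * bracketIntegral p * ENNReal.ofReal (bracket (k / lam - r) ^ (-θ)) := by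
        refine mul_le_mul_right (ENNReal.tsum_le_tsum fun k => ?_) _
        have hb : 0 ≤ bracket (k / lam - r) ^ (-θ) := Real.rpow_nonneg (bracket_pos _).le _
        rw [mul_comm (2 * bracketIntegral p)]
        refine le_trans (le_of_eq ?_)
          (mul_le_mul_right (lintegral_transversal_le (p := p) ξ₀ q₀ c (k / lam)) _)
        rw [← lintegral_const_mul' _ _ ENNReal.ofReal_ne_top]
        refine lintegral_congr fun ξ => ?_
        rw [← ENNReal.ofReal_mul hb]
        congr 1; ring
    _ = 2 * bracketIntegral p * (ENNReal.ofReal (1 / lam) *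
        ∑' k : ℤ, ENNReal.ofReal (bracket (k / lam - r) ^ (-θ))) := by
        rw [ENNReal.tsum_mul_left]; ring
    _ ≤ _ := mul_le_mul_right (tsum_bracket_le hlam hθ r) _

theorem tsum_lintegral_low_le {lam : ℝ} (hlam : 1 < lam) :
    ENNReal.ofReal (1 / lam) * ∑' k : ℤ, ∫⁻ ξ : ℝ, ENNReal.ofReal
      (bracket ξ ^ (-2 : ℝ) * bracket (k / lam) ^ (-2 : ℝ)) ≤
      bracketIntegral 2 * (ENNReal.ofReal (2 ^ (2 : ℝ)) * bracketIntegral 2) := by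
  have e : ∀ k : ℤ, ∫⁻ ξ : ℝ, ENNReal.ofReal
      (bracket ξ ^ (-2 : ℝ) * bracket (k / lam) ^ (-2 : ℝ)) =
      bracketIntegral 2 * ENNReal.ofReal (bracket (k / lam - 0) ^ (-2 : ℝ)) := by
    intro k
    rw [bracketIntegral, ← lintegral_mul_const' _ _ ENNReal.ofReal_ne_top]
    refine lintegral_congr fun ξ => ?_
    rw [ENNReal.ofReal_mul (Real.rpow_nonneg (bracket_pos _).le _), sub_zero]
  simp_rw [e]
  rw [ENNReal.tsum_mul_left, mul_left_comm]
  exact mul_le_mul_right (tsum_bracket_le hlam zero_le_two 0) _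

theorem pairPhase_eq {ξ₀ : ℝ} (h : ξ₀ ≠ 0) (q₀ ξ q : ℝ) :
    pairPhase ξ₀ q₀ ξ q =
      3 * ξ₀ * (ξ - (ξ₀ / 2 - q₀ * (q - q₀ / 2) / (3 * ξ₀))) ^ 2 +
        (3 * ξ₀ ^ 2 - q₀ ^ 2) / (3 * ξ₀) * (q - q₀ / 2) ^ 2 + 2 * sigma (ξ₀ / 2) (q₀ / 2) := by
  unfold pairPhase sigma
  field_simp
  ring

theorem rpow_mul_rpow_le_add {X Y a b : ℝ} (hX : 1 ≤ X) (hY : 1 ≤ Y) (ha : 0 ≤ a) (hb : 0 ≤ b) :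
    X ^ (-a) * Y ^ (-b) ≤ X ^ (-(a + b)) + Y ^ (-(a + b)) := by
  have hX0 : 0 < X := by linarith
  have hY0 : 0 < Y := by linarith
  rw [neg_add, Real.rpow_add hX0, Real.rpow_add hY0]
  have p1 := Real.rpow_pos_of_pos hX0
  have p2 := Real.rpow_pos_of_pos hY0
  rcases le_total X Y with h | h
  · have := Real.rpow_le_rpow_of_nonpos hX0 h (neg_nonpos.2 hb)
    nlinarith [p1 (-a), p2 (-a), p2 (-b), mul_pos (p2 (-a)) (p2 (-b))]
  · have := Real.rpow_le_rpow_of_nonpos hY0 h (neg_nonpos.2 ha)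
    nlinarith [p1 (-a), p1 (-b), p2 (-b), mul_pos (p1 (-a)) (p1 (-b))]

theorem inv_one_add_sqrt_le {η κ : ℝ} (hη : 0 < η) (hη1 : η ≤ 1) (hκ : η ≤ |κ|) (d y : ℝ) :
    (1 + √|d - κ * y ^ 2|)⁻¹ ≤ η⁻¹ * (bracket (|y| - √|d / κ|))⁻¹ := by
  have hκ0 : κ ≠ 0 := by rintro rfl; simp at hκ; linarith
  have hρ2 : √|d / κ| ^ 2 = |d / κ| := Real.sq_sqrt (abs_nonneg _)
  set ρ := √|d / κ|
  have hρ0 : 0 ≤ ρ := Real.sqrt_nonneg _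
  have hsq : (|y| - ρ) ^ 2 ≤ |d / κ - y ^ 2| := by
    rw [← sq_abs y]
    have hy := abs_nonneg y
    generalize |y| = Y at hy
    rcases le_total 0 (d / κ) with h | h
    · rw [abs_of_nonneg h] at hρ2
      rw [← hρ2]
      rcases le_total Y ρ with h' | h'
      · rw [abs_of_nonneg (by nlinarith)]; nlinarith
      · rw [abs_of_nonpos (by nlinarith)]; nlinarith
    · rw [abs_of_nonpos h] at hρ2
      rw [abs_of_nonpos (by nlinarith)]; nlinarith
  have h2 : (η * |(|y| - ρ)|) ^ 2 ≤ |d - κ * y ^ 2| := by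
    have e : d - κ * y ^ 2 = κ * (d / κ - y ^ 2) := by field_simp
    rw [e, abs_mul, mul_pow, sq_abs]
    have : η ^ 2 ≤ |κ| := by nlinarith
    exact mul_le_mul this hsq (sq_nonneg _) (abs_nonneg _)
  have h3 := Real.le_sqrt_of_sq_le h2
  have hb : 0 < bracket (|y| - ρ) := bracket_pos _
  rw [← mul_inv]
  refine inv_anti₀ (by positivity) ?_
  unfold bracket
  nlinarith

theorem inv_bracket_mul_le (y ρ : ℝ) :
    bracket y ^ (-(1 / 10) : ℝ) * (bracket (|y| - ρ))⁻¹ ≤ bracket y ^ (-(11 / 10) : ℝ) +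
      (bracket (y - ρ) ^ (-(11 / 10) : ℝ) + bracket (y + ρ) ^ (-(11 / 10) : ℝ)) := by
  have h := rpow_mul_rpow_le_add (a := 1 / 10) (b := 1) (one_le_bracket y)
    (one_le_bracket (|y| - ρ)) (by norm_num) (by norm_num)
  rw [Real.rpow_neg_one] at h
  norm_num at h ⊢
  have hn : ∀ x : ℝ, 0 ≤ bracket x ^ (-(11 / 10) : ℝ) := fun x => Real.rpow_nonneg (bracket_pos x).le _
  refine h.trans ?_
  gcongr
  rcases le_total 0 y with hy | hy
  · rw [abs_of_nonneg hy]; linarith [hn (y + ρ)]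
  · rw [abs_of_nonpos hy, ← bracket_neg, show -(-y - ρ) = y + ρ by ring]; linarith [hn (y - ρ)]

theorem tsum_lintegral_elliptic_le {p η : ℝ} (hp : 1 < p) (hη : 0 < η) (hη1 : η ≤ 1) :
    ∃ C : ℝ≥0∞, C ≠ ⊤ ∧ ∀ lam : ℝ, 1 < lam → ∀ ξ₀ q₀ c : ℝ, ξ₀ ≠ 0 →
      η ≤ |(3 * ξ₀ ^ 2 - q₀ ^ 2) / (3 * ξ₀)| →
      ENNReal.ofReal (1 / lam) * ∑' k : ℤ, ∫⁻ ξ : ℝ, ENNReal.ofReal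
        (√|ξ₀| * bracket (k / lam - q₀ / 2) ^ (-(1 / 10) : ℝ) *
          bracket (c - pairPhase ξ₀ q₀ ξ (k / lam)) ^ (-p)) ≤ C := by
  refine ⟨ENNReal.ofReal (2 * 3 ^ p) * bracketIntegral p * ENNReal.ofReal η⁻¹ *
    (3 * (ENNReal.ofReal (2 ^ (11 / 10 : ℝ)) * bracketIntegral (11 / 10))), ?_, ?_⟩
  · have h1 := bracketIntegral_ne_top hp
    have h2 := bracketIntegral_ne_top (p := 11 / 10) (by norm_num)
    finiteness
  intro lam hlam ξ₀ q₀ c hξ hκ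
  set κ := (3 * ξ₀ ^ 2 - q₀ ^ 2) / (3 * ξ₀) with hκdef
  set d := c - 2 * sigma (ξ₀ / 2) (q₀ / 2) with hd
  set ρ := √|d / κ| with hρ
  set B : ℝ≥0∞ := ENNReal.ofReal (2 * 3 ^ p) * bracketIntegral p
  have hn : ∀ (x r : ℝ), 0 ≤ bracket x ^ r := fun x r => Real.rpow_nonneg (bracket_pos x).le _
  have hq : ∀ q : ℝ, ∫⁻ ξ : ℝ, ENNReal.ofReal
      (√|ξ₀| * bracket (q - q₀ / 2) ^ (-(1 / 10) : ℝ) *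
        bracket (c - pairPhase ξ₀ q₀ ξ q) ^ (-p)) ≤
      B * ENNReal.ofReal η⁻¹ * (ENNReal.ofReal (bracket (q - q₀ / 2) ^ (-(11 / 10) : ℝ)) +
        (ENNReal.ofReal (bracket (q - (q₀ / 2 + ρ)) ^ (-(11 / 10) : ℝ)) +
        ENNReal.ofReal (bracket (q - (q₀ / 2 - ρ)) ^ (-(11 / 10) : ℝ)))) := by
    intro q
    set y := q - q₀ / 2 with hy
    have h := lintegral_bracket_quadratic_le (p := p) (by linarith) (a := 3 * ξ₀) (by simpa using hξ)
      (ξ₀ / 2 - q₀ * y / (3 * ξ₀)) (d - κ * y ^ 2)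
    have e : ∀ ξ, bracket (c - pairPhase ξ₀ q₀ ξ q) =
        bracket (3 * ξ₀ * (ξ - (ξ₀ / 2 - q₀ * y / (3 * ξ₀))) ^ 2 - (d - κ * y ^ 2)) := by
      intro ξ
      rw [pairPhase_eq hξ, ← bracket_neg]
      congr 1; simp only [hd, hκdef, hy]; ring
    have hw : 0 ≤ √|ξ₀| * bracket y ^ (-(1 / 10) : ℝ) := mul_nonneg (Real.sqrt_nonneg _) (hn _ _)
    have hs : √|ξ₀| * (√|3 * ξ₀|)⁻¹ ≤ 1 := by
      have h0 : 0 < √|ξ₀| := Real.sqrt_pos.2 (abs_pos.2 hξ)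
      have h1 : √|ξ₀| ≤ √|3 * ξ₀| := by
        apply Real.sqrt_le_sqrt
        rw [abs_mul, abs_of_pos (by norm_num : (0 : ℝ) < 3)]
        linarith [abs_nonneg ξ₀]
      rw [← div_eq_mul_inv, div_le_one (h0.trans_le h1)]
      exact h1
    simp_rw [ENNReal.ofReal_mul hw, e]
    rw [lintegral_const_mul' _ _ ENNReal.ofReal_ne_top]
    refine (mul_le_mul_right h _).trans ?_
    rw [mul_left_comm, ← ENNReal.ofReal_mul hw, mul_assoc B,
      ← ENNReal.ofReal_add (hn _ _) (hn _ _),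
      ← ENNReal.ofReal_add (hn _ _) (add_nonneg (hn _ _) (hn _ _)),
      ← ENNReal.ofReal_mul (by positivity)]
    refine mul_le_mul_right (ENNReal.ofReal_le_ofReal ?_) _
    have h1 := inv_one_add_sqrt_le hη hη1 hκ d y
    have h2 := inv_bracket_mul_le y ρ
    rw [show q - (q₀ / 2 + ρ) = y - ρ by rw [hy]; ring,
      show q - (q₀ / 2 - ρ) = y + ρ by rw [hy]; ring]
    calc _ = (√|ξ₀| * (√|3 * ξ₀|)⁻¹) *
          (bracket y ^ (-(1 / 10) : ℝ) * (1 + √|d - κ * y ^ 2|)⁻¹) := by ring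
      _ ≤ 1 * (bracket y ^ (-(1 / 10) : ℝ) * (η⁻¹ * (bracket (|y| - ρ))⁻¹)) := by
          refine mul_le_mul hs (mul_le_mul_of_nonneg_left h1 (hn _ _)) ?_ zero_le_one
          exact mul_nonneg (hn _ _) (by positivity)
      _ = η⁻¹ * (bracket y ^ (-(1 / 10) : ℝ) * (bracket (|y| - ρ))⁻¹) := by ring
      _ ≤ _ := mul_le_mul_of_nonneg_left h2 (by positivity)
  refine (mul_le_mul_right (ENNReal.tsum_le_tsum fun k : ℤ => hq (k / lam)) _).trans ?_
  rw [ENNReal.tsum_mul_left, ENNReal.tsum_add, ENNReal.tsum_add, mul_left_comm]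
  have t := tsum_bracket_le hlam (p := 11 / 10) (by norm_num)
  refine mul_le_mul_right ?_ _
  rw [mul_add, mul_add]
  refine (add_le_add (t _) (add_le_add (t _) (t _))).trans (le_of_eq ?_)
  ring


/-! ### Geometry of the interacting frequencies -/

theorem sqZeta_nonneg (ξ q : ℝ) : 0 ≤ sqZeta ξ q := by unfold sqZeta; positivity

theorem absZeta_nonneg (ξ q : ℝ) : 0 ≤ absZeta ξ q := Real.sqrt_nonneg _

theorem absZeta_sq (ξ q : ℝ) : absZeta ξ q ^ 2 = sqZeta ξ q := Real.sq_sqrt (sqZeta_nonneg ξ q)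

theorem absZeta_eq_norm (ξ q : ℝ) : absZeta ξ q = ‖(⟨√3 * ξ, q⟩ : ℂ)‖ := by
  rw [Complex.norm_def, Complex.normSq_mk, absZeta]
  congr 1
  have : √3 * √3 = (3 : ℝ) := Real.mul_self_sqrt (by norm_num)
  linear_combination (-ξ ^ 2) * this

theorem absZeta_add_le (ξ q ξ' q' : ℝ) :
    absZeta (ξ + ξ') (q + q') ≤ absZeta ξ q + absZeta ξ' q' := by
  rw [absZeta_eq_norm, absZeta_eq_norm, absZeta_eq_norm]
  refine le_trans (le_of_eq ?_) (norm_add_le _ _)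
  congr 1
  apply Complex.ext <;> simp [mul_add]

theorem absZeta_le_add_sub (ξ q ξ₁ q₁ : ℝ) :
    absZeta ξ q ≤ absZeta ξ₁ q₁ + absZeta (ξ - ξ₁) (q - q₁) := by
  have := absZeta_add_le ξ₁ q₁ (ξ - ξ₁) (q - q₁)
  rwa [add_sub_cancel, add_sub_cancel] at this

theorem abs_left_le_absZeta (ξ q : ℝ) : |ξ| ≤ absZeta ξ q :=
  Real.abs_le_sqrt (by nlinarith [sq_nonneg ξ, sq_nonneg q])

theorem abs_right_le_absZeta (ξ q : ℝ) : |q| ≤ absZeta ξ q :=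
  Real.abs_le_sqrt (by nlinarith [sq_nonneg ξ, sq_nonneg q])

/-- The bracket `⟨|(ξ, q)|⟩`. -/
noncomputable def zetaBracket (ξ q : ℝ) : ℝ := bracket (absZeta ξ q)

theorem zetaBracket_eq (ξ q : ℝ) : zetaBracket ξ q = 1 + absZeta ξ q := by
  rw [zetaBracket, bracket, abs_of_nonneg (absZeta_nonneg ξ q)]

theorem one_le_zetaBracket (ξ q : ℝ) : 1 ≤ zetaBracket ξ q := one_le_bracket _

theorem zetaBracket_pos (ξ q : ℝ) : 0 < zetaBracket ξ q := bracket_pos _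

theorem bracket_le_zetaBracket (ξ q : ℝ) : bracket q ≤ zetaBracket ξ q := by
  rw [zetaBracket_eq, bracket]; linarith [abs_right_le_absZeta ξ q]

theorem zetaBracket_le_add (ξ q ξ₁ q₁ : ℝ) :
    zetaBracket ξ q + 1 ≤ zetaBracket ξ₁ q₁ + zetaBracket (ξ - ξ₁) (q - q₁) := by
  rw [zetaBracket_eq, zetaBracket_eq, zetaBracket_eq]; linarith [absZeta_le_add_sub ξ q ξ₁ q₁]

theorem zetaBracket_le_mul (ξ q ξ₁ q₁ : ℝ) :
    zetaBracket ξ q ≤ zetaBracket ξ₁ q₁ * zetaBracket (ξ - ξ₁) (q - q₁) := by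
  nlinarith [zetaBracket_le_add ξ q ξ₁ q₁, one_le_zetaBracket ξ₁ q₁,
    one_le_zetaBracket (ξ - ξ₁) (q - q₁)]

/-- The frequencies `(ξ, q)` away from the degenerate directions `ξ = 0` and `3 ξ ^ 2 = q ^ 2`. -/
def Nondegenerate (ξ q : ℝ) : Prop :=
  1 / 4 ≤ sqZeta ξ q ∧ 1 / 100 * sqZeta ξ q ≤ 3 * ξ ^ 2 ∧
    1 / 100 * sqZeta ξ q ≤ |3 * ξ ^ 2 - q ^ 2|

theorem resonance_identity (ξ q ξ₁ q₁ : ℝ) :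
    4 * (3 * ξ * ξ₁ + q * q₁) ^ 2 * (3 * ξ ^ 2) * (3 * ξ₁ ^ 2) =
      ((3 * ξ * ξ₁ + q * q₁) ^ 2 - sqZeta ξ q * sqZeta ξ₁ q₁ + sqZeta ξ₁ q₁ * (3 * ξ ^ 2) +
        sqZeta ξ q * (3 * ξ₁ ^ 2)) ^ 2 := by
  unfold sqZeta; ring

theorem no_degenerate_pair {a U W α α₁ : ℝ} (hU : |U - 1 / 2| ≤ 1 / 400)
    (hW : |W - 1 / 2| ≤ 3 / 400) (ha : |a - 1 / 4| ≤ 1 / 160) (hα : 0 ≤ α) (hα₁ : 0 ≤ α₁)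
    (h : α ≤ 1 / 190 ∨ |α - 1 / 4| ≤ 1 / 150) (h₁ : α₁ ≤ 1 / 190 ∨ |α₁ - 1 / 4| ≤ 1 / 150) :
    4 * a ^ 2 * α * α₁ ≠ (a ^ 2 - W * U + U * α + W * α₁) ^ 2 := by
  rw [abs_le] at hU hW ha
  have a1 : 59 / 1000 ≤ a ^ 2 := by nlinarith
  have a2 : a ^ 2 ≤ 66 / 1000 := by nlinarith
  have w1 : 245 / 1000 ≤ W * U := by nlinarith
  have w2 : W * U ≤ 2551 / 10000 := by nlinarith
  have small : ∀ x, 0 ≤ x → x ≤ 1 / 190 →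
      (0 ≤ U * x ∧ U * x ≤ 3 / 1000) ∧ (0 ≤ W * x ∧ W * x ≤ 3 / 1000) := by
    intro x h0 h1
    refine ⟨⟨?_, ?_⟩, ?_, ?_⟩ <;> nlinarith
  have mid : ∀ x, |x - 1 / 4| ≤ 1 / 150 →
      (12 / 100 ≤ U * x ∧ U * x ≤ 13 / 100) ∧ (119 / 1000 ≤ W * x ∧ W * x ≤ 131 / 1000) := by
    intro x h0
    rw [abs_le] at h0
    refine ⟨⟨?_, ?_⟩, ?_, ?_⟩ <;> nlinarith
  have final : ∀ E A P e b : ℝ, 0 ≤ e → 0 ≤ P → 0 ≤ A → A ≤ 66 / 1000 → e ≤ |E| → P ≤ b →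
      4 * (66 / 1000) * b < e ^ 2 → 4 * A * P ≠ E ^ 2 := by
    intro E A P e b he hP hA0 hA hE hb hlt heq
    have h1 : e ^ 2 ≤ E ^ 2 := by rw [← sq_abs E]; exact pow_le_pow_left₀ he hE 2
    have h2 : A * P ≤ 66 / 1000 * b := mul_le_mul hA hb hP (by norm_num)
    linarith
  have hP := mul_nonneg hα hα₁
  rw [mul_assoc]
  rcases h with h | h <;> rcases h₁ with h₁ | h₁
  · obtain ⟨⟨b1, b2⟩, -⟩ := small α hα h
    obtain ⟨-, c1, c2⟩ := small α₁ hα₁ h₁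
    refine final _ _ _ (1 / 10) (1 / 190 * (1 / 190)) (by norm_num) hP (by linarith) a2 ?_
      (mul_le_mul h h₁ hα₁ (by norm_num)) (by norm_num)
    rw [le_abs]; right; linarith
  · obtain ⟨⟨b1, b2⟩, -⟩ := small α hα h
    obtain ⟨-, c1, c2⟩ := mid α₁ h₁
    rw [abs_le] at h₁
    refine final _ _ _ (4 / 100) (1 / 190 * (26 / 100)) (by norm_num) hP (by linarith) a2 ?_
      (mul_le_mul h (by linarith) hα₁ (by norm_num)) (by norm_num)
    rw [le_abs]; right; linarith
  · obtain ⟨⟨b1, b2⟩, -⟩ := mid α h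
    obtain ⟨-, c1, c2⟩ := small α₁ hα₁ h₁
    rw [abs_le] at h
    refine final _ _ _ (4 / 100) (26 / 100 * (1 / 190)) (by norm_num) hP (by linarith) a2 ?_
      (mul_le_mul (by linarith) h₁ hα₁ (by norm_num)) (by norm_num)
    rw [le_abs]; right; linarith
  · obtain ⟨⟨b1, b2⟩, -⟩ := mid α h
    obtain ⟨-, c1, c2⟩ := mid α₁ h₁
    rw [abs_le] at h h₁
    have l : 24 / 100 * (24 / 100) ≤ α * α₁ :=
      mul_le_mul (by linarith) (by linarith) (by norm_num) hα
    have l2 : 59 / 1000 * (24 / 100 * (24 / 100)) ≤ a ^ 2 * (α * α₁) :=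
      mul_le_mul a1 l (by norm_num) (by positivity)
    have t : (a ^ 2 - W * U + U * α + W * α₁) ^ 2 ≤ (9 / 100) ^ 2 :=
      sq_le_sq' (by linarith) (by linarith)
    intro heq
    linarith

/-- In a nearly equilateral interaction one of the first two frequencies is nondegenerate. -/
theorem nondegenerate_or {ξ q ξ₁ q₁ : ℝ}
    (hS : 1 < sqZeta ξ₁ q₁ + sqZeta (ξ - ξ₁) (q - q₁))
    (h1 : |sqZeta ξ₁ q₁ - sqZeta (ξ - ξ₁) (q - q₁)| <
      1 / 200 * (sqZeta ξ₁ q₁ + sqZeta (ξ - ξ₁) (q - q₁)))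
    (h2 : |sqZeta ξ q - sqZeta (ξ - ξ₁) (q - q₁)| <
      1 / 200 * (sqZeta ξ₁ q₁ + sqZeta (ξ - ξ₁) (q - q₁))) :
    Nondegenerate ξ q ∨ Nondegenerate ξ₁ q₁ := by
  have hid := resonance_identity ξ q ξ₁ q₁
  set U := sqZeta ξ₁ q₁ with hU
  set V := sqZeta (ξ - ξ₁) (q - q₁) with hV
  set W := sqZeta ξ q with hW
  set S := U + V
  have hS0 : 0 < S := by linarith
  have ha : 3 * ξ * ξ₁ + q * q₁ = (W + U - V) / 2 := by
    simp only [hU, hV, hW, sqZeta]; ring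
  rw [ha] at hid
  rw [abs_lt] at h1 h2
  have hU4 : 1 / 4 ≤ U := by linarith
  have hW4 : 1 / 4 ≤ W := by linarith
  have deg : ∀ x y : ℝ, 1 / 4 ≤ sqZeta x y → |sqZeta x y / S - 1 / 2| ≤ 3 / 400 →
      ¬ Nondegenerate x y → 3 * x ^ 2 / S ≤ 1 / 190 ∨ |3 * x ^ 2 / S - 1 / 4| ≤ 1 / 150 := by
    intro x y h4 hn hnd
    rw [abs_le] at hn
    have hn1 : sqZeta x y ≤ 203 / 400 * S := by
      rw [← div_le_iff₀ hS0]; linarith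
    have hn2 : 197 / 400 * S ≤ sqZeta x y := by
      rw [← le_div_iff₀ hS0]; linarith
    by_cases hx : 1 / 100 * sqZeta x y ≤ 3 * x ^ 2
    · right
      have hy : |3 * x ^ 2 - y ^ 2| < 1 / 100 * sqZeta x y := by
        by_contra hcon
        exact hnd ⟨h4, hx, not_lt.1 hcon⟩
      have e : 3 * x ^ 2 - y ^ 2 = 2 * (3 * x ^ 2) - sqZeta x y := by unfold sqZeta; ring
      rw [e, abs_lt] at hy
      rw [abs_le]
      constructor
      · rw [le_sub_iff_add_le, le_div_iff₀ hS0]; linarith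
      · rw [sub_le_iff_le_add, div_le_iff₀ hS0]; linarith
    · left
      rw [div_le_iff₀ hS0]; linarith
  by_contra hcon
  rw [not_or] at hcon
  have nU : |U / S - 1 / 2| ≤ 1 / 400 := by
    rw [abs_le]; constructor
    · rw [le_sub_iff_add_le, le_div_iff₀ hS0]; linarith
    · rw [sub_le_iff_le_add, div_le_iff₀ hS0]; linarith
  have nW : |W / S - 1 / 2| ≤ 3 / 400 := by
    rw [abs_le]; constructor
    · rw [le_sub_iff_add_le, le_div_iff₀ hS0]; linarith
    · rw [sub_le_iff_le_add, div_le_iff₀ hS0]; linarith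
  have na : |(W + U - V) / 2 / S - 1 / 4| ≤ 1 / 160 := by
    rw [abs_le]; constructor
    · rw [le_sub_iff_add_le, le_div_iff₀ hS0]; linarith
    · rw [sub_le_iff_le_add, div_le_iff₀ hS0]; linarith
  refine no_degenerate_pair nU nW na (by positivity) (by positivity)
    (deg ξ q hW4 nW hcon.1) (deg ξ₁ q₁ hU4 (nU.trans (by norm_num)) hcon.2) ?_
  have : ∀ x y z w : ℝ, 4 * x ^ 2 * y * z = w → 4 * (x / S) ^ 2 * (y / S) * (z / S) = w / S ^ 4 := by
    intro x y z w h; rw [← h]; field_simp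
  rw [this _ _ _ _ hid]
  field_simp

/-! ### Pointwise bounds for the weight -/

/-- The square of the multiplier of the bilinear estimate at regularity `9 / 10`, without the
modulations. -/
noncomputable def interactionWeight (ξ q ξ₁ q₁ : ℝ) : ℝ :=
  ξ ^ 2 * (zetaBracket ξ q / (zetaBracket ξ₁ q₁ * zetaBracket (ξ - ξ₁) (q - q₁))) ^ (9 / 5 : ℝ)

theorem interactionWeight_nonneg (ξ q ξ₁ q₁ : ℝ) : 0 ≤ interactionWeight ξ q ξ₁ q₁ := by
  have := zetaBracket_pos ξ q
  have := zetaBracket_pos ξ₁ q₁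
  have := zetaBracket_pos (ξ - ξ₁) (q - q₁)
  unfold interactionWeight; positivity

theorem interactionWeight_le_of_low {ξ q ξ₁ q₁ : ℝ}
    (hS : sqZeta ξ₁ q₁ + sqZeta (ξ - ξ₁) (q - q₁) ≤ 1) :
    interactionWeight ξ q ξ₁ q₁ ≤ 64 * (bracket ξ₁ ^ (-2 : ℝ) * bracket q₁ ^ (-2 : ℝ)) := by
  have r1 := absZeta_nonneg ξ₁ q₁
  have r2 := absZeta_nonneg (ξ - ξ₁) (q - q₁)
  rw [← absZeta_sq, ← absZeta_sq] at hS
  have h1 : absZeta ξ₁ q₁ ≤ 1 := by nlinarith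
  have h2 : absZeta (ξ - ξ₁) (q - q₁) ≤ 1 := by nlinarith
  have h3 := absZeta_le_add_sub ξ q ξ₁ q₁
  have h4 := abs_left_le_absZeta ξ q
  have hb := zetaBracket_pos ξ q
  have hb1 := zetaBracket_pos ξ₁ q₁
  have hb2 := zetaBracket_pos (ξ - ξ₁) (q - q₁)
  have hx : ξ ^ 2 ≤ 4 := by rw [← sq_abs]; nlinarith [abs_nonneg ξ]
  have hr : (zetaBracket ξ q / (zetaBracket ξ₁ q₁ * zetaBracket (ξ - ξ₁) (q - q₁))) ^ (9 / 5 : ℝ)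
      ≤ 1 := by
    refine Real.rpow_le_one (by positivity) ?_ (by norm_num)
    rw [div_le_one (by positivity)]
    exact zetaBracket_le_mul ξ q ξ₁ q₁
  have hlow : ∀ x : ℝ, |x| ≤ 1 → 1 / 4 ≤ bracket x ^ (-2 : ℝ) := by
    intro x hx
    have : bracket x ≤ 2 := by unfold bracket; linarith
    have := Real.rpow_le_rpow_of_nonpos (bracket_pos x) this (by norm_num : (-2 : ℝ) ≤ 0)
    refine le_trans ?_ this
    rw [Real.rpow_neg (by norm_num)]; norm_num
  have e1 := hlow ξ₁ ((abs_left_le_absZeta ξ₁ q₁).trans h1)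
  have e2 := hlow q₁ ((abs_right_le_absZeta ξ₁ q₁).trans h1)
  unfold interactionWeight
  calc _ ≤ 4 * 1 := mul_le_mul hx hr (by positivity) (by norm_num)
    _ ≤ _ := by nlinarith

theorem rpow_nine_fifths_le {x y : ℝ} (hx : 0 ≤ x) (h : x ≤ y) {n : ℝ} (hn : 1 ≤ n) {z : ℝ} (hz : 0 < z)
    (hy : y = n / z) : x ^ (9 / 5 : ℝ) ≤ n ^ 2 * z ^ (-(9 / 5) : ℝ) := by
  have h1 := Real.rpow_le_rpow hx h (by norm_num : (0 : ℝ) ≤ 9 / 5)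
  rw [hy, Real.div_rpow (by linarith) hz.le, div_eq_mul_inv (n ^ _), ← Real.rpow_neg hz.le] at h1
  refine h1.trans (mul_le_mul_of_nonneg_right ?_ (by positivity))
  have := Real.rpow_le_rpow_of_exponent_le hn (by norm_num : (9 / 5 : ℝ) ≤ 2)
  rwa [Real.rpow_two] at this

theorem interactionWeight_le_of_transversal {ξ q ξ₁ q₁ : ℝ}
    (hD : 1 / 200 * (sqZeta ξ₁ q₁ + sqZeta (ξ - ξ₁) (q - q₁)) ≤
      |sqZeta ξ₁ q₁ - sqZeta (ξ - ξ₁) (q - q₁)|) :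
    interactionWeight ξ q ξ₁ q₁ ≤ 1600 * (|sqZeta ξ₁ q₁ - sqZeta (ξ - ξ₁) (q - q₁)| *
      (bracket q₁ ^ (-(9 / 5) : ℝ) + bracket (q₁ - q) ^ (-(9 / 5) : ℝ))) := by
  have r1 := absZeta_nonneg ξ₁ q₁
  have r2 := absZeta_nonneg (ξ - ξ₁) (q - q₁)
  have h3 := absZeta_le_add_sub ξ q ξ₁ q₁
  have h4 := abs_left_le_absZeta ξ q
  have hb := zetaBracket_pos ξ q
  have hb1 := zetaBracket_pos ξ₁ q₁
  have hb2 := zetaBracket_pos (ξ - ξ₁) (q - q₁)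
  set D := |sqZeta ξ₁ q₁ - sqZeta (ξ - ξ₁) (q - q₁)|
  have hx : ξ ^ 2 ≤ 400 * D := by
    rw [← absZeta_sq, ← absZeta_sq] at hD
    rw [← sq_abs]
    nlinarith [abs_nonneg ξ, sq_nonneg (absZeta ξ₁ q₁ - absZeta (ξ - ξ₁) (q - q₁))]
  have n1 : 0 ≤ bracket q₁ ^ (-(9 / 5) : ℝ) := Real.rpow_nonneg (bracket_pos _).le _
  have n2 : 0 ≤ bracket (q₁ - q) ^ (-(9 / 5) : ℝ) := Real.rpow_nonneg (bracket_pos _).le _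
  have hadd := zetaBracket_le_add ξ q ξ₁ q₁
  have hr : (zetaBracket ξ q / (zetaBracket ξ₁ q₁ * zetaBracket (ξ - ξ₁) (q - q₁))) ^ (9 / 5 : ℝ)
      ≤ 4 * (bracket q₁ ^ (-(9 / 5) : ℝ) + bracket (q₁ - q) ^ (-(9 / 5) : ℝ)) := by
    rcases le_total (zetaBracket ξ₁ q₁) (zetaBracket (ξ - ξ₁) (q - q₁)) with h | h
    · have := rpow_nine_fifths_le (x := zetaBracket ξ q / (zetaBracket ξ₁ q₁ *
        zetaBracket (ξ - ξ₁) (q - q₁))) (y := 2 / zetaBracket ξ₁ q₁) (by positivity) (by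
          rw [div_le_div_iff₀ (by positivity) hb1]; nlinarith) one_le_two hb1 rfl
      have m := Real.rpow_le_rpow_of_nonpos (bracket_pos _) (bracket_le_zetaBracket ξ₁ q₁)
        (by norm_num : (-(9 / 5) : ℝ) ≤ 0)
      linarith
    · have := rpow_nine_fifths_le (x := zetaBracket ξ q / (zetaBracket ξ₁ q₁ *
        zetaBracket (ξ - ξ₁) (q - q₁))) (y := 2 / zetaBracket (ξ - ξ₁) (q - q₁)) (by positivity) (by
          rw [div_le_div_iff₀ (by positivity) hb2]; nlinarith) one_le_two hb2 rfl
      have m := Real.rpow_le_rpow_of_nonpos (bracket_pos _)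
        (bracket_le_zetaBracket (ξ - ξ₁) (q - q₁)) (by norm_num : (-(9 / 5) : ℝ) ≤ 0)
      rw [← bracket_neg (q - q₁), neg_sub] at m
      linarith
  have hD0 : 0 ≤ D := abs_nonneg _
  calc _ ≤ 400 * D * (4 * (bracket q₁ ^ (-(9 / 5) : ℝ) + bracket (q₁ - q) ^ (-(9 / 5) : ℝ))) :=
        mul_le_mul hx hr (by positivity) (by positivity)
    _ = _ := by ring

theorem rpow_two_fifths_le {B x y : ℝ} (hB : 1 ≤ B) (hx : B ≤ 64 * |x|) (hy : bracket y ≤ 2 * B) :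
    B ^ (2 / 5 : ℝ) ≤ 16 * (√|x| * bracket y ^ (-(1 / 10) : ℝ)) := by
  have hB0 : 0 < B := by linarith
  have h1 : √B ≤ 8 * √|x| := by
    refine (Real.sqrt_le_sqrt hx).trans (le_of_eq ?_)
    rw [Real.sqrt_mul (by norm_num), show (64 : ℝ) = 8 ^ 2 by norm_num, Real.sqrt_sq (by norm_num)]
  have h2 := Real.rpow_le_rpow_of_nonpos (bracket_pos y) hy (by norm_num : (-(1 / 10) : ℝ) ≤ 0)
  rw [Real.mul_rpow (by norm_num) hB0.le] at h2
  have h3 : (1 / 2 : ℝ) ≤ 2 ^ (-(1 / 10) : ℝ) := by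
    have := Real.rpow_le_rpow_of_exponent_le one_le_two (by norm_num : (-1 : ℝ) ≤ -(1 / 10))
    rw [Real.rpow_neg_one] at this
    linarith
  have h4 : 0 < B ^ (-(1 / 10) : ℝ) := by positivity
  have h5 : B ^ (2 / 5 : ℝ) = √B * B ^ (-(1 / 10) : ℝ) := by
    rw [Real.sqrt_eq_rpow, ← Real.rpow_add hB0]; norm_num
  rw [h5]
  have h6 : B ^ (-(1 / 10) : ℝ) ≤ 2 * bracket y ^ (-(1 / 10) : ℝ) := by nlinarith
  calc _ ≤ (8 * √|x|) * (2 * bracket y ^ (-(1 / 10) : ℝ)) :=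
        mul_le_mul h1 h6 h4.le (by positivity)
    _ = _ := by ring

theorem zetaBracket_le_of_nondegenerate {ξ q : ℝ} (h : Nondegenerate ξ q) :
    zetaBracket ξ q ≤ 64 * |ξ| := by
  obtain ⟨h1, h2, -⟩ := h
  rw [← absZeta_sq] at h1 h2
  have h0 := absZeta_nonneg ξ q
  have h3 : 1 / 2 ≤ absZeta ξ q := by nlinarith
  have h4 : absZeta ξ q ≤ 20 * |ξ| := by
    refine abs_le_of_sq_le_sq' ?_ (by positivity) |>.2
    rw [mul_pow, sq_abs]; nlinarith
  rw [zetaBracket_eq]; linarith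

theorem Nondegenerate.ne_zero {ξ q : ℝ} (h : Nondegenerate ξ q) : ξ ≠ 0 := by
  rintro rfl
  have := h.1
  have := h.2.1
  norm_num at this
  linarith

theorem Nondegenerate.le_abs_div {ξ q : ℝ} (h : Nondegenerate ξ q) :
    1 / 600 ≤ |(3 * ξ ^ 2 - q ^ 2) / (3 * ξ)| := by
  have hξ := abs_pos.2 h.ne_zero
  obtain ⟨h1, -, h2⟩ := h
  rw [abs_div, le_div_iff₀ (by rw [abs_mul]; positivity), abs_mul,
    abs_of_pos (by norm_num : (0 : ℝ) < 3)]
  refine le_trans ?_ h2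
  have h3 := abs_left_le_absZeta ξ q
  have h0 := absZeta_nonneg ξ q
  rw [← absZeta_sq] at h1 ⊢
  have h4 : 1 / 2 ≤ absZeta ξ q := by nlinarith
  nlinarith

section
variable {ξ q ξ₁ q₁ : ℝ}
  (hS : 1 < sqZeta ξ₁ q₁ + sqZeta (ξ - ξ₁) (q - q₁))
  (h1 : |sqZeta ξ₁ q₁ - sqZeta (ξ - ξ₁) (q - q₁)| <
      1 / 200 * (sqZeta ξ₁ q₁ + sqZeta (ξ - ξ₁) (q - q₁)))
include hS h1

theorem zetaBracket_comparable :
    zetaBracket ξ₁ q₁ ≤ 2 * zetaBracket (ξ - ξ₁) (q - q₁) ∧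
      zetaBracket (ξ - ξ₁) (q - q₁) ≤ 2 * zetaBracket ξ₁ q₁ ∧
      zetaBracket ξ₁ q₁ ≤ 3 * absZeta ξ₁ q₁ := by
  have r1 := absZeta_nonneg ξ₁ q₁
  have r2 := absZeta_nonneg (ξ - ξ₁) (q - q₁)
  rw [abs_lt] at h1
  rw [zetaBracket_eq, zetaBracket_eq]
  rw [← absZeta_sq, ← absZeta_sq] at *
  refine ⟨?_, ?_, ?_⟩ <;> nlinarith

theorem interactionWeight_mul_le_of_transversal
    (h2 : 1 / 200 * (sqZeta ξ₁ q₁ + sqZeta (ξ - ξ₁) (q - q₁)) ≤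
      |sqZeta ξ q - sqZeta (ξ - ξ₁) (q - q₁)|) :
    interactionWeight ξ q ξ₁ q₁ *
      (zetaBracket ξ₁ q₁ * zetaBracket (ξ - ξ₁) (q - q₁)) ^ (1 / 10 : ℝ) ≤
      3499200 * (|sqZeta ξ q - sqZeta (ξ - ξ₁) (q - q₁)| * bracket q ^ (-(6 / 5) : ℝ)) := by
  obtain ⟨c1, c2, c3⟩ := zetaBracket_comparable hS h1
  have hadd := zetaBracket_le_add ξ q ξ₁ q₁
  have hx : |ξ| ≤ zetaBracket ξ q := by
    rw [zetaBracket_eq]; linarith [abs_left_le_absZeta ξ q]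
  have hone := one_le_zetaBracket ξ₁ q₁
  have hU : absZeta ξ₁ q₁ ^ 2 ≤ 200 * |sqZeta ξ q - sqZeta (ξ - ξ₁) (q - q₁)| := by
    rw [absZeta_sq]; linarith [sqZeta_nonneg (ξ - ξ₁) (q - q₁)]
  have hq := Real.rpow_le_rpow_of_nonpos (bracket_pos q) (bracket_le_zetaBracket ξ q)
    (by norm_num : (-(6 / 5) : ℝ) ≤ 0)
  have hB := zetaBracket_pos ξ q
  have hB1 := zetaBracket_pos ξ₁ q₁
  have hB2 := zetaBracket_pos (ξ - ξ₁) (q - q₁)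
  have r1 := absZeta_nonneg ξ₁ q₁
  unfold interactionWeight
  set B := zetaBracket ξ q
  set B1 := zetaBracket ξ₁ q₁
  set B2 := zetaBracket (ξ - ξ₁) (q - q₁)
  set D := |sqZeta ξ q - sqZeta (ξ - ξ₁) (q - q₁)|
  have hB3 : B ≤ 3 * B1 := by linarith
  have e1 : (B / (B1 * B2)) ^ (9 / 5 : ℝ) ≤ 2 ^ 2 * (B1 ^ 2 / B) ^ (-(9 / 5) : ℝ) := by
    refine rpow_nine_fifths_le (by positivity) (y := 2 / (B1 ^ 2 / B)) ?_ one_le_two (by positivity) rfl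
    rw [div_div_eq_mul_div, div_le_div_iff₀ (by positivity) (by positivity)]
    nlinarith [mul_pos hB hB1]
  have e2 : (B1 ^ 2 / B) ^ (-(9 / 5) : ℝ) = B ^ (9 / 5 : ℝ) * B1 ^ (-(18 / 5) : ℝ) := by
    rw [Real.div_rpow (by positivity) hB.le, Real.rpow_neg hB.le, div_inv_eq_mul,
      ← Real.rpow_natCast, ← Real.rpow_mul hB1.le, mul_comm]
    norm_num
  have e3 : (B1 * B2) ^ (1 / 10 : ℝ) ≤ 2 * B1 ^ (1 / 5 : ℝ) := by
    have : B1 * B2 ≤ 2 * B1 ^ 2 := by nlinarith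
    refine (Real.rpow_le_rpow (by positivity) this (by norm_num)).trans ?_
    rw [Real.mul_rpow (by norm_num) (by positivity), ← Real.rpow_natCast, ← Real.rpow_mul hB1.le]
    have h2 := Real.rpow_le_rpow_of_exponent_le one_le_two (by norm_num : (1 / 10 : ℝ) ≤ 1)
    rw [Real.rpow_one] at h2
    norm_num at h2 ⊢
    exact mul_le_mul_of_nonneg_right h2 (by positivity)
  have e4 : ξ ^ 2 ≤ B ^ 2 := by rw [← sq_abs]; exact pow_le_pow_left₀ (abs_nonneg _) hx 2
  have e5 : B ^ 2 * B ^ (9 / 5 : ℝ) = B ^ 5 * B ^ (-(6 / 5) : ℝ) := by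
    rw [← Real.rpow_natCast, ← Real.rpow_natCast, ← Real.rpow_add hB, ← Real.rpow_add hB]; norm_num
  have e6 : B1 ^ (-(18 / 5) : ℝ) * B1 ^ (1 / 5 : ℝ) * B1 ^ 5 ≤ B1 ^ 2 := by
    rw [← Real.rpow_natCast, ← Real.rpow_natCast, ← Real.rpow_add hB1, ← Real.rpow_add hB1]
    exact Real.rpow_le_rpow_of_exponent_le hone (by norm_num)
  have e7 : B ^ 5 ≤ 243 * B1 ^ 5 := by
    have := pow_le_pow_left₀ hB.le hB3 5
    rw [mul_pow] at this; norm_num at this; exact this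
  have e8 : B1 ^ 2 ≤ 1800 * D := by nlinarith
  calc _ ≤ (B ^ 2 * (2 ^ 2 * (B ^ (9 / 5 : ℝ) * B1 ^ (-(18 / 5) : ℝ)))) *
        (2 * B1 ^ (1 / 5 : ℝ)) := by
        rw [← e2]
        exact mul_le_mul (mul_le_mul e4 e1 (by positivity) (by positivity)) e3 (by positivity)
          (by positivity)
    _ = 8 * (B ^ 2 * B ^ (9 / 5 : ℝ)) * (B1 ^ (-(18 / 5) : ℝ) * B1 ^ (1 / 5 : ℝ)) := by ring
    _ = 8 * (B ^ (-(6 / 5) : ℝ)) * (B1 ^ (-(18 / 5) : ℝ) * B1 ^ (1 / 5 : ℝ)) * B ^ 5 := by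
        rw [e5]; ring
    _ ≤ 8 * (B ^ (-(6 / 5) : ℝ)) * (B1 ^ (-(18 / 5) : ℝ) * B1 ^ (1 / 5 : ℝ)) * (243 * B1 ^ 5) :=
        mul_le_mul_of_nonneg_left e7 (by positivity)
    _ = 1944 * (B ^ (-(6 / 5) : ℝ)) *
        (B1 ^ (-(18 / 5) : ℝ) * B1 ^ (1 / 5 : ℝ) * B1 ^ 5) := by ring
    _ ≤ 1944 * (bracket q ^ (-(6 / 5) : ℝ)) * (1800 * D) := by
        refine mul_le_mul (mul_le_mul_of_nonneg_left hq (by norm_num)) (e6.trans e8)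
          (by positivity) ?_
        exact mul_nonneg (by norm_num) (Real.rpow_nonneg (bracket_pos _).le _)
    _ = _ := by ring

variable (h2 : |sqZeta ξ q - sqZeta (ξ - ξ₁) (q - q₁)| <
      1 / 200 * (sqZeta ξ₁ q₁ + sqZeta (ξ - ξ₁) (q - q₁)))
include h2

theorem absZeta_comparable : absZeta ξ₁ q₁ ≤ 11 / 10 * absZeta ξ q ∧
    absZeta (ξ - ξ₁) (q - q₁) ≤ 11 / 10 * absZeta ξ q ∧
    absZeta ξ q ≤ 11 / 10 * absZeta ξ₁ q₁ := by
  have r := absZeta_nonneg ξ q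
  have r1 := absZeta_nonneg ξ₁ q₁
  have r2 := absZeta_nonneg (ξ - ξ₁) (q - q₁)
  rw [abs_lt] at h1 h2
  rw [← absZeta_sq, ← absZeta_sq] at *
  rw [← absZeta_sq] at h2
  refine ⟨?_, ?_, ?_⟩ <;> refine (abs_le_of_sq_le_sq' ?_ (by positivity)).2 <;> nlinarith

theorem interactionWeight_le_rpow : interactionWeight ξ q ξ₁ q₁ ≤
    16 * zetaBracket ξ q ^ (1 / 5 : ℝ) := by
  obtain ⟨c1, c2, c3⟩ := absZeta_comparable hS h1 h2
  have r := absZeta_nonneg ξ q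
  have b0 := zetaBracket_eq ξ q
  have hB := zetaBracket_pos ξ q
  have hB1 := zetaBracket_pos ξ₁ q₁
  have hB2 := zetaBracket_pos (ξ - ξ₁) (q - q₁)
  have hadd := zetaBracket_le_add ξ q ξ₁ q₁
  have d1 : zetaBracket ξ q ≤ 2 * zetaBracket ξ₁ q₁ := by
    rw [zetaBracket_eq, zetaBracket_eq]; linarith
  obtain ⟨c4, c5, -⟩ := zetaBracket_comparable hS h1
  have d2 : zetaBracket ξ q ≤ 2 * zetaBracket (ξ - ξ₁) (q - q₁) := by
    have r1 := absZeta_nonneg ξ₁ q₁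
    have r2 := absZeta_nonneg (ξ - ξ₁) (q - q₁)
    rw [zetaBracket_eq, zetaBracket_eq]
    have : absZeta ξ q ≤ 2 * absZeta (ξ - ξ₁) (q - q₁) := by
      rw [abs_lt] at h1 h2
      rw [← absZeta_sq, ← absZeta_sq] at *
      rw [← absZeta_sq] at h2
      refine (abs_le_of_sq_le_sq' ?_ (by positivity)).2
      nlinarith
    linarith
  have hx : |ξ| ≤ zetaBracket ξ q := by
    rw [zetaBracket_eq]; linarith [abs_left_le_absZeta ξ q]
  unfold interactionWeight
  set B := zetaBracket ξ q
  set B1 := zetaBracket ξ₁ q₁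
  set B2 := zetaBracket (ξ - ξ₁) (q - q₁)
  have e1 : (B / (B1 * B2)) ^ (9 / 5 : ℝ) ≤ 4 ^ 2 * B ^ (-(9 / 5) : ℝ) := by
    refine rpow_nine_fifths_le (by positivity) (y := 4 / B) ?_ (by norm_num) hB rfl
    rw [div_le_div_iff₀ (by positivity) hB]
    nlinarith [mul_le_mul d1 d2 hB.le (by positivity)]
  have e4 : ξ ^ 2 ≤ B ^ 2 := by rw [← sq_abs]; exact pow_le_pow_left₀ (abs_nonneg _) hx 2
  calc _ ≤ B ^ 2 * (4 ^ 2 * B ^ (-(9 / 5) : ℝ)) := mul_le_mul e4 e1 (by positivity) (by positivity)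
    _ = 16 * (B ^ 2 * B ^ (-(9 / 5) : ℝ)) := by ring
    _ = _ := by rw [← Real.rpow_natCast, ← Real.rpow_add hB]; norm_num

theorem interactionWeight_le_of_elliptic (hg : Nondegenerate ξ q) :
    interactionWeight ξ q ξ₁ q₁ ≤
      256 * (√|ξ| * bracket (q₁ - q / 2) ^ (-(1 / 10) : ℝ)) := by
  have hone := one_le_zetaBracket ξ q
  have hy : bracket (q₁ - q / 2) ≤ 2 * zetaBracket ξ q := by
    obtain ⟨c1, c2, c3⟩ := absZeta_comparable hS h1 h2
    have r := absZeta_nonneg ξ q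
    rw [zetaBracket_eq, bracket]
    have a1 := abs_right_le_absZeta ξ₁ q₁
    have a2 := abs_right_le_absZeta (ξ - ξ₁) (q - q₁)
    have : |q₁ - q / 2| ≤ (|q₁| + |q - q₁|) / 2 := by
      have := abs_sub q₁ (q - q₁)
      rw [show q₁ - q / 2 = (q₁ - (q - q₁)) / 2 by ring, abs_div, abs_two]
      linarith
    linarith
  have h := rpow_two_fifths_le hone (zetaBracket_le_of_nondegenerate hg) hy
  have h3 := Real.rpow_le_rpow_of_exponent_le hone (by norm_num : (1 / 5 : ℝ) ≤ 2 / 5)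
  linarith [interactionWeight_le_rpow hS h1 h2]

theorem interactionWeight_mul_le_of_elliptic (hg : Nondegenerate ξ₁ q₁) :
    interactionWeight ξ q ξ₁ q₁ *
      (zetaBracket ξ₁ q₁ * zetaBracket (ξ - ξ₁) (q - q₁)) ^ (1 / 10 : ℝ) ≤
      1024 * (√|ξ₁| * bracket (q - q₁ / 2) ^ (-(1 / 10) : ℝ)) := by
  have hone := one_le_zetaBracket ξ₁ q₁
  obtain ⟨c1, c2, c3⟩ := absZeta_comparable hS h1 h2
  obtain ⟨c4, c5, -⟩ := zetaBracket_comparable hS h1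
  have r1 := absZeta_nonneg ξ₁ q₁
  have hy : bracket (q - q₁ / 2) ≤ 2 * zetaBracket ξ₁ q₁ := by
    rw [zetaBracket_eq, bracket]
    have a1 := abs_right_le_absZeta ξ₁ q₁
    have a2 := abs_right_le_absZeta ξ q
    have := abs_sub q (q₁ / 2)
    rw [abs_div, abs_two] at this
    linarith
  have h := rpow_two_fifths_le hone (zetaBracket_le_of_nondegenerate hg) hy
  have hd : zetaBracket ξ q ≤ 2 * zetaBracket ξ₁ q₁ := by
    rw [zetaBracket_eq, zetaBracket_eq]; linarith
  have hw := interactionWeight_le_rpow hS h1 h2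
  have hB := zetaBracket_pos ξ q
  have hB1 := zetaBracket_pos ξ₁ q₁
  have hB2 := zetaBracket_pos (ξ - ξ₁) (q - q₁)
  set B := zetaBracket ξ q
  set B1 := zetaBracket ξ₁ q₁
  set B2 := zetaBracket (ξ - ξ₁) (q - q₁)
  have two_rpow : ∀ x : ℝ, x ≤ 1 → (2 : ℝ) ^ x ≤ 2 := fun x hx => by
    simpa using Real.rpow_le_rpow_of_exponent_le one_le_two hx
  have e1 : B ^ (1 / 5 : ℝ) ≤ 2 * B1 ^ (1 / 5 : ℝ) := by
    refine (Real.rpow_le_rpow hB.le hd (by norm_num)).trans ?_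
    rw [Real.mul_rpow (by norm_num) hB1.le]
    exact mul_le_mul_of_nonneg_right (two_rpow _ (by norm_num)) (by positivity)
  have e3 : (B1 * B2) ^ (1 / 10 : ℝ) ≤ 2 * B1 ^ (1 / 5 : ℝ) := by
    have : B1 * B2 ≤ 2 * B1 ^ 2 := by nlinarith
    refine (Real.rpow_le_rpow (by positivity) this (by norm_num)).trans ?_
    rw [Real.mul_rpow (by norm_num) (by positivity), ← Real.rpow_natCast, ← Real.rpow_mul hB1.le,
      show ((2 : ℕ) : ℝ) * (1 / 10) = 1 / 5 by norm_num]
    exact mul_le_mul_of_nonneg_right (two_rpow _ (by norm_num)) (by positivity)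
  calc _ ≤ (16 * (2 * B1 ^ (1 / 5 : ℝ))) * (2 * B1 ^ (1 / 5 : ℝ)) :=
        mul_le_mul (hw.trans (by linarith)) e3 (by positivity) (by positivity)
    _ = 64 * (B1 ^ (1 / 5 : ℝ) * B1 ^ (1 / 5 : ℝ)) := by ring
    _ = 64 * B1 ^ (2 / 5 : ℝ) := by rw [← Real.rpow_add hB1]; norm_num
    _ ≤ _ := by linarith

end


/-! ### Integral bounds for the kernel -/

/-- The interactions estimated for a fixed output frequency. -/
def OutputRegion (ξ q ξ₁ q₁ : ℝ) : Prop :=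
  sqZeta ξ₁ q₁ + sqZeta (ξ - ξ₁) (q - q₁) ≤ 1 ∨
    1 / 200 * (sqZeta ξ₁ q₁ + sqZeta (ξ - ξ₁) (q - q₁)) ≤
      |sqZeta ξ₁ q₁ - sqZeta (ξ - ξ₁) (q - q₁)| ∨
    (|sqZeta ξ q - sqZeta (ξ - ξ₁) (q - q₁)| <
      1 / 200 * (sqZeta ξ₁ q₁ + sqZeta (ξ - ξ₁) (q - q₁)) ∧ Nondegenerate ξ q)

open Classical in
theorem interactionWeight_le_of_mem {ξ q ξ₁ q₁ : ℝ} (h : OutputRegion ξ q ξ₁ q₁) :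
    interactionWeight ξ q ξ₁ q₁ ≤ 64 * (bracket ξ₁ ^ (-2 : ℝ) * bracket q₁ ^ (-2 : ℝ)) +
      1600 * (|sqZeta ξ₁ q₁ - sqZeta (ξ - ξ₁) (q - q₁)| *
        (bracket q₁ ^ (-(9 / 5) : ℝ) + bracket (q₁ - q) ^ (-(9 / 5) : ℝ))) +
      (if Nondegenerate ξ q then 256 * (√|ξ| * bracket (q₁ - q / 2) ^ (-(1 / 10) : ℝ)) else 0) := by
  have hn : ∀ (x r : ℝ), 0 ≤ bracket x ^ r := fun x r => Real.rpow_nonneg (bracket_pos x).le _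
  have p1 : 0 ≤ 64 * (bracket ξ₁ ^ (-2 : ℝ) * bracket q₁ ^ (-2 : ℝ)) :=
    mul_nonneg (by norm_num) (mul_nonneg (hn _ _) (hn _ _))
  have p2 : 0 ≤ 1600 * (|sqZeta ξ₁ q₁ - sqZeta (ξ - ξ₁) (q - q₁)| *
        (bracket q₁ ^ (-(9 / 5) : ℝ) + bracket (q₁ - q) ^ (-(9 / 5) : ℝ))) :=
    mul_nonneg (by norm_num) (mul_nonneg (abs_nonneg _) (add_nonneg (hn _ _) (hn _ _)))
  have p3 : 0 ≤ 256 * (√|ξ| * bracket (q₁ - q / 2) ^ (-(1 / 10) : ℝ)) :=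
    mul_nonneg (by norm_num) (mul_nonneg (Real.sqrt_nonneg _) (hn _ _))
  have p3' : 0 ≤ if Nondegenerate ξ q then
      256 * (√|ξ| * bracket (q₁ - q / 2) ^ (-(1 / 10) : ℝ)) else 0 := by
    split_ifs <;> linarith
  by_cases hS : sqZeta ξ₁ q₁ + sqZeta (ξ - ξ₁) (q - q₁) ≤ 1
  · linarith [interactionWeight_le_of_low hS]
  by_cases hD : 1 / 200 * (sqZeta ξ₁ q₁ + sqZeta (ξ - ξ₁) (q - q₁)) ≤
      |sqZeta ξ₁ q₁ - sqZeta (ξ - ξ₁) (q - q₁)|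
  · linarith [interactionWeight_le_of_transversal hD]
  rcases h with h | h | ⟨h, hnd⟩
  · exact absurd h hS
  · exact absurd h hD
  · rw [if_pos hnd]
    linarith [interactionWeight_le_of_elliptic (not_le.1 hS) (not_le.1 hD) h hnd]

open Classical in
theorem interactionWeight_mul_le_of_notMem {ξ q ξ₁ q₁ : ℝ} (h : ¬ OutputRegion ξ q ξ₁ q₁) :
    interactionWeight ξ q ξ₁ q₁ *
      (zetaBracket ξ₁ q₁ * zetaBracket (ξ - ξ₁) (q - q₁)) ^ (1 / 10 : ℝ) ≤
      3499200 * (|sqZeta ξ q - sqZeta (ξ₁ - ξ) (q₁ - q)| * bracket q ^ (-(6 / 5) : ℝ)) +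
      (if Nondegenerate ξ₁ q₁ then
        1024 * (√|ξ₁| * bracket (q - q₁ / 2) ^ (-(1 / 10) : ℝ)) else 0) := by
  have hn : ∀ (x r : ℝ), 0 ≤ bracket x ^ r := fun x r => Real.rpow_nonneg (bracket_pos x).le _
  have e : sqZeta (ξ₁ - ξ) (q₁ - q) = sqZeta (ξ - ξ₁) (q - q₁) := by unfold sqZeta; ring
  rw [e]
  have p1 : 0 ≤ 3499200 * (|sqZeta ξ q - sqZeta (ξ - ξ₁) (q - q₁)| * bracket q ^ (-(6 / 5) : ℝ)) :=
    mul_nonneg (by norm_num) (mul_nonneg (abs_nonneg _) (hn _ _))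
  have p3 : 0 ≤ 1024 * (√|ξ₁| * bracket (q - q₁ / 2) ^ (-(1 / 10) : ℝ)) :=
    mul_nonneg (by norm_num) (mul_nonneg (Real.sqrt_nonneg _) (hn _ _))
  have p3' : 0 ≤ if Nondegenerate ξ₁ q₁ then
      1024 * (√|ξ₁| * bracket (q - q₁ / 2) ^ (-(1 / 10) : ℝ)) else 0 := by
    split_ifs <;> linarith
  simp only [OutputRegion, not_or, not_and, not_le] at h
  obtain ⟨hS, h1, h3⟩ := h
  by_cases h2 : |sqZeta ξ q - sqZeta (ξ - ξ₁) (q - q₁)| <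
      1 / 200 * (sqZeta ξ₁ q₁ + sqZeta (ξ - ξ₁) (q - q₁))
  · have hg := (nondegenerate_or hS h1 h2).resolve_left (h3 h2)
    rw [if_pos hg]
    linarith [interactionWeight_mul_le_of_elliptic hS h1 h2 hg]
  · linarith [interactionWeight_mul_le_of_transversal hS h1 (not_lt.1 h2)]

@[fun_prop]
theorem measurable_sqZeta {α : Type*} [MeasurableSpace α] {f g : α → ℝ} (hf : Measurable f)
    (hg : Measurable g) : Measurable fun x => sqZeta (f x) (g x) := by unfold sqZeta; fun_prop

@[fun_prop]
theorem measurable_sigma {α : Type*} [MeasurableSpace α] {f g : α → ℝ} (hf : Measurable f)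
    (hg : Measurable g) : Measurable fun x => sigma (f x) (g x) := by unfold sigma; fun_prop

@[fun_prop]
theorem measurable_pairPhase {α : Type*} [MeasurableSpace α] {ξ₀ q₀ : ℝ} {f g : α → ℝ}
    (hf : Measurable f) (hg : Measurable g) :
    Measurable fun x => pairPhase ξ₀ q₀ (f x) (g x) := by unfold pairPhase; fun_prop

@[fun_prop]
theorem measurable_zetaBracket {α : Type*} [MeasurableSpace α] {f g : α → ℝ} (hf : Measurable f)
    (hg : Measurable g) : Measurable fun x => zetaBracket (f x) (g x) := by
  unfold zetaBracket absZeta; fun_prop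

@[fun_prop]
theorem measurable_interactionWeight {α : Type*} [MeasurableSpace α] {a b c d : α → ℝ}
    (ha : Measurable a) (hb : Measurable b) (hc : Measurable c) (hd : Measurable d) :
    Measurable fun x => interactionWeight (a x) (b x) (c x) (d x) := by
  unfold interactionWeight; fun_prop

theorem measurableSet_outputRegion {α : Type*} [MeasurableSpace α] {a b c d : α → ℝ}
    (ha : Measurable a) (hb : Measurable b) (hc : Measurable c) (hd : Measurable d) :
    MeasurableSet {x | OutputRegion (a x) (b x) (c x) (d x)} := by
  have le : ∀ {f g : α → ℝ}, Measurable f → Measurable g → Measurable fun x => f x ≤ g x :=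
    fun hf hg => measurableSet_setOfPred.1 (measurableSet_le hf hg)
  have lt : ∀ {f g : α → ℝ}, Measurable f → Measurable g → Measurable fun x => f x < g x :=
    fun hf hg => measurableSet_setOfPred.1 (measurableSet_lt hf hg)
  refine measurableSet_setOfPred.2 ?_
  unfold OutputRegion Nondegenerate
  refine .or ?_ (.or ?_ (.and ?_ (.and ?_ (.and ?_ ?_))))
  · exact le (by fun_prop) (by fun_prop)
  · exact le (by fun_prop) (by fun_prop)
  · exact lt (by fun_prop) (by fun_prop)
  · exact le (by fun_prop) (by fun_prop)
  · exact le (by fun_prop) (by fun_prop)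
  · exact le (by fun_prop) (by fun_prop)

theorem tsum_lintegral_le_add {α : Type*} [MeasurableSpace α] {μ : Measure α} {c a A B : ℝ≥0∞}
    {f g h : ℤ → α → ℝ≥0∞} (hg : ∀ k, Measurable (g k)) (ha : a ≠ ⊤)
    (hf : ∀ k x, f k x ≤ g k x + a * h k x) (hA : c * ∑' k, ∫⁻ x, g k x ∂μ ≤ A)
    (hB : c * ∑' k, ∫⁻ x, h k x ∂μ ≤ B) : c * ∑' k, ∫⁻ x, f k x ∂μ ≤ A + a * B :=
  calc c * ∑' k, ∫⁻ x, f k x ∂μ ≤ c * ∑' k, ∫⁻ x, (g k x + a * h k x) ∂μ :=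
        mul_le_mul_right (ENNReal.tsum_le_tsum fun k => lintegral_mono (hf k)) _
    _ = c * ∑' k, ∫⁻ x, g k x ∂μ + a * (c * ∑' k, ∫⁻ x, h k x ∂μ) := by
        have e : ∀ k, ∫⁻ x, (g k x + a * h k x) ∂μ = ∫⁻ x, g k x ∂μ + a * ∫⁻ x, h k x ∂μ :=
          fun k => by rw [lintegral_add_left (hg k), lintegral_const_mul' _ _ ha]
        simp_rw [e]
        rw [ENNReal.tsum_add, ENNReal.tsum_mul_left, mul_add, mul_left_comm]
    _ ≤ _ := by gcongr

theorem tsum_lintegral_const_mul_le {α : Type*} [MeasurableSpace α] {μ : Measure α}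
    {c a A : ℝ≥0∞} {g : ℤ → α → ℝ≥0∞} (ha : a ≠ ⊤) (hA : c * ∑' k, ∫⁻ x, g k x ∂μ ≤ A) :
    c * ∑' k, ∫⁻ x, a * g k x ∂μ ≤ a * A := by
  simp_rw [lintegral_const_mul' a _ ha]
  rw [ENNReal.tsum_mul_left, mul_left_comm]
  gcongr

open Classical in
theorem tsum_lintegral_outputRegion_le {p : ℝ} (hp : 1 < p) :
    ∃ C : ℝ≥0∞, C ≠ ⊤ ∧ ∀ lam : ℝ, 1 < lam → ∀ ξ q c : ℝ,
      ENNReal.ofReal (1 / lam) * ∑' k : ℤ, ∫⁻ ξ₁ : ℝ, ENNReal.ofReal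
        ((if OutputRegion ξ q ξ₁ (k / lam) then interactionWeight ξ q ξ₁ (k / lam) else 0) *
          bracket (c - pairPhase ξ q ξ₁ (k / lam)) ^ (-p)) ≤ C := by
  obtain ⟨CE, hCE, hE⟩ := tsum_lintegral_elliptic_le (η := 1 / 600) hp (by norm_num) (by norm_num)
  have f1 := bracketIntegral_ne_top hp
  have f2 := bracketIntegral_ne_top (p := 2) (by norm_num)
  have f3 := bracketIntegral_ne_top (p := 9 / 5) (by norm_num)
  set CL := bracketIntegral 2 * (ENNReal.ofReal (2 ^ (2 : ℝ)) * bracketIntegral 2)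
  set CT := 2 * bracketIntegral p *
    (ENNReal.ofReal (2 ^ (9 / 5 : ℝ)) * bracketIntegral (9 / 5))
  refine ⟨64 * CL + 1600 * CT + 1600 * CT + 256 * CE, by finiteness, ?_⟩
  intro lam hlam ξ q c
  have hn : ∀ (x r : ℝ), 0 ≤ bracket x ^ r := fun x r => Real.rpow_nonneg (bracket_pos x).le _
  have hL := tsum_lintegral_low_le hlam
  have hT0 := tsum_lintegral_transversal_le hlam (p := p) (θ := 9 / 5) (by norm_num) ξ q c 0
  have hT1 := tsum_lintegral_transversal_le hlam (p := p) (θ := 9 / 5) (by norm_num) ξ q c q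
  have hE' : ENNReal.ofReal (1 / lam) * ∑' k : ℤ, ∫⁻ ξ₁ : ℝ, ENNReal.ofReal
        (if Nondegenerate ξ q then √|ξ| * bracket (k / lam - q / 2) ^ (-(1 / 10) : ℝ) *
          bracket (c - pairPhase ξ q ξ₁ (k / lam)) ^ (-p) else 0) ≤ CE := by
    by_cases hnd : Nondegenerate ξ q
    · simp only [if_pos hnd]
      exact hE lam hlam ξ q c hnd.ne_zero hnd.le_abs_div
    · simp [if_neg hnd]
  have key : ∀ (k : ℤ) (ξ₁ : ℝ), ENNReal.ofReal
        ((if OutputRegion ξ q ξ₁ (k / lam) then interactionWeight ξ q ξ₁ (k / lam) else 0) *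
          bracket (c - pairPhase ξ q ξ₁ (k / lam)) ^ (-p)) ≤
      64 * ENNReal.ofReal (bracket ξ₁ ^ (-2 : ℝ) * bracket (k / lam) ^ (-2 : ℝ)) +
      1600 * ENNReal.ofReal (|sqZeta ξ₁ (k / lam) - sqZeta (ξ - ξ₁) (q - k / lam)| *
        bracket (k / lam - 0) ^ (-(9 / 5) : ℝ) *
        bracket (c - pairPhase ξ q ξ₁ (k / lam)) ^ (-p)) +
      1600 * ENNReal.ofReal (|sqZeta ξ₁ (k / lam) - sqZeta (ξ - ξ₁) (q - k / lam)| *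
        bracket (k / lam - q) ^ (-(9 / 5) : ℝ) *
        bracket (c - pairPhase ξ q ξ₁ (k / lam)) ^ (-p)) +
      256 * ENNReal.ofReal (if Nondegenerate ξ q then
        √|ξ| * bracket (k / lam - q / 2) ^ (-(1 / 10) : ℝ) *
          bracket (c - pairPhase ξ q ξ₁ (k / lam)) ^ (-p) else 0) := by
    intro k ξ₁
    have q1 : 0 ≤ bracket ξ₁ ^ (-2 : ℝ) * bracket (k / lam) ^ (-2 : ℝ) :=
      mul_nonneg (hn _ _) (hn _ _)
    have q2 : ∀ r, 0 ≤ |sqZeta ξ₁ (k / lam) - sqZeta (ξ - ξ₁) (q - k / lam)| *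
        bracket (k / lam - r) ^ (-(9 / 5) : ℝ) *
        bracket (c - pairPhase ξ q ξ₁ (k / lam)) ^ (-p) := fun r =>
      mul_nonneg (mul_nonneg (abs_nonneg _) (hn _ _)) (hn _ _)
    have q3 : 0 ≤ if Nondegenerate ξ q then
        √|ξ| * bracket (k / lam - q / 2) ^ (-(1 / 10) : ℝ) *
          bracket (c - pairPhase ξ q ξ₁ (k / lam)) ^ (-p) else 0 := by
      split_ifs
      · exact mul_nonneg (mul_nonneg (Real.sqrt_nonneg _) (hn _ _)) (hn _ _)
      · exact le_rfl
    rw [show (64 : ℝ≥0∞) = ENNReal.ofReal 64 by simp,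
      show (1600 : ℝ≥0∞) = ENNReal.ofReal 1600 by simp,
      show (256 : ℝ≥0∞) = ENNReal.ofReal 256 by simp,
      ← ENNReal.ofReal_mul (by norm_num), ← ENNReal.ofReal_mul (by norm_num),
      ← ENNReal.ofReal_mul (by norm_num), ← ENNReal.ofReal_mul (by norm_num),
      ← ENNReal.ofReal_add (mul_nonneg (by norm_num) q1) (mul_nonneg (by norm_num) (q2 _)),
      ← ENNReal.ofReal_add (add_nonneg (mul_nonneg (by norm_num) q1)
        (mul_nonneg (by norm_num) (q2 _))) (mul_nonneg (by norm_num) (q2 _)),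
      ← ENNReal.ofReal_add (add_nonneg (add_nonneg (mul_nonneg (by norm_num) q1)
        (mul_nonneg (by norm_num) (q2 _))) (mul_nonneg (by norm_num) (q2 _)))
        (mul_nonneg (by norm_num) q3)]
    refine ENNReal.ofReal_le_ofReal ?_
    have q20 := q2 0
    have q2q := q2 q
    by_cases hO : OutputRegion ξ q ξ₁ (k / lam)
    · rw [if_pos hO]
      have h := interactionWeight_le_of_mem hO
      have hP0 := hn (c - pairPhase ξ q ξ₁ (k / lam)) (-p)
      have hP1 : bracket (c - pairPhase ξ q ξ₁ (k / lam)) ^ (-p) ≤ 1 :=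
        Real.rpow_le_one_of_one_le_of_nonpos (one_le_bracket _) (by linarith)
      have h' := mul_le_mul_of_nonneg_right h hP0
      rw [sub_zero]
      refine h'.trans ?_
      rw [add_mul, add_mul]
      refine add_le_add ?_ (le_of_eq ?_)
      · have := mul_le_mul_of_nonneg_left hP1 q1
        linarith
      · split_ifs <;> ring
    · rw [if_neg hO, zero_mul]
      linarith
  refine tsum_lintegral_le_add (fun k => by fun_prop) (by simp) key ?_ hE'
  refine tsum_lintegral_le_add (fun k => by fun_prop) (by simp) (fun k ξ₁ => le_rfl) ?_ hT1
  refine tsum_lintegral_le_add (fun k => by fun_prop) (by simp) (fun k ξ₁ => le_rfl) ?_ hT0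
  exact tsum_lintegral_const_mul_le (by simp) hL

open Classical in
theorem tsum_lintegral_notMem_outputRegion_le {p : ℝ} (hp : 1 < p) :
    ∃ C : ℝ≥0∞, C ≠ ⊤ ∧ ∀ lam : ℝ, 1 < lam → ∀ ξ₁ q₁ c : ℝ,
      ENNReal.ofReal (1 / lam) * ∑' k : ℤ, ∫⁻ ξ : ℝ, ENNReal.ofReal
        ((if OutputRegion ξ (k / lam) ξ₁ q₁ then 0 else interactionWeight ξ (k / lam) ξ₁ q₁ *
          (zetaBracket ξ₁ q₁ * zetaBracket (ξ - ξ₁) (k / lam - q₁)) ^ (1 / 10 : ℝ)) *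
          bracket (c - pairPhase ξ₁ q₁ ξ (k / lam)) ^ (-p)) ≤ C := by
  obtain ⟨CE, hCE, hE⟩ := tsum_lintegral_elliptic_le (η := 1 / 600) hp (by norm_num) (by norm_num)
  have f1 := bracketIntegral_ne_top hp
  have f3 := bracketIntegral_ne_top (p := 6 / 5) (by norm_num)
  set CT := 2 * bracketIntegral p *
    (ENNReal.ofReal (2 ^ (6 / 5 : ℝ)) * bracketIntegral (6 / 5))
  refine ⟨3499200 * CT + 1024 * CE, by finiteness, ?_⟩
  intro lam hlam ξ₁ q₁ c
  have hn : ∀ (x r : ℝ), 0 ≤ bracket x ^ r := fun x r => Real.rpow_nonneg (bracket_pos x).le _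
  have hT := tsum_lintegral_transversal_le hlam (p := p) (θ := 6 / 5) (by norm_num) ξ₁ q₁ c 0
  have hE' : ENNReal.ofReal (1 / lam) * ∑' k : ℤ, ∫⁻ ξ : ℝ, ENNReal.ofReal
        (if Nondegenerate ξ₁ q₁ then √|ξ₁| * bracket (k / lam - q₁ / 2) ^ (-(1 / 10) : ℝ) *
          bracket (c - pairPhase ξ₁ q₁ ξ (k / lam)) ^ (-p) else 0) ≤ CE := by
    by_cases hnd : Nondegenerate ξ₁ q₁
    · simp only [if_pos hnd]
      exact hE lam hlam ξ₁ q₁ c hnd.ne_zero hnd.le_abs_div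
    · simp [if_neg hnd]
  have key : ∀ (k : ℤ) (ξ : ℝ), ENNReal.ofReal
        ((if OutputRegion ξ (k / lam) ξ₁ q₁ then 0 else interactionWeight ξ (k / lam) ξ₁ q₁ *
          (zetaBracket ξ₁ q₁ * zetaBracket (ξ - ξ₁) (k / lam - q₁)) ^ (1 / 10 : ℝ)) *
          bracket (c - pairPhase ξ₁ q₁ ξ (k / lam)) ^ (-p)) ≤
      3499200 * ENNReal.ofReal (|sqZeta ξ (k / lam) - sqZeta (ξ₁ - ξ) (q₁ - k / lam)| *
        bracket (k / lam - 0) ^ (-(6 / 5) : ℝ) *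
        bracket (c - pairPhase ξ₁ q₁ ξ (k / lam)) ^ (-p)) +
      1024 * ENNReal.ofReal (if Nondegenerate ξ₁ q₁ then
        √|ξ₁| * bracket (k / lam - q₁ / 2) ^ (-(1 / 10) : ℝ) *
          bracket (c - pairPhase ξ₁ q₁ ξ (k / lam)) ^ (-p) else 0) := by
    intro k ξ
    have q2 : 0 ≤ |sqZeta ξ (k / lam) - sqZeta (ξ₁ - ξ) (q₁ - k / lam)| *
        bracket (k / lam - 0) ^ (-(6 / 5) : ℝ) *
        bracket (c - pairPhase ξ₁ q₁ ξ (k / lam)) ^ (-p) :=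
      mul_nonneg (mul_nonneg (abs_nonneg _) (hn _ _)) (hn _ _)
    have q3 : 0 ≤ if Nondegenerate ξ₁ q₁ then
        √|ξ₁| * bracket (k / lam - q₁ / 2) ^ (-(1 / 10) : ℝ) *
          bracket (c - pairPhase ξ₁ q₁ ξ (k / lam)) ^ (-p) else 0 := by
      split_ifs
      · exact mul_nonneg (mul_nonneg (Real.sqrt_nonneg _) (hn _ _)) (hn _ _)
      · exact le_rfl
    rw [show (3499200 : ℝ≥0∞) = ENNReal.ofReal 3499200 by simp,
      show (1024 : ℝ≥0∞) = ENNReal.ofReal 1024 by simp,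
      ← ENNReal.ofReal_mul (by norm_num), ← ENNReal.ofReal_mul (by norm_num),
      ← ENNReal.ofReal_add (mul_nonneg (by norm_num) q2) (mul_nonneg (by norm_num) q3)]
    refine ENNReal.ofReal_le_ofReal ?_
    by_cases hO : OutputRegion ξ (k / lam) ξ₁ q₁
    · rw [if_pos hO, zero_mul]
      linarith
    · rw [if_neg hO]
      have h := interactionWeight_mul_le_of_notMem hO
      have h' := mul_le_mul_of_nonneg_right h (hn (c - pairPhase ξ₁ q₁ ξ (k / lam)) (-p))
      rw [sub_zero]
      refine h'.trans (le_of_eq ?_)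
      split_ifs <;> ring
  refine tsum_lintegral_le_add (fun k => by fun_prop) (by simp) key ?_ hE'
  exact tsum_lintegral_const_mul_le (by simp) hT


/-! ### The bilinear kernels -/

/-- The square of the kernel with frequency weight `w` at the output `(k, ξ, τ)` and the input
`(k₁, ξ₁, τ₁)`. -/
noncomputable def kernelSq (lam a p : ℝ) (w : ℝ → ℝ → ℝ → ℝ → ℝ)
    (z x : ℤ × (ℝ × ℝ)) : ℝ :=
  w z.2.1 (z.1 / lam) x.2.1 (x.1 / lam) *
    bracket (z.2.2 - sigma z.2.1 (z.1 / lam)) ^ (-a) *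
    (bracket (x.2.2 - sigma x.2.1 (x.1 / lam)) ^ (-p) *
      bracket (z.2.2 - x.2.2 - sigma (z.2.1 - x.2.1) (z.1 / lam - x.1 / lam)) ^ (-p))

theorem kernelSq_nonneg {lam a p : ℝ} {w : ℝ → ℝ → ℝ → ℝ → ℝ} (hw : ∀ a b c d, 0 ≤ w a b c d)
    (z x : ℤ × (ℝ × ℝ)) : 0 ≤ kernelSq lam a p w z x := by
  have hn : ∀ (x r : ℝ), 0 ≤ bracket x ^ r := fun x r => Real.rpow_nonneg (bracket_pos x).le _
  exact mul_nonneg (mul_nonneg (hw _ _ _ _) (hn _ _)) (mul_nonneg (hn _ _) (hn _ _))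

theorem measurable_kernelSq (lam a p : ℝ) {w : ℝ → ℝ → ℝ → ℝ → ℝ}
    (hw : Measurable fun y : ℝ × ℝ × ℝ × ℝ => w y.1 y.2.1 y.2.2.1 y.2.2.2) :
    Measurable fun y : (ℤ × (ℝ × ℝ)) × (ℤ × (ℝ × ℝ)) => kernelSq lam a p w y.1 y.2 := by
  have h1 : Measurable fun y : (ℤ × (ℝ × ℝ)) × (ℤ × (ℝ × ℝ)) => (y.1.1 : ℝ) / lam :=
    ((measurable_of_countable fun k : ℤ => (k : ℝ)).comp (by fun_prop)).div_const _
  have h2 : Measurable fun y : (ℤ × (ℝ × ℝ)) × (ℤ × (ℝ × ℝ)) => (y.2.1 : ℝ) / lam :=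
    ((measurable_of_countable fun k : ℤ => (k : ℝ)).comp (by fun_prop)).div_const _
  have h3 : Measurable fun y : (ℤ × (ℝ × ℝ)) × (ℤ × (ℝ × ℝ)) =>
      w y.1.2.1 (y.1.1 / lam) y.2.2.1 (y.2.1 / lam) :=
    hw.comp (f := fun y : (ℤ × (ℝ × ℝ)) × (ℤ × (ℝ × ℝ)) =>
      (y.1.2.1, (y.1.1 : ℝ) / lam, y.2.2.1, (y.2.1 : ℝ) / lam)) (by fun_prop)
  unfold kernelSq
  fun_prop

theorem lintegral_freqMeasure_iterated {F : ℤ × (ℝ × ℝ) → ℝ≥0∞} (hF : Measurable F) :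
    ∫⁻ z, F z ∂freqMeasure = ∑' k : ℤ, ∫⁻ ξ : ℝ, ∫⁻ τ : ℝ, F (k, (ξ, τ)) := by
  rw [lintegral_freqMeasure hF]
  refine tsum_congr fun k => ?_
  rw [Measure.volume_eq_prod, lintegral_prod _ (by fun_prop)]

theorem lintegral_kernelSq_input_le {lam a p : ℝ} (ha : 0 ≤ a) (hp : 1 < p)
    {w : ℝ → ℝ → ℝ → ℝ → ℝ} (hw0 : ∀ a b c d, 0 ≤ w a b c d)
    (hw : Measurable fun y : ℝ × ℝ × ℝ × ℝ => w y.1 y.2.1 y.2.2.1 y.2.2.2) {C : ℝ≥0∞}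
    (hC : ∀ ξ q c : ℝ, ENNReal.ofReal (1 / lam) * ∑' k : ℤ, ∫⁻ ξ₁ : ℝ, ENNReal.ofReal
      (w ξ q ξ₁ (k / lam) * bracket (c - pairPhase ξ q ξ₁ (k / lam)) ^ (-p)) ≤ C)
    (z : ℤ × (ℝ × ℝ)) :
    ENNReal.ofReal (1 / lam) * ∫⁻ x, ENNReal.ofReal (kernelSq lam a p w z x) ∂freqMeasure ≤
      ENNReal.ofReal (2 ^ (p + 1)) * bracketIntegral p * C := by
  have hn : ∀ (x r : ℝ), 0 ≤ bracket x ^ r := fun x r => Real.rpow_nonneg (bracket_pos x).le _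
  have hm : Measurable fun x => ENNReal.ofReal (kernelSq lam a p w z x) :=
    ((measurable_kernelSq lam a p hw).comp measurable_prodMk_left).ennreal_ofReal
  rw [lintegral_freqMeasure_iterated hm]
  obtain ⟨k, ξ, τ⟩ := z
  refine le_trans ?_ (mul_le_mul_right (hC ξ (k / lam) τ)
    (ENNReal.ofReal (2 ^ (p + 1)) * bracketIntegral p))
  rw [mul_left_comm (ENNReal.ofReal (2 ^ (p + 1)) * bracketIntegral p)]
  refine mul_le_mul_right ?_ _
  rw [← ENNReal.tsum_mul_left]
  refine ENNReal.tsum_le_tsum fun k₁ => ?_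
  rw [← lintegral_const_mul' _ _
    (ENNReal.mul_ne_top ENNReal.ofReal_ne_top (bracketIntegral_ne_top hp))]
  refine lintegral_mono fun ξ₁ => ?_
  have h := lintegral_bracket_mul_le (a := p) (p := p) (by linarith) le_rfl (sigma ξ₁ (k₁ / lam))
    (τ - pairPhase ξ (k / lam) ξ₁ (k₁ / lam))
  have hw' := hw0 ξ (k / lam) ξ₁ (k₁ / lam)
  rw [ENNReal.ofReal_mul hw', mul_left_comm]
  refine le_trans ?_ (mul_le_mul_right h _)
  rw [← lintegral_const_mul' _ _ ENNReal.ofReal_ne_top]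
  refine lintegral_mono fun τ₁ => ?_
  rw [← ENNReal.ofReal_mul hw']
  refine ENNReal.ofReal_le_ofReal ?_
  have e : τ - pairPhase ξ (k / lam) ξ₁ (k₁ / lam) - (τ₁ - sigma ξ₁ (k₁ / lam)) =
      τ - τ₁ - sigma (ξ - ξ₁) (k / lam - k₁ / lam) := by unfold pairPhase; ring
  rw [e]
  refine mul_le_mul_of_nonneg_right ?_ (mul_nonneg (hn _ _) (hn _ _))
  exact mul_le_of_le_one_right hw'
    (Real.rpow_le_one_of_one_le_of_nonpos (one_le_bracket _) (by linarith))

theorem abs_sigma_le (ξ q : ℝ) : |sigma ξ q| ≤ absZeta ξ q ^ 3 := by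
  have e : sigma ξ q = ξ * (ξ ^ 2 + q ^ 2) := by unfold sigma; ring
  rw [e, abs_mul, abs_of_nonneg (by positivity : 0 ≤ ξ ^ 2 + q ^ 2),
    show absZeta ξ q ^ 3 = absZeta ξ q * absZeta ξ q ^ 2 by ring, absZeta_sq]
  refine mul_le_mul (abs_left_le_absZeta ξ q) ?_ (by positivity) (absZeta_nonneg _ _)
  unfold sqZeta; nlinarith [sq_nonneg ξ]

theorem bracket_resonance_le (ξ q ξ₁ q₁ : ℝ) :
    bracket (sigma ξ₁ q₁ + sigma (ξ - ξ₁) (q - q₁) - sigma ξ q) ≤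
      4 * (zetaBracket ξ₁ q₁ * zetaBracket (ξ - ξ₁) (q - q₁)) ^ 3 := by
  have r := absZeta_nonneg ξ q
  have r1 := absZeta_nonneg ξ₁ q₁
  have r2 := absZeta_nonneg (ξ - ξ₁) (q - q₁)
  have h := absZeta_le_add_sub ξ q ξ₁ q₁
  have s := abs_sigma_le ξ q
  have s1 := abs_sigma_le ξ₁ q₁
  have s2 := abs_sigma_le (ξ - ξ₁) (q - q₁)
  rw [zetaBracket_eq, zetaBracket_eq, bracket]
  set R := absZeta ξ₁ q₁ + absZeta (ξ - ξ₁) (q - q₁)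
  have hR : 0 ≤ R := add_nonneg r1 r2
  have t := pow_le_pow_left₀ r h 3
  have t1 := pow_le_pow_left₀ r1 (show absZeta ξ₁ q₁ ≤ R by simp only [R]; linarith) 3
  have t2 := pow_le_pow_left₀ r2 (show absZeta (ξ - ξ₁) (q - q₁) ≤ R by simp only [R]; linarith) 3
  have hab : |sigma ξ₁ q₁ + sigma (ξ - ξ₁) (q - q₁) - sigma ξ q| ≤ 3 * R ^ 3 := by
    refine (abs_sub _ _).trans ?_
    linarith [abs_add_le (sigma ξ₁ q₁) (sigma (ξ - ξ₁) (q - q₁))]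
  have hp : 1 + R ≤ (1 + absZeta ξ₁ q₁) * (1 + absZeta (ξ - ξ₁) (q - q₁)) := by
    simp only [R]; nlinarith
  have hp3 := pow_le_pow_left₀ (by linarith) hp 3
  nlinarith [pow_nonneg hR 3, pow_nonneg hR 2]

theorem bracket_rpow_mul_le {ε p : ℝ} (hε : 0 ≤ ε) (hε' : ε ≤ 1 / 120) (hp : 1 ≤ p)
    (ξ q ξ₁ q₁ τ₁ : ℝ) :
    bracket (τ₁ - pairPhase ξ₁ q₁ ξ q) ^ (-(1 - 2 * ε)) * bracket (τ₁ - sigma ξ₁ q₁) ^ (-p) ≤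
      4 * (zetaBracket ξ₁ q₁ * zetaBracket (ξ - ξ₁) (q - q₁)) ^ (1 / 10 : ℝ) *
        bracket (τ₁ - pairPhase ξ₁ q₁ ξ q) ^ (-(1 + 2 * ε)) := by
  set A := bracket (τ₁ - pairPhase ξ₁ q₁ ξ q) with hA
  set D := bracket (τ₁ - sigma ξ₁ q₁)
  set P := zetaBracket ξ₁ q₁ * zetaBracket (ξ - ξ₁) (q - q₁)
  have hA0 : 0 < A := bracket_pos _
  have hD : 1 ≤ D := one_le_bracket _
  have hP : 1 ≤ P := one_le_mul_of_one_le_of_one_le (one_le_zetaBracket _ _) (one_le_zetaBracket _ _)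
  have hAD : A ≤ D * (4 * P ^ 3) := by
    refine le_trans ?_ (mul_le_mul_of_nonneg_left (bracket_resonance_le ξ q ξ₁ q₁) (by linarith))
    refine le_trans (le_of_eq ?_) (bracket_add_le _ _)
    rw [hA]; congr 1
    unfold pairPhase sigma; ring
  have h4 : A ^ (4 * ε) ≤ D ^ p * (4 * P ^ (1 / 10 : ℝ)) := by
    refine (Real.rpow_le_rpow hA0.le hAD (by linarith)).trans ?_
    rw [Real.mul_rpow (by linarith) (by positivity), Real.mul_rpow (by norm_num) (by positivity)]
    refine mul_le_mul (Real.rpow_le_rpow_of_exponent_le hD (by linarith)) ?_ (by positivity)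
      (by positivity)
    refine mul_le_mul ?_ ?_ (by positivity) (by norm_num)
    · have := Real.rpow_le_rpow_of_exponent_le (by norm_num : (1 : ℝ) ≤ 4)
        (by linarith : 4 * ε ≤ 1)
      rwa [Real.rpow_one] at this
    · rw [← Real.rpow_natCast, ← Real.rpow_mul (by linarith)]
      exact Real.rpow_le_rpow_of_exponent_le hP (by push_cast; linarith)
  have e : A ^ (-(1 - 2 * ε)) = A ^ (-(1 + 2 * ε)) * A ^ (4 * ε) := by
    rw [← Real.rpow_add hA0]; ring_nf
  have e2 : D ^ p * D ^ (-p) = 1 := by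
    rw [← Real.rpow_add (by linarith), add_neg_cancel, Real.rpow_zero]
  calc A ^ (-(1 - 2 * ε)) * D ^ (-p) = A ^ (4 * ε) * (A ^ (-(1 + 2 * ε)) * D ^ (-p)) := by
        rw [e]; ring
    _ ≤ D ^ p * (4 * P ^ (1 / 10 : ℝ)) * (A ^ (-(1 + 2 * ε)) * D ^ (-p)) :=
        mul_le_mul_of_nonneg_right h4 (by positivity)
    _ = 4 * P ^ (1 / 10 : ℝ) * A ^ (-(1 + 2 * ε)) * (D ^ p * D ^ (-p)) := by ring
    _ = _ := by rw [e2, mul_one]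

theorem lintegral_kernelSq_output_le {lam ε p : ℝ} (hε : 0 ≤ ε) (hε' : ε ≤ 1 / 120) (hp : 1 < p)
    {w : ℝ → ℝ → ℝ → ℝ → ℝ} (hw0 : ∀ a b c d, 0 ≤ w a b c d)
    (hw : Measurable fun y : ℝ × ℝ × ℝ × ℝ => w y.1 y.2.1 y.2.2.1 y.2.2.2) {C : ℝ≥0∞}
    (hC : ∀ ξ₁ q₁ c : ℝ, ENNReal.ofReal (1 / lam) * ∑' k : ℤ, ∫⁻ ξ : ℝ, ENNReal.ofReal
      (w ξ (k / lam) ξ₁ q₁ *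
        (zetaBracket ξ₁ q₁ * zetaBracket (ξ - ξ₁) (k / lam - q₁)) ^ (1 / 10 : ℝ) *
        bracket (c - pairPhase ξ₁ q₁ ξ (k / lam)) ^ (-(1 + 2 * ε))) ≤ C)
    (x : ℤ × (ℝ × ℝ)) :
    ENNReal.ofReal (1 / lam) *
        ∫⁻ z, ENNReal.ofReal (kernelSq lam (1 - 2 * ε) p w z x) ∂freqMeasure ≤
      4 * (ENNReal.ofReal (2 ^ (2 - 2 * ε)) * bracketIntegral p) * C := by
  have hn : ∀ (x r : ℝ), 0 ≤ bracket x ^ r := fun x r => Real.rpow_nonneg (bracket_pos x).le _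
  have hm : Measurable fun z => ENNReal.ofReal (kernelSq lam (1 - 2 * ε) p w z x) :=
    ((measurable_kernelSq lam (1 - 2 * ε) p hw).comp measurable_prodMk_right).ennreal_ofReal
  rw [lintegral_freqMeasure_iterated hm]
  obtain ⟨k₁, ξ₁, τ₁⟩ := x
  set L := ENNReal.ofReal (2 ^ (2 - 2 * ε)) * bracketIntegral p with hL
  refine le_trans ?_ (mul_le_mul_right (hC ξ₁ (k₁ / lam) τ₁) (4 * L))
  rw [mul_left_comm (4 * L)]
  refine mul_le_mul_right ?_ _
  rw [← ENNReal.tsum_mul_left]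
  refine ENNReal.tsum_le_tsum fun k => ?_
  rw [← lintegral_const_mul' _ _ (ENNReal.mul_ne_top (by simp)
    (ENNReal.mul_ne_top ENNReal.ofReal_ne_top (bracketIntegral_ne_top hp)))]
  refine lintegral_mono fun ξ => ?_
  have h := lintegral_bracket_mul_le (a := 1 - 2 * ε) (p := p) (by linarith) (by linarith)
    (sigma ξ (k / lam)) (τ₁ - pairPhase ξ₁ (k₁ / lam) ξ (k / lam))
  rw [show 1 - 2 * ε + 1 = 2 - 2 * ε by ring, ← hL] at h
  have hw' := hw0 ξ (k / lam) ξ₁ (k₁ / lam)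
  have hD := hn (τ₁ - sigma ξ₁ (k₁ / lam)) (-p)
  calc ∫⁻ τ, ENNReal.ofReal (kernelSq lam (1 - 2 * ε) p w (k, ξ, τ) (k₁, ξ₁, τ₁))
      ≤ ENNReal.ofReal (w ξ (k / lam) ξ₁ (k₁ / lam) *
          bracket (τ₁ - sigma ξ₁ (k₁ / lam)) ^ (-p)) *
          (L * ENNReal.ofReal (bracket (τ₁ - pairPhase ξ₁ (k₁ / lam) ξ (k / lam)) ^
            (-(1 - 2 * ε)))) := by
        refine le_trans ?_ (mul_le_mul_right h _)
        rw [← lintegral_const_mul' _ _ ENNReal.ofReal_ne_top]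
        refine le_of_eq (lintegral_congr fun τ => ?_)
        rw [← ENNReal.ofReal_mul (mul_nonneg hw' hD)]
        congr 1
        have e : τ₁ - pairPhase ξ₁ (k₁ / lam) ξ (k / lam) - (τ - sigma ξ (k / lam)) =
          -(τ - τ₁ - sigma (ξ - ξ₁) (k / lam - k₁ / lam)) := by
          unfold pairPhase sigma; ring
        rw [e, bracket_neg]
        unfold kernelSq
        ring
    _ = L * ENNReal.ofReal (w ξ (k / lam) ξ₁ (k₁ / lam) *
          (bracket (τ₁ - pairPhase ξ₁ (k₁ / lam) ξ (k / lam)) ^ (-(1 - 2 * ε)) *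
          bracket (τ₁ - sigma ξ₁ (k₁ / lam)) ^ (-p))) := by
        rw [mul_left_comm, ← ENNReal.ofReal_mul (mul_nonneg hw' hD)]
        congr 2; ring
    _ ≤ L * ENNReal.ofReal (4 * (w ξ (k / lam) ξ₁ (k₁ / lam) *
          (zetaBracket ξ₁ (k₁ / lam) *
            zetaBracket (ξ - ξ₁) (k / lam - k₁ / lam)) ^ (1 / 10 : ℝ) *
          bracket (τ₁ - pairPhase ξ₁ (k₁ / lam) ξ (k / lam)) ^ (-(1 + 2 * ε)))) := by
        refine mul_le_mul_right (ENNReal.ofReal_le_ofReal ?_) _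
        refine (mul_le_mul_of_nonneg_left
          (bracket_rpow_mul_le hε hε' hp.le ξ (k / lam) ξ₁ (k₁ / lam) τ₁) hw').trans (le_of_eq ?_)
        ring
    _ = _ := by
        rw [ENNReal.ofReal_mul (by norm_num), show ENNReal.ofReal 4 = 4 by simp]
        ring


theorem add_sq_le_four_mul_add (a b : ℝ≥0∞) : (a + b) ^ 2 ≤ 4 * (a ^ 2 + b ^ 2) := by
  rcases le_total a b with h | h
  · calc (a + b) ^ 2 ≤ (b + b) ^ 2 := by gcongr
      _ = 4 * b ^ 2 := by ring
      _ ≤ _ := by gcongr; exact le_add_self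
  · calc (a + b) ^ 2 ≤ (a + a) ^ 2 := by gcongr
      _ = 4 * a ^ 2 := by ring
      _ ≤ _ := by gcongr; exact le_self_add

open Classical in
/-- The part of the weight estimated for a fixed output frequency. -/
noncomputable def outputWeight (ξ q ξ₁ q₁ : ℝ) : ℝ :=
  if OutputRegion ξ q ξ₁ q₁ then interactionWeight ξ q ξ₁ q₁ else 0

open Classical in
/-- The part of the weight estimated for a fixed input frequency. -/
noncomputable def inputWeight (ξ q ξ₁ q₁ : ℝ) : ℝ :=
  if OutputRegion ξ q ξ₁ q₁ then 0 else interactionWeight ξ q ξ₁ q₁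

theorem outputWeight_nonneg (ξ q ξ₁ q₁ : ℝ) : 0 ≤ outputWeight ξ q ξ₁ q₁ := by
  unfold outputWeight; split_ifs
  exacts [interactionWeight_nonneg _ _ _ _, le_rfl]

theorem inputWeight_nonneg (ξ q ξ₁ q₁ : ℝ) : 0 ≤ inputWeight ξ q ξ₁ q₁ := by
  unfold inputWeight; split_ifs
  exacts [le_rfl, interactionWeight_nonneg _ _ _ _]

theorem measurable_outputWeight :
    Measurable fun y : ℝ × ℝ × ℝ × ℝ => outputWeight y.1 y.2.1 y.2.2.1 y.2.2.2 :=
  Measurable.ite (measurableSet_outputRegion (by fun_prop) (by fun_prop) (by fun_prop)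
    (by fun_prop)) (by fun_prop) (by fun_prop)

theorem measurable_inputWeight :
    Measurable fun y : ℝ × ℝ × ℝ × ℝ => inputWeight y.1 y.2.1 y.2.2.1 y.2.2.2 :=
  Measurable.ite (measurableSet_outputRegion (by fun_prop) (by fun_prop) (by fun_prop)
    (by fun_prop)) (by fun_prop) (by fun_prop)

theorem sqrt_kernelSq_split (lam a p : ℝ) (z x : ℤ × (ℝ × ℝ)) :
    ENNReal.ofReal √(kernelSq lam a p interactionWeight z x) =
      ENNReal.ofReal √(kernelSq lam a p outputWeight z x) +
        ENNReal.ofReal √(kernelSq lam a p inputWeight z x) := by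
  unfold kernelSq outputWeight inputWeight
  split_ifs <;> simp

/-- The bilinear estimate for the kernel `√(kernelSq lam (1 - 2 ε) p interactionWeight)`. -/
theorem exists_bilinear_bound {ε p : ℝ} (hε : 0 < ε) (hε' : ε ≤ 1 / 120) (hp : 1 < p) :
    ∃ C : ℝ≥0∞, C ≠ ⊤ ∧ ∀ lam : ℝ, 1 < lam → ∀ F G : ℤ × (ℝ × ℝ) → ℝ≥0∞,
      Measurable F → Measurable G →
      ENNReal.ofReal (1 / lam) * ∫⁻ z, (ENNReal.ofReal (1 / lam) * ∫⁻ x,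
        ENNReal.ofReal √(kernelSq lam (1 - 2 * ε) p interactionWeight z x) *
          (F x * G (z - x)) ∂freqMeasure) ^ 2 ∂freqMeasure ≤
      C * ((ENNReal.ofReal (1 / lam) * ∫⁻ x, F x ^ 2 ∂freqMeasure) *
        (ENNReal.ofReal (1 / lam) * ∫⁻ x, G x ^ 2 ∂freqMeasure)) := by
  obtain ⟨C₀, hC₀, h₀⟩ := tsum_lintegral_outputRegion_le hp
  obtain ⟨C₁, hC₁, h₁⟩ := tsum_lintegral_notMem_outputRegion_le (p := 1 + 2 * ε) (by linarith)
  have fp := bracketIntegral_ne_top hp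
  set A₀ := ENNReal.ofReal (2 ^ (p + 1)) * bracketIntegral p * C₀ with hA₀
  set A₁ := 4 * (ENNReal.ofReal (2 ^ (2 - 2 * ε)) * bracketIntegral p) * C₁
  refine ⟨4 * (A₀ + A₁), by finiteness, ?_⟩
  intro lam hlam F G hF hG
  set c := ENNReal.ofReal (1 / lam)
  set K₀ : (ℤ × (ℝ × ℝ)) × (ℤ × (ℝ × ℝ)) → ℝ≥0∞ := fun y =>
    ENNReal.ofReal √(kernelSq lam (1 - 2 * ε) p outputWeight y.1 y.2) with hK₀
  set K₁ : (ℤ × (ℝ × ℝ)) × (ℤ × (ℝ × ℝ)) → ℝ≥0∞ := fun y =>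
    ENNReal.ofReal √(kernelSq lam (1 - 2 * ε) p inputWeight y.1 y.2) with hK₁
  have m₀ : Measurable K₀ :=
    (measurable_kernelSq lam (1 - 2 * ε) p measurable_outputWeight).sqrt.ennreal_ofReal
  have m₁ : Measurable K₁ :=
    (measurable_kernelSq lam (1 - 2 * ε) p measurable_inputWeight).sqrt.ennreal_ofReal
  have s₀ : ∀ y, K₀ y ^ 2 = ENNReal.ofReal (kernelSq lam (1 - 2 * ε) p outputWeight y.1 y.2) :=
    fun y => by
      rw [hK₀, ← ENNReal.ofReal_pow (Real.sqrt_nonneg _),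
        Real.sq_sqrt (kernelSq_nonneg outputWeight_nonneg _ _)]
  have s₁ : ∀ y, K₁ y ^ 2 = ENNReal.ofReal (kernelSq lam (1 - 2 * ε) p inputWeight y.1 y.2) :=
    fun y => by
      rw [hK₁, ← ENNReal.ofReal_pow (Real.sqrt_nonneg _),
        Real.sq_sqrt (kernelSq_nonneg inputWeight_nonneg _ _)]
  have b₀ := lintegral_sq_bilinear_le_left m₀ hF hG c A₀ fun z => by
    simp only [s₀]
    exact lintegral_kernelSq_input_le (by linarith) hp outputWeight_nonneg measurable_outputWeight
      (h₀ lam hlam) z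
  have b₁ := lintegral_sq_bilinear_le_right m₁ hF hG c A₁ fun x => by
    simp only [s₁]
    refine lintegral_kernelSq_output_le hε.le hε' hp inputWeight_nonneg measurable_inputWeight
      (fun ξ₁ q₁ c' => le_trans (le_of_eq ?_) (h₁ lam hlam ξ₁ q₁ c')) x
    unfold inputWeight
    simp only [ite_mul, zero_mul]
  have mi : ∀ {K : (ℤ × (ℝ × ℝ)) × (ℤ × (ℝ × ℝ)) → ℝ≥0∞}, Measurable K →
      Measurable fun y : (ℤ × (ℝ × ℝ)) × (ℤ × (ℝ × ℝ)) => K y * (F y.2 * G (y.1 - y.2)) :=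
    fun hK => hK.mul ((hF.comp measurable_snd).mul (hG.comp (measurable_fst.sub measurable_snd)))
  have e : ∀ z, c * ∫⁻ x, ENNReal.ofReal √(kernelSq lam (1 - 2 * ε) p interactionWeight z x) *
      (F x * G (z - x)) ∂freqMeasure = c * ∫⁻ x, K₀ (z, x) * (F x * G (z - x)) ∂freqMeasure +
      c * ∫⁻ x, K₁ (z, x) * (F x * G (z - x)) ∂freqMeasure := by
    intro z
    have hz : Measurable fun x => K₀ (z, x) * (F x * G (z - x)) :=
      (mi m₀).comp measurable_prodMk_left
    rw [← mul_add, ← lintegral_add_left hz]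
    simp only [sqrt_kernelSq_split, add_mul, hK₀, hK₁]
  simp_rw [e]
  calc _ ≤ c * ∫⁻ z, 4 * ((c * ∫⁻ x, K₀ (z, x) * (F x * G (z - x)) ∂freqMeasure) ^ 2 +
        (c * ∫⁻ x, K₁ (z, x) * (F x * G (z - x)) ∂freqMeasure) ^ 2) ∂freqMeasure :=
        mul_le_mul_right (lintegral_mono fun z => add_sq_le_four_mul_add _ _) _
    _ = 4 * (c * ∫⁻ z, (c * ∫⁻ x, K₀ (z, x) * (F x * G (z - x)) ∂freqMeasure) ^ 2 ∂freqMeasure +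
        c * ∫⁻ z, (c * ∫⁻ x, K₁ (z, x) * (F x * G (z - x)) ∂freqMeasure) ^ 2 ∂freqMeasure) := by
        rw [lintegral_const_mul' _ _ (by simp), lintegral_add_left
          (((mi m₀).lintegral_prod_right'.const_mul c).pow_const 2), mul_left_comm, mul_add]
    _ ≤ 4 * (A₀ * ((c * ∫⁻ x, F x ^ 2 ∂freqMeasure) * (c * ∫⁻ x, G x ^ 2 ∂freqMeasure)) +
        A₁ * ((c * ∫⁻ x, F x ^ 2 ∂freqMeasure) * (c * ∫⁻ x, G x ^ 2 ∂freqMeasure))) := by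
        gcongr
    _ = _ := by ring

/-! ### The symbol of the operator `I` -/

theorem absZeta_zero_left (x : ℝ) : absZeta 0 x = |x| := by
  simp [absZeta, Real.sqrt_sq_eq_abs]

section symbol

variable {s N : ℝ} {m : ℝ × ℝ → ℝ}

theorem IsSymbolI.le_one_exponent (hm : IsSymbolI s N m) (hN : 1 ≤ N) : s ≤ 1 := by
  by_contra! hs
  have e : ∀ x, 2 ≤ x → m (0, x * N) = x ^ (s - 1) := fun x hx => by
    have h1 : absZeta 0 (x * N) = x * N := by
      rw [absZeta_zero_left, abs_of_nonneg (by nlinarith)]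
    have := hm.eq_high (0, x * N) (by dsimp only; rw [h1]; nlinarith)
    dsimp only at this
    rwa [h1, mul_div_assoc, div_self (by linarith), mul_one] at this
  have h := hm.nonincreasing (0, 2 * N) (0, 4 * N) (by
    dsimp only
    rw [absZeta_zero_left, absZeta_zero_left, abs_of_nonneg (by linarith),
      abs_of_nonneg (by linarith)]
    linarith)
  rw [e 2 le_rfl, e 4 (by norm_num)] at h
  exact absurd h (not_le.2 (Real.rpow_lt_rpow (by norm_num) (by norm_num) (by linarith)))

theorem IsSymbolI.comparable (hm : IsSymbolI s N m) (hN : 1 ≤ N) (hs : 0 ≤ s) (ξ q : ℝ) :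
    1 / 2 * max 1 (absZeta ξ q / N) ^ (s - 1) ≤ m (ξ, q) ∧
      m (ξ, q) ≤ 2 * max 1 (absZeta ξ q / N) ^ (s - 1) := by
  have hs1 := hm.le_one_exponent hN
  have hN0 : 0 < N := by linarith
  have h2 : (1 / 2 : ℝ) ≤ 2 ^ (s - 1) := by
    have := Real.rpow_le_rpow_of_exponent_le one_le_two (by linarith : -1 ≤ s - 1)
    rw [Real.rpow_neg_one] at this
    linarith
  rcases le_or_gt (absZeta ξ q) N with h | h
  · rw [max_eq_left ((div_le_one hN0).2 h), Real.one_rpow, hm.eq_low (ξ, q) h]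
    norm_num
  have hM : 1 ≤ absZeta ξ q / N := (one_le_div hN0).2 h.le
  rw [max_eq_right hM]
  rcases le_or_gt (2 * N) (absZeta ξ q) with h' | h'
  · rw [hm.eq_high (ξ, q) h']
    have : 0 < (absZeta ξ q / N) ^ (s - 1) := by positivity
    constructor <;> linarith
  have hM1 : (absZeta ξ q / N) ^ (s - 1) ≤ 1 := Real.rpow_le_one_of_one_le_of_nonpos hM (by linarith)
  have hM2 : 2 ^ (s - 1) ≤ (absZeta ξ q / N) ^ (s - 1) :=
    Real.rpow_le_rpow_of_nonpos (by linarith) ((div_le_iff₀ hN0).2 h'.le) (by linarith)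
  have e1 : absZeta 0 N = N := by rw [absZeta_zero_left, abs_of_pos hN0]
  have e2 : absZeta 0 (2 * N) = 2 * N := by rw [absZeta_zero_left, abs_of_nonneg (by linarith)]
  have up := hm.nonincreasing (0, N) (ξ, q) (by dsimp only; rw [e1]; exact h.le)
  have lo := hm.nonincreasing (ξ, q) (0, 2 * N) (by dsimp only; rw [e2]; exact h'.le)
  rw [hm.eq_low (0, N) e1.le] at up
  rw [hm.eq_high (0, 2 * N) e2.ge] at lo
  dsimp only at lo
  rw [e2, mul_div_assoc, div_self hN0.ne', mul_one] at lo
  constructor <;> linarith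

theorem IsSymbolI.nonneg (hm : IsSymbolI s N m) (hN : 1 ≤ N) (hs : 0 ≤ s) (ξ q : ℝ) :
    0 ≤ m (ξ, q) :=
  le_trans (mul_nonneg (by norm_num)
    (Real.rpow_nonneg (zero_le_one.trans (le_max_left _ _)) _)) (hm.comparable hN hs ξ q).1

/-- The quantity `⟨|(ξ, q)|⟩ / max (1, |(ξ, q)| / N)`, comparable to `min (⟨|(ξ, q)|⟩, N)`. -/
noncomputable def cutBracket (N ξ q : ℝ) : ℝ := zetaBracket ξ q / max 1 (absZeta ξ q / N)

theorem cutBracket_pos (N ξ q : ℝ) : 0 < cutBracket N ξ q :=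
  div_pos (zetaBracket_pos ξ q) (lt_of_lt_of_le one_pos (le_max_left _ _))

theorem min_le_cutBracket (hN : 1 ≤ N) (ξ q : ℝ) : min (zetaBracket ξ q) N ≤ cutBracket N ξ q := by
  have hN0 : 0 < N := by linarith
  unfold cutBracket
  rcases le_or_gt (absZeta ξ q) N with h | h
  · rw [max_eq_left ((div_le_one hN0).2 h), div_one]; exact min_le_left _ _
  · rw [max_eq_right ((one_le_div hN0).2 h.le)]
    refine (min_le_right _ _).trans ?_
    rw [zetaBracket_eq, le_div_iff₀ (div_pos (hN0.trans h) hN0), mul_div_cancel₀ _ hN0.ne']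
    linarith

theorem cutBracket_le_min (hN : 1 ≤ N) (ξ q : ℝ) :
    cutBracket N ξ q ≤ 2 * min (zetaBracket ξ q) N := by
  have hN0 : 0 < N := by linarith
  have hB := zetaBracket_pos ξ q
  rw [mul_min_of_nonneg _ _ zero_le_two]
  refine le_min ?_ ?_
  · refine (div_le_self hB.le (le_max_left _ _)).trans (by linarith)
  · unfold cutBracket
    rw [zetaBracket_eq]
    rcases le_or_gt (absZeta ξ q) N with h | h
    · rw [max_eq_left ((div_le_one hN0).2 h), div_one]; linarith
    · have hr : 0 < absZeta ξ q := by linarith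
      rw [max_eq_right ((one_le_div hN0).2 h.le), div_le_iff₀ (by positivity), mul_assoc,
        mul_div_cancel₀ _ hN0.ne']
      linarith

theorem cutBracket_le_mul (hN : 1 ≤ N) (ξ q ξ₁ q₁ : ℝ) :
    cutBracket N ξ q ≤ 2 * (cutBracket N ξ₁ q₁ * cutBracket N (ξ - ξ₁) (q - q₁)) := by
  refine (cutBracket_le_min hN ξ q).trans (mul_le_mul_of_nonneg_left ?_ zero_le_two)
  refine le_trans ?_ (mul_le_mul (min_le_cutBracket hN ξ₁ q₁)
    (min_le_cutBracket hN (ξ - ξ₁) (q - q₁))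
    (le_min (zetaBracket_pos _ _).le (by linarith)) (cutBracket_pos _ _ _).le)
  have h1 := one_le_zetaBracket ξ₁ q₁
  have h2 := one_le_zetaBracket (ξ - ξ₁) (q - q₁)
  have h := zetaBracket_le_mul ξ q ξ₁ q₁
  rcases min_choice (zetaBracket ξ₁ q₁) N with e1 | e1 <;>
  rcases min_choice (zetaBracket (ξ - ξ₁) (q - q₁)) N with e2 | e2 <;> rw [e1, e2]
  · exact (min_le_left _ _).trans h
  all_goals refine (min_le_right _ _).trans ?_; nlinarith

theorem max_rpow_mul_zetaBracket (s N ξ q : ℝ) :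
    max 1 (absZeta ξ q / N) ^ (s - 1) * zetaBracket ξ q =
      cutBracket N ξ q ^ (1 - s) * zetaBracket ξ q ^ s := by
  have hB := zetaBracket_pos ξ q
  have hM : 0 < max 1 (absZeta ξ q / N) := lt_of_lt_of_le one_pos (le_max_left _ _)
  rw [cutBracket, Real.div_rpow hB.le hM.le, div_mul_eq_mul_div, ← Real.rpow_add hB,
    sub_add_cancel, Real.rpow_one, ← neg_sub 1 s, Real.rpow_neg hM.le]
  exact (div_eq_inv_mul _ _).symm

theorem sqrt_interactionWeight (ξ q ξ₁ q₁ : ℝ) : √(interactionWeight ξ q ξ₁ q₁) =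
    |ξ| * (zetaBracket ξ q / (zetaBracket ξ₁ q₁ * zetaBracket (ξ - ξ₁) (q - q₁))) ^
      (9 / 10 : ℝ) := by
  have h : 0 ≤ zetaBracket ξ q / (zetaBracket ξ₁ q₁ * zetaBracket (ξ - ξ₁) (q - q₁)) :=
    (div_pos (zetaBracket_pos _ _) (mul_pos (zetaBracket_pos _ _) (zetaBracket_pos _ _))).le
  rw [interactionWeight, Real.sqrt_mul (sq_nonneg _), Real.sqrt_sq_eq_abs, Real.sqrt_eq_rpow,
    ← Real.rpow_mul h]
  norm_num

theorem IsSymbolI.abs_mul_le (hm : IsSymbolI s N m) (hN : 1 ≤ N) (hs : 9 / 10 ≤ s)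
    (ξ q ξ₁ q₁ : ℝ) :
    |ξ| * m (ξ, q) * zetaBracket ξ q ≤ 16 * √(interactionWeight ξ q ξ₁ q₁) *
      ((m (ξ₁, q₁) * zetaBracket ξ₁ q₁) *
        (m (ξ - ξ₁, q - q₁) * zetaBracket (ξ - ξ₁) (q - q₁))) := by
  have hs1 := hm.le_one_exponent hN
  have up := (hm.comparable hN (by linarith) ξ q).2
  have lo1 := (hm.comparable hN (by linarith) ξ₁ q₁).1
  have lo2 := (hm.comparable hN (by linarith) (ξ - ξ₁) (q - q₁)).1
  have hB := zetaBracket_pos ξ q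
  have hB1 := zetaBracket_pos ξ₁ q₁
  have hB2 := zetaBracket_pos (ξ - ξ₁) (q - q₁)
  have g0 := cutBracket_pos N ξ q
  have g1 := cutBracket_pos N ξ₁ q₁
  have g2 := cutBracket_pos N (ξ - ξ₁) (q - q₁)
  have hg := cutBracket_le_mul hN ξ q ξ₁ q₁
  have hq := zetaBracket_le_mul ξ q ξ₁ q₁
  replace up := mul_le_mul_of_nonneg_right up hB.le
  replace lo1 := mul_le_mul_of_nonneg_right lo1 hB1.le
  replace lo2 := mul_le_mul_of_nonneg_right lo2 hB2.le
  rw [mul_assoc, max_rpow_mul_zetaBracket] at up lo1 lo2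
  rw [sqrt_interactionWeight]
  set B := zetaBracket ξ q
  set B1 := zetaBracket ξ₁ q₁
  set B2 := zetaBracket (ξ - ξ₁) (q - q₁)
  set g := cutBracket N ξ q
  set γ1 := cutBracket N ξ₁ q₁
  set γ2 := cutBracket N (ξ - ξ₁) (q - q₁)
  have hgs : g ^ (1 - s) ≤ 2 * (γ1 ^ (1 - s) * γ2 ^ (1 - s)) := by
    refine (Real.rpow_le_rpow g0.le hg (by linarith)).trans ?_
    rw [Real.mul_rpow zero_le_two (by positivity), Real.mul_rpow g1.le g2.le]
    refine mul_le_mul_of_nonneg_right ?_ (by positivity)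
    have := Real.rpow_le_rpow_of_exponent_le one_le_two (by linarith : 1 - s ≤ 1)
    rwa [Real.rpow_one] at this
  have hBs : B ^ s ≤ (B / (B1 * B2)) ^ (9 / 10 : ℝ) * (B1 ^ s * B2 ^ s) := by
    have e : B ^ s = (B / (B1 * B2)) ^ s * (B1 ^ s * B2 ^ s) := by
      rw [← Real.mul_rpow hB1.le hB2.le, ← Real.mul_rpow (by positivity) (by positivity),
        div_mul_cancel₀ _ (by positivity)]
    rw [e]
    refine mul_le_mul_of_nonneg_right ?_ (by positivity)
    exact Real.rpow_le_rpow_of_exponent_ge (by positivity)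
      ((div_le_one (by positivity)).2 hq) hs
  set ρ := (B / (B1 * B2)) ^ (9 / 10 : ℝ)
  have hρ : 0 ≤ ρ := by positivity
  calc |ξ| * m (ξ, q) * B = |ξ| * (m (ξ, q) * B) := by ring
    _ ≤ |ξ| * (2 * (g ^ (1 - s) * B ^ s)) := mul_le_mul_of_nonneg_left up (abs_nonneg _)
    _ ≤ |ξ| * (2 * ((2 * (γ1 ^ (1 - s) * γ2 ^ (1 - s))) * (ρ * (B1 ^ s * B2 ^ s)))) := by
        gcongr
    _ = 16 * (|ξ| * ρ) * ((1 / 2 * (γ1 ^ (1 - s) * B1 ^ s)) *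
          (1 / 2 * (γ2 ^ (1 - s) * B2 ^ s))) := by ring
    _ ≤ _ := by
        refine mul_le_mul_of_nonneg_left ?_ (by positivity)
        exact mul_le_mul lo1 lo2 (by positivity) (le_trans (by positivity) lo1)

end symbol


/-! ### Conclusion -/

theorem IsFourierTransformL2.exists_measurable {lam : ℝ} [Fact (1 < lam)]
    {u : SpaceTime lam → ℂ} {U : ℝ → ℤ → ℝ → ℂ} (hU : IsFourierTransformL2 lam u U) :
    ∃ U' : ℝ → ℤ → ℝ → ℂ, IsFourierTransformL2 lam u U' ∧
      (∀ k : ℤ, Measurable fun z : ℝ × ℝ => U' z.1 k z.2) ∧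
      ∀ k : ℤ, (fun z : ℝ × ℝ => U z.1 k z.2) =ᵐ[volume] fun z => U' z.1 k z.2 := by
  have hm : ∀ k : ℤ, Measurable ((hU.aestronglyMeasurable k).mk _) := fun k =>
    (hU.aestronglyMeasurable k).stronglyMeasurable_mk.measurable
  have he := fun k : ℤ => (hU.aestronglyMeasurable k).ae_eq_mk
  refine ⟨fun ξ k τ => (hU.aestronglyMeasurable k).mk _ (ξ, τ), ⟨fun k => ?_, ?_⟩, hm, he⟩
  · exact (hm k).aestronglyMeasurable
  · refine hU.tendsto.congr fun n => tsum_congr fun k => lintegral_congr_ae ?_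
    filter_upwards [he k] with z hz
    rw [hz]

theorem bourgainNorm_opI_congr {lam s b : ℝ} {m : ℝ × ℝ → ℝ} {U U' : ℝ → ℤ → ℝ → ℂ}
    (h : ∀ k : ℤ, (fun z : ℝ × ℝ => U z.1 k z.2) =ᵐ[volume] fun z => U' z.1 k z.2) :
    bourgainNorm lam s b (opI lam m U) = bourgainNorm lam s b (opI lam m U') := by
  unfold bourgainNorm
  congr 2
  refine tsum_congr fun k => lintegral_congr_ae ?_
  filter_upwards [h k] with z hz
  simp only [opI, hz]

theorem IsSymbolI.measurable {s N : ℝ} {m : ℝ × ℝ → ℝ} (hm : IsSymbolI s N m) : Measurable m :=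
  hm.smooth.continuous.measurable

/-- The weighted size of `U` in the norm of `X^{1,b}_λ`. -/
noncomputable def weightedSize (lam b : ℝ) (m : ℝ × ℝ → ℝ) (U : ℝ → ℤ → ℝ → ℂ)
    (z : ℤ × (ℝ × ℝ)) : ℝ≥0∞ :=
  ENNReal.ofReal (bracket (z.2.2 - sigma z.2.1 (z.1 / lam)) ^ b *
    (m (z.2.1, z.1 / lam) * zetaBracket z.2.1 (z.1 / lam))) * ‖U z.2.1 z.1 z.2.2‖ₑ

theorem measurable_weightedSize {lam b : ℝ} {m : ℝ × ℝ → ℝ} (hm : Measurable m)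
    {U : ℝ → ℤ → ℝ → ℂ} (hU : ∀ k : ℤ, Measurable fun z : ℝ × ℝ => U z.1 k z.2) :
    Measurable (weightedSize lam b m U) := by
  have h1 : Measurable fun z : ℤ × (ℝ × ℝ) => (z.1 : ℝ) / lam :=
    ((measurable_of_countable fun k : ℤ => (k : ℝ)).comp (by fun_prop)).div_const _
  have h2 : Measurable fun z : ℤ × (ℝ × ℝ) => m (z.2.1, z.1 / lam) := hm.comp (by fun_prop)
  have h3 := (measurable_freq hU).enorm
  unfold weightedSize
  fun_prop

theorem sq_bourgain_integrand {b : ℝ} (ξ q τ : ℝ) {c : ℝ} (hc : 0 ≤ c) (w F : ℂ) (hw : ‖w‖ = c) :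
    ENNReal.ofReal (bracket (τ - sigma ξ q) ^ (2 * b) * bracket (absZeta ξ q) ^ (2 * (1 : ℝ))) *
      ‖w * F‖ₑ ^ 2 =
      (ENNReal.ofReal (bracket (τ - sigma ξ q) ^ b * (c * zetaBracket ξ q)) * ‖F‖ₑ) ^ 2 := by
  have hb := bracket_pos (τ - sigma ξ q)
  have hz := zetaBracket_pos ξ q
  rw [enorm_mul, mul_pow, ← mul_assoc, ← ofReal_norm w, hw, ← ENNReal.ofReal_pow hc,
    ← ENNReal.ofReal_mul (by rw [← zetaBracket]; positivity), mul_pow (ENNReal.ofReal _),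
    ← ENNReal.ofReal_pow (by positivity)]
  congr 2
  rw [mul_comm 2 b, Real.rpow_mul hb.le, ← zetaBracket, mul_one, Real.rpow_two, Real.rpow_two]
  ring

theorem bourgainNorm_opI_eq {lam b : ℝ} {m : ℝ × ℝ → ℝ} (hm : Measurable m)
    (hm0 : ∀ ξ q, 0 ≤ m (ξ, q)) {U : ℝ → ℤ → ℝ → ℂ}
    (hU : ∀ k : ℤ, Measurable fun z : ℝ × ℝ => U z.1 k z.2) :
    bourgainNorm lam 1 b (opI lam m U) =
      (ENNReal.ofReal (1 / lam) * ∫⁻ z, weightedSize lam b m U z ^ 2 ∂freqMeasure) ^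
        (1 / 2 : ℝ) := by
  rw [lintegral_freqMeasure ((measurable_weightedSize hm hU).pow_const 2), bourgainNorm]
  congr 2
  refine tsum_congr fun k => lintegral_congr fun z => ?_
  exact sq_bourgain_integrand z.1 (k / lam) z.2 (hm0 z.1 (k / lam)) _ _
    (by rw [Complex.norm_real, Real.norm_of_nonneg (hm0 z.1 (k / lam))])

theorem sqrt_kernelSq (lam ε δ : ℝ) (z x : ℤ × (ℝ × ℝ)) :
    √(kernelSq lam (1 - 2 * ε) (1 + 2 * δ) interactionWeight z x) =
      √(interactionWeight z.2.1 (z.1 / lam) x.2.1 (x.1 / lam)) *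
        bracket (z.2.2 - sigma z.2.1 (z.1 / lam)) ^ (-1 / 2 + ε) *
        ((bracket (x.2.2 - sigma x.2.1 (x.1 / lam)) ^ (1 / 2 + δ))⁻¹ *
          (bracket (z.2.2 - x.2.2 - sigma (z.2.1 - x.2.1) (z.1 / lam - x.1 / lam)) ^
            (1 / 2 + δ))⁻¹) := by
  have hn : ∀ (x r : ℝ), 0 ≤ bracket x ^ r := fun x r => Real.rpow_nonneg (bracket_pos x).le _
  have hs : ∀ (x r : ℝ), √(bracket x ^ r) = bracket x ^ (r / 2) := fun x r => by
    rw [Real.sqrt_eq_rpow, ← Real.rpow_mul (bracket_pos x).le]; ring_nf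
  have e1 : -(1 + 2 * δ) / 2 = -(1 / 2 + δ) := by ring
  have e2 : -(1 - 2 * ε) / 2 = -1 / 2 + ε := by ring
  rw [kernelSq, Real.sqrt_mul (mul_nonneg (interactionWeight_nonneg _ _ _ _) (hn _ _)),
    Real.sqrt_mul (interactionWeight_nonneg _ _ _ _), Real.sqrt_mul (hn _ _), hs, hs, hs, e1, e2,
    Real.rpow_neg (bracket_pos _).le, Real.rpow_neg (bracket_pos _).le]

theorem weight_mul_le {s N : ℝ} {m : ℝ × ℝ → ℝ} (hm : IsSymbolI s N m) (hN : 1 ≤ N)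
    (hs : 9 / 10 ≤ s) (lam ε δ : ℝ) (U V : ℝ → ℤ → ℝ → ℂ) (z x : ℤ × (ℝ × ℝ)) :
    ENNReal.ofReal (bracket (z.2.2 - sigma z.2.1 (z.1 / lam)) ^ (-1 / 2 + ε) *
        (|z.2.1| * m (z.2.1, z.1 / lam) * zetaBracket z.2.1 (z.1 / lam))) *
      (‖U x.2.1 x.1 x.2.2‖ₑ * ‖V (z - x).2.1 (z - x).1 (z - x).2.2‖ₑ) ≤
    16 * (ENNReal.ofReal √(kernelSq lam (1 - 2 * ε) (1 + 2 * δ) interactionWeight z x) *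
      (weightedSize lam (1 / 2 + δ) m U x * weightedSize lam (1 / 2 + δ) m V (z - x))) := by
  have hm0 := hm.nonneg hN (by linarith)
  have h := hm.abs_mul_le hN hs z.2.1 (z.1 / lam) x.2.1 (x.1 / lam)
  have e : (((z - x).1 : ℤ) : ℝ) / lam = z.1 / lam - x.1 / lam := by
    rw [Prod.fst_sub]; push_cast; rw [sub_div]
  unfold weightedSize
  rw [e, sqrt_kernelSq, Prod.snd_sub, Prod.fst_sub z.2 x.2, Prod.snd_sub z.2 x.2]
  have hD := bracket_pos (z.2.2 - sigma z.2.1 (z.1 / lam))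
  have hD1 := bracket_pos (x.2.2 - sigma x.2.1 (x.1 / lam))
  have hD2 := bracket_pos (z.2.2 - x.2.2 - sigma (z.2.1 - x.2.1) (z.1 / lam - x.1 / lam))
  have n1 := mul_nonneg (hm0 x.2.1 (x.1 / lam)) (zetaBracket_pos x.2.1 (x.1 / lam)).le
  have n2 := mul_nonneg (hm0 (z.2.1 - x.2.1) (z.1 / lam - x.1 / lam))
    (zetaBracket_pos (z.2.1 - x.2.1) (z.1 / lam - x.1 / lam)).le
  set D := bracket (z.2.2 - sigma z.2.1 (z.1 / lam))
  set D1 := bracket (x.2.2 - sigma x.2.1 (x.1 / lam))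
  set D2 := bracket (z.2.2 - x.2.2 - sigma (z.2.1 - x.2.1) (z.1 / lam - x.1 / lam))
  set Q := √(interactionWeight z.2.1 (z.1 / lam) x.2.1 (x.1 / lam))
  have hQ : 0 ≤ Q := Real.sqrt_nonneg _
  set A1 := m (x.2.1, x.1 / lam) * zetaBracket x.2.1 (x.1 / lam)
  set A2 := m (z.2.1 - x.2.1, z.1 / lam - x.1 / lam) *
    zetaBracket (z.2.1 - x.2.1) (z.1 / lam - x.1 / lam)
  set P1 := D1 ^ (1 / 2 + δ)
  set P2 := D2 ^ (1 / 2 + δ)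
  have hP1 : 0 < P1 := by positivity
  have hP2 : 0 < P2 := by positivity
  have key : D ^ (-1 / 2 + ε) *
      (|z.2.1| * m (z.2.1, z.1 / lam) * zetaBracket z.2.1 (z.1 / lam)) ≤
      16 * ((Q * D ^ (-1 / 2 + ε) * (P1⁻¹ * P2⁻¹)) * ((P1 * A1) * (P2 * A2))) := by
    refine (mul_le_mul_of_nonneg_left h (Real.rpow_nonneg hD.le _)).trans (le_of_eq ?_)
    field_simp
  calc _ ≤ ENNReal.ofReal (16 * ((Q * D ^ (-1 / 2 + ε) * (P1⁻¹ * P2⁻¹)) *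
        ((P1 * A1) * (P2 * A2)))) *
        (‖U x.2.1 x.1 x.2.2‖ₑ * ‖V (z.2.1 - x.2.1) (z - x).1 (z.2.2 - x.2.2)‖ₑ) := by gcongr
    _ = _ := by
      rw [ENNReal.ofReal_mul (by norm_num), ENNReal.ofReal_mul (by positivity),
        ENNReal.ofReal_mul (mul_nonneg hP1.le n1), show ENNReal.ofReal 16 = 16 by simp]
      ring

theorem weight_mul_fourierIntegral_le {s N : ℝ} {m : ℝ × ℝ → ℝ} (hm : IsSymbolI s N m)
    (hN : 1 ≤ N) (hs : 9 / 10 ≤ s) (lam ε δ : ℝ) [Fact (1 < lam)] {u v : SpaceTime lam → ℂ}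
    (hu : MemLp u 2 volume) (hv : MemLp v 2 volume) {U V : ℝ → ℤ → ℝ → ℂ}
    (hU : IsFourierTransformL2 lam u U) (hV : IsFourierTransformL2 lam v V)
    (hUm : ∀ k : ℤ, Measurable fun z : ℝ × ℝ => U z.1 k z.2)
    (hVm : ∀ k : ℤ, Measurable fun z : ℝ × ℝ => V z.1 k z.2) (z : ℤ × (ℝ × ℝ)) :
    ENNReal.ofReal (bracket (z.2.2 - sigma z.2.1 (z.1 / lam)) ^ (-1 / 2 + ε) *
        (|z.2.1| * m (z.2.1, z.1 / lam) * zetaBracket z.2.1 (z.1 / lam))) *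
      ‖fourierIntegral lam (fun p => u p * v p) z.2.1 z.1 z.2.2‖ₑ ≤
    16 * (ENNReal.ofReal (1 / lam) * ∫⁻ x,
      ENNReal.ofReal √(kernelSq lam (1 - 2 * ε) (1 + 2 * δ) interactionWeight z x) *
      (weightedSize lam (1 / 2 + δ) m U x * weightedSize lam (1 / 2 + δ) m V (z - x))
        ∂freqMeasure) := by
  refine (mul_le_mul_right (enorm_fourierIntegral_mul_le hu hv hU hV hUm hVm z) _).trans ?_
  rw [mul_left_comm, mul_left_comm 16]
  refine mul_le_mul_right ?_ _
  rw [← lintegral_const_mul' _ _ ENNReal.ofReal_ne_top, ← lintegral_const_mul' _ _ (by simp)]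
  exact lintegral_mono fun x => weight_mul_le hm hN hs lam ε δ U V z x

theorem measurable_convolution {lam a p : ℝ} {F G : ℤ × (ℝ × ℝ) → ℝ≥0∞} (hF : Measurable F)
    (hG : Measurable G) : Measurable fun z => ∫⁻ x,
      ENNReal.ofReal √(kernelSq lam a p interactionWeight z x) * (F x * G (z - x))
        ∂freqMeasure := by
  have hk := measurable_kernelSq lam a p (w := interactionWeight) (by fun_prop)
  have h : Measurable fun y : (ℤ × (ℝ × ℝ)) × (ℤ × (ℝ × ℝ)) =>
      ENNReal.ofReal √(kernelSq lam a p interactionWeight y.1 y.2) * (F y.2 * G (y.1 - y.2)) :=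
    hk.sqrt.ennreal_ofReal.mul
      ((hF.comp measurable_snd).mul (hG.comp (measurable_fst.sub measurable_snd)))
  exact h.lintegral_prod_right'

theorem bourgainNorm_product_le {ε δ : ℝ} (hε : 0 < ε) (hε' : ε ≤ 1 / 120) (hδ : 0 < δ) :
    ∃ C : ℝ≥0, ∀ (s N : ℝ) (m : ℝ × ℝ → ℝ), 9 / 10 ≤ s → 1 ≤ N → IsSymbolI s N m →
      ∀ (lam : ℝ) [Fact (1 < lam)] (u v : SpaceTime lam → ℂ), MemLp u 2 volume →
        MemLp v 2 volume → ∀ U V : ℝ → ℤ → ℝ → ℂ, IsFourierTransformL2 lam u U →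
        IsFourierTransformL2 lam v V → (∀ k : ℤ, Measurable fun z : ℝ × ℝ => U z.1 k z.2) →
        (∀ k : ℤ, Measurable fun z : ℝ × ℝ => V z.1 k z.2) →
        bourgainNorm lam 1 (-1 / 2 + ε)
            (opDx (opI lam m (fourierIntegral lam (fun p => u p * v p)))) ≤
          C * bourgainNorm lam 1 (1 / 2 + δ) (opI lam m U) *
            bourgainNorm lam 1 (1 / 2 + δ) (opI lam m V) := by
  obtain ⟨C, hC, hb⟩ := exists_bilinear_bound hε hε' (p := 1 + 2 * δ) (by linarith)
  have hfin : (256 * C) ^ (1 / 2 : ℝ) ≠ ⊤ :=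
    ENNReal.rpow_ne_top_of_nonneg (by norm_num) (by finiteness)
  refine ⟨((256 * C) ^ (1 / 2 : ℝ)).toNNReal, ?_⟩
  intro s N m hs hN hm lam hlam u v hu hv U V hU hV hUm hVm
  have hm0 := hm.nonneg hN (by linarith)
  have mU := measurable_weightedSize (lam := lam) (b := 1 / 2 + δ) hm.measurable hUm
  have mV := measurable_weightedSize (lam := lam) (b := 1 / 2 + δ) hm.measurable hVm
  rw [ENNReal.coe_toNNReal hfin, bourgainNorm_opI_eq hm.measurable hm0 hUm,
    bourgainNorm_opI_eq hm.measurable hm0 hVm,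
    ← ENNReal.mul_rpow_of_nonneg _ _ (by norm_num : (0 : ℝ) ≤ 1 / 2),
    ← ENNReal.mul_rpow_of_nonneg _ _ (by norm_num : (0 : ℝ) ≤ 1 / 2), bourgainNorm]
  refine ENNReal.rpow_le_rpow ?_ (by norm_num)
  set G := weightedSize lam (1 / 2 + δ) m U
  set H := weightedSize lam (1 / 2 + δ) m V
  set c := ENNReal.ofReal (1 / lam)
  have hconv := measurable_convolution (lam := lam) (a := 1 - 2 * ε) (p := 1 + 2 * δ) mU mV
  calc _ ≤ c * ∑' k : ℤ, ∫⁻ z : ℝ × ℝ, 256 * (c * ∫⁻ x,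
        ENNReal.ofReal √(kernelSq lam (1 - 2 * ε) (1 + 2 * δ) interactionWeight (k, z) x) *
        (G x * H ((k, z) - x)) ∂freqMeasure) ^ 2 := by
        refine mul_le_mul_right (ENNReal.tsum_le_tsum fun k => lintegral_mono fun z => ?_) _
        have h := weight_mul_fourierIntegral_le hm hN hs lam ε δ hu hv hU hV hUm hVm (k, z)
        have hn : 0 ≤ |z.1| * m (z.1, k / lam) := mul_nonneg (abs_nonneg _) (hm0 _ _)
        have e := sq_bourgain_integrand (b := -1 / 2 + ε) z.1 (k / lam) z.2 hn
          (Complex.I * (z.1 : ℂ) * (m (z.1, k / lam) : ℂ))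
          (fourierIntegral lam (fun p => u p * v p) z.1 k z.2) (by
            rw [norm_mul, norm_mul, Complex.norm_I, one_mul, Complex.norm_real, Complex.norm_real,
              Real.norm_eq_abs, Real.norm_of_nonneg (hm0 _ _)])
        dsimp only [opDx, opI]
        rw [← mul_assoc (Complex.I * (z.1 : ℂ)), e]
        refine (pow_le_pow_left' h 2).trans (le_of_eq ?_)
        rw [mul_pow, show (16 : ℝ≥0∞) ^ 2 = 256 by norm_num]
    _ = c * ∫⁻ z, 256 * (c * ∫⁻ x,
        ENNReal.ofReal √(kernelSq lam (1 - 2 * ε) (1 + 2 * δ) interactionWeight z x) *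
        (G x * H (z - x)) ∂freqMeasure) ^ 2 ∂freqMeasure := by
        rw [lintegral_freqMeasure (((hconv.const_mul c).pow_const 2).const_mul 256)]
    _ = 256 * (c * ∫⁻ z, (c * ∫⁻ x,
        ENNReal.ofReal √(kernelSq lam (1 - 2 * ε) (1 + 2 * δ) interactionWeight z x) *
        (G x * H (z - x)) ∂freqMeasure) ^ 2 ∂freqMeasure) := by
        rw [lintegral_const_mul' _ _ (by simp), mul_left_comm]
    _ ≤ 256 * (C * ((c * ∫⁻ x, G x ^ 2 ∂freqMeasure) * (c * ∫⁻ x, H x ^ 2 ∂freqMeasure))) :=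
        mul_le_mul_right (hb lam hlam.out G H mU mV) _
    _ = _ := by ring

end ZK

theorem lemma3p5 (s : ℝ) (hs : 9 / 10 < s) :
    ∃ ε₀ : ℝ, 0 < ε₀ ∧ ∀ ε : ℝ, 0 < ε → ε ≤ ε₀ → ∀ δ : ℝ, 0 < δ →
      ∃ C : ℝ≥0, ∀ (j : ℕ) (m : ℝ × ℝ → ℝ), ZK.IsSymbolI s (2 ^ j) m →
        ∀ (lam : ℝ) [Fact (1 < lam)] (u v : ZK.SpaceTime lam → ℂ),
          MemLp u 2 volume → MemLp v 2 volume →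
          ∀ U V : ℝ → ℤ → ℝ → ℂ,
            ZK.IsFourierTransformL2 lam u U → ZK.IsFourierTransformL2 lam v V →
            ZK.bourgainNorm lam 1 (-1 / 2 + ε)
                (ZK.opDx (ZK.opI lam m (ZK.fourierIntegral lam (fun p => u p * v p)))) ≤
              C * ZK.bourgainNorm lam 1 (1 / 2 + δ) (ZK.opI lam m U) *
                ZK.bourgainNorm lam 1 (1 / 2 + δ) (ZK.opI lam m V) := by
  refine ⟨1 / 120, by norm_num, fun ε hε hε' δ hδ => ?_⟩
  obtain ⟨C, hC⟩ := ZK.bourgainNorm_product_le hε hε' hδ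
  refine ⟨C, fun j m hm lam _ u v hu hv U V hU hV => ?_⟩
  obtain ⟨U', hU', hUm, hUe⟩ := hU.exists_measurable
  obtain ⟨V', hV', hVm, hVe⟩ := hV.exists_measurable
  rw [ZK.bourgainNorm_opI_congr hUe, ZK.bourgainNorm_opI_congr hVe]
  exact hC s (2 ^ j) m hs.le (one_le_pow₀ one_le_two) hm lam u v hu hv U' V' hU' hV' hUm hVm
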